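/- Let $\mathbb{F}_q$ be a finite field with $q$ elements, $k_\infty$ the completion of $\mathbb{F}_q(\theta)$ at the infinite place, and $\mathbb{K}$ the completion of an algebraic closure of $k_\infty$, with absolute value normalized by $|\theta|=q$; put $\deg=\log_q|\cdot|$. Let $\mathbb{T}=\{\sum c_it^i\in\mathbb{K}[[t]] : |c_i|\to 0\}$ with the Gauss norm $\|\sum c_it^i\|=\max_i|c_i|$, extended to $\mathrm{Mat}_r(\mathbb{T})$ by taking the maximum over entries, and for $n\ge 0$ let $(\sum c_it^i)^{(n)}=\sum c_i^{q^n}t^i$, entrywise on matrices. Let $\phi:\mathbb{F}_q[t]\to\mathbb{K}[\tau]$ (where $\tau c=c^q\tau$) be a Drinfeld module of rank $r\ge 1$, $\phi_t=\theta+A_1\tau+\dots+A_r\tau^r$, $A_r\neq 0$, and put $A_0=\theta$. Write $\phi[a]=\{x\in\mathbb{K}:\phi_a(x)=0\}$, where $\sum b_i\tau^i$ acts on $\mathbb{K}$ by $x\mapsto\sum b_ix^{q^i}$, and let $$\Theta=\begin{pmatrix}0&1&\cdots&0\\ \vdots&\vdots&\ddots&\vdots\\ 0&0&\cdots&1\\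 (t-\theta)/A_r&-A_1/A_r&\cdots&-A_{r-1}/A_r\end{pmatrix}.$$ Let $(q^{d_0},-\deg A_{d_0}),\dots,(q^{d_s},-\deg A_{d_s})$, with $0=d_0<\dots<d_s=r$, be the vertices of the Newton polygon of $\phi_t(x)=\theta x+A_1x^q+\dots+A_rx^{q^r}$, and $\lambda_1<\dots<\lambda_s$ the slopes of its edges. An $\mathbb{F}_q$-basis $x_1,\dots,x_r$ of $\phi[t]$ is called strict if $\deg x_j=\lambda_k$ whenever $d_{k-1}+1\le j\le d_k$. Let $R_\phi=|\theta|^{-\mu}$, where $\mu=\max\{(\deg A_i-q^i)/(q^i-1): 1\le i\le r,\ A_i\ne 0\}$. Given a strict basis $x_1,\dots,x_r$, call $N\ge 1$ and $\xi_1,\dots,\xi_r\in\phi[t^N]$ admissible if for each $j$ $$|\xi_j|<R_\phi,\qquad \phi_{t^{N-1}}(\xi_j)=x_j,\qquad |\phi_{t^{N-1}}(\xi_j)|>\dots>|\phi_t(\xi_j)|>|\xi_j|.$$ (a) (The construction needs only finite initial data.) A strict basis of $\phi[t]$ exists, and for every strict basis $x_1,\dots,x_r$ and every integer $N\ge 1$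 with $N>\deg x_j-\log_q R_\phi+1$ for all $j$, there are $\xi_1,\dots,\xi_r$ such that $N,\xi_1,\dots,\xi_r$ are admissible. (b) For every strict basis $x_1,\dots,x_r$ and every admissible $N,\xi_1,\dots,\xi_r$, put $h_j=\phi_{t^{N-1}}(\xi_j)+\phi_{t^{N-2}}(\xi_j)t+\dots+\xi_jt^{N-1}\in\mathbb{K}[t]$ and $B=(h_j^{(i-1)})_{1\le i,j\le r}\in\mathrm{Mat}_r(\mathbb{K}[t])$. Then $B,\Theta\in\mathrm{GL}_r(\mathbb{T})$, and the infinite product $$\Pi=B\prod_{n=0}^{\infty}\bigl(B^{-1}\Theta^{-1}B^{(1)}\bigr)^{(n)}$$ (successive factors multiplied on the right) converges with respect to the Gauss norm on $\mathrm{Mat}_r(\mathbb{T})$ and lies in $\mathrm{GL}_r(\mathbb{T})$. Moreover $\Pi^{(1)}=\Theta\Pi$, and so $\Pi$ is a rigid analytic trivialization for $\phi$ with respect to $\Theta$; that is, in addition, on the $t$-motive $M(\phi)=\mathbb{K}[\tau]$, with $\mathbb{K}[t]$ acting by $ct^i\cdot m=c\,m\,\phi_{t^i}$, the elements $1,\tau,\dots,\tau^{r-1}$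 form a $\mathbb{K}[t]$-basis and left multiplication by $\tau$ is represented by $\Theta$: $\tau\mathbf{m}=\Theta\mathbf{m}$ for $\mathbf{m}=(1,\tau,\dots,\tau^{r-1})^{\mathrm{tr}}$. -/

import Mathlib

open scoped NNReal Topology Polynomial

noncomputable section

namespace DrinfeldRAT

/-! ### The fields `k_∞` and `𝕂` -/

section Fields

variable (Fq : Type*) [Field Fq] [Fintype Fq]

/-- `k_∞ = 𝔽_q((1/θ))`: the completion of `k = 𝔽_q(θ)` at its infinite place. -/
abbrev KInf : Type _ := @RatFunc.CompletionAtInfty Fq _ (Classical.decEq _)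

theorem one_lt_q : (1 : ℝ≥0) < (Fintype.card Fq : ℝ≥0) := by
  exact_mod_cast Fintype.one_lt_card

theorem kInf_v_coe (x : RatFunc Fq) :
    (Valued.v : Valuation (KInf Fq) (WithZero (Multiplicative ℤ)))
      (algebraMap (RatFunc Fq) (KInf Fq) x)
      = @RatFunc.inftyValuation Fq _ (Classical.decEq _) x := by
  let := Classical.decEq (RatFunc Fq)
  let := RatFunc.inftyValued Fq
  exact Valued.extensionValuation_apply_coe x

instance kInfNontrivial :
    (Valued.v : Valuation (KInf Fq) (WithZero (Multiplicative ℤ))).IsNontrivial where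
  exists_val_nontrivial := by
    let := Classical.decEq (RatFunc Fq)
    refine ⟨algebraMap (RatFunc Fq) (KInf Fq) RatFunc.X, ?_, ?_⟩ <;>
    · rw [kInf_v_coe, RatFunc.inftyValuation.X]
      decide

/-- The absolute value on `k_∞` is normalised by `|x| = q ^ (deg x)`, so that `|θ| = q`. -/
instance kInfRankOne :
    (Valued.v : Valuation (KInf Fq) (WithZero (Multiplicative ℤ))).RankOne where
  hom' := (WithZeroMulInt.toNNReal (one_lt_q Fq).ne_zero).comp
    (MonoidWithZeroHom.ValueGroup₀.embedding)
  strictMono' := (WithZeroMulInt.toNNReal_strictMono (one_lt_q Fq)).comp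
    MonoidWithZeroHom.ValueGroup₀.embedding_strictMono

instance kInfNormed : NontriviallyNormedField (KInf Fq) :=
  Valued.toNontriviallyNormedField (KInf Fq) (WithZero (Multiplicative ℤ))

instance kInfUltrametric : IsUltrametricDist (KInf Fq) :=
  inferInstanceAs (@IsUltrametricDist (KInf Fq)
    (Valued.toNormedField (KInf Fq) (WithZero (Multiplicative ℤ))).toMetricSpace.toDist)

instance kInfComplete : CompleteSpace (KInf Fq) := by
  let := Classical.decEq (RatFunc Fq)
  let := RatFunc.inftyValued Fq
  exact inferInstanceAs (CompleteSpace (UniformSpace.Completion (RatFunc Fq)))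

/-- An algebraic closure of `k_∞`, with the unique extension of the absolute value. -/
abbrev KInfAlg : Type _ := AlgebraicClosure (KInf Fq)

instance kInfAlgNormed : NormedField (KInfAlg Fq) :=
  spectralNorm.normedField (KInf Fq) (KInfAlg Fq)

instance kInfAlgUltrametric : IsUltrametricDist (KInfAlg Fq) :=
  IsUltrametricDist.isUltrametricDist_of_forall_norm_add_le_max_norm
    (isNonarchimedean_spectralNorm (K := KInf Fq) (L := KInfAlg Fq))

/-- `𝕂`: the completion of an algebraic closure of `k_∞`. -/
def KK : Type _ := UniformSpace.Completion (KInfAlg Fq)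

instance kkNormed : NormedField (KK Fq) :=
  inferInstanceAs (NormedField (UniformSpace.Completion (KInfAlg Fq)))

instance kkComplete : CompleteSpace (KK Fq) :=
  inferInstanceAs (CompleteSpace (UniformSpace.Completion (KInfAlg Fq)))

/-- The inclusion of the algebraic closure of `k_∞` into its completion `𝕂`. -/
def algToKK : KInfAlg Fq →+* KK Fq :=
  (UniformSpace.Completion.coeRingHom : KInfAlg Fq →+* UniformSpace.Completion (KInfAlg Fq))

instance kkUltrametric : IsUltrametricDist (KK Fq) := by
  refine IsUltrametricDist.isUltrametricDist_of_forall_norm_add_le_max_norm ?_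
  intro x y
  refine UniformSpace.Completion.induction_on₂
    (p := fun x y : UniformSpace.Completion (KInfAlg Fq) => ‖x + y‖ ≤ max ‖x‖ ‖y‖) x y ?_ ?_
  · exact isClosed_le (by fun_prop) (by fun_prop)
  · intro a b
    rw [← UniformSpace.Completion.coe_add]
    simpa only [UniformSpace.Completion.norm_coe] using
      IsUltrametricDist.norm_add_le_max a b

/-- The inclusion `k = 𝔽_q(θ) ⊆ 𝕂`. -/
def ratToKK : RatFunc Fq →+* KK Fq :=
  (algToKK Fq).comp ((algebraMap (KInf Fq) (KInfAlg Fq)).comp (algebraMap (RatFunc Fq) (KInf Fq)))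

instance kkAlgebra : Algebra Fq (KK Fq) :=
  ((ratToKK Fq).comp (algebraMap Fq (RatFunc Fq))).toAlgebra

/-- The element `θ ∈ 𝕂`. -/
def theta : KK Fq := ratToKK Fq RatFunc.X

variable {Fq}

/-- `deg x = -v_∞(x) = log_q |x|`, for nonzero `x` (it is only used for nonzero elements). -/
def deg (x : KK Fq) : ℝ := Real.logb (Fintype.card Fq) ‖x‖

end Fields

/-! ### Twisted polynomials -/

section Twisted

variable (Fq : Type*) [Field Fq] [Fintype Fq]

/-- The `q`-th power Frobenius of `𝕂`. -/
abbrev frob : KK Fq →ₐ[Fq] KK Fq := FiniteField.frobeniusAlgHom Fq (KK Fq)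

/-- `n` acts on `𝕂` as the `n`-th power of the Frobenius; this makes `SkewPolynomial (KK Fq)` the
ring `𝕂[τ]` with `τ c = c ^ q τ`. -/
instance kkFrobAction : MulSemiringAction (Multiplicative ℕ) (KK Fq) where
  smul n x := (frob Fq ^ n.toAdd) x
  one_smul _ := rfl
  mul_smul m n x := by
    change (frob Fq ^ (m.toAdd + n.toAdd)) x = (frob Fq ^ m.toAdd) ((frob Fq ^ n.toAdd) x)
    rw [pow_add, AlgHom.mul_apply]
  smul_zero n := map_zero (frob Fq ^ n.toAdd)
  smul_add n := map_add (frob Fq ^ n.toAdd)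
  smul_one n := map_one (frob Fq ^ n.toAdd)
  smul_mul n := map_mul (frob Fq ^ n.toAdd)

instance kkFrobComm : SMulCommClass (Multiplicative ℕ) Fq (KK Fq) where
  smul_comm n c x := map_smul (frob Fq ^ n.toAdd) c x

/-- The ring `𝕂[τ]` of twisted polynomials; `SkewPolynomial.X` is `τ`. -/
abbrev KTau : Type _ := SkewPolynomial (KK Fq)

variable {Fq}

/-- The additive polynomial function `Δ(x) = ∑ b_i x^(q^i)` attached to `Δ = ∑ b_i τ^i`. -/
def evalTau (Δ : KTau Fq) (x : KK Fq) : KK Fq :=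
  SkewPolynomial.sum Δ fun i b => b * x ^ (Fintype.card Fq) ^ i

end Twisted

/-! ### Drinfeld modules -/

/-- A Drinfeld module of rank `r` over `𝕂`: an `𝔽_q`-algebra homomorphism `φ : 𝔽_q[t] → 𝕂[τ]` with
`φ_t = θ + A_1 τ + ⋯ + A_r τ^r`, `A_r ≠ 0`, where `r ≥ 1`. -/
structure DrinfeldModule (Fq : Type*) [Field Fq] [Fintype Fq] (r : ℕ) where
  toAlgHom : Fq[X] →ₐ[Fq] KTau Fq
  rank_pos : 0 < r
  coeff_zero : SkewPolynomial.coeff (toAlgHom Polynomial.X) 0 = theta Fq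
  coeff_rank : SkewPolynomial.coeff (toAlgHom Polynomial.X) r ≠ 0
  coeff_gt : ∀ i, r < i → SkewPolynomial.coeff (toAlgHom Polynomial.X) i = 0

namespace DrinfeldModule

variable {Fq : Type*} [Field Fq] [Fintype Fq] {r : ℕ} (φ : DrinfeldModule Fq r)

/-- The coefficient `A_i` of `τ^i` in `φ_t` (with `A_0 = θ`). -/
def A (i : ℕ) : KK Fq := SkewPolynomial.coeff (φ.toAlgHom Polynomial.X) i

/-- The action `a · x = φ_a(x)` of `a ∈ 𝔽_q[t]` on `x ∈ 𝕂`. -/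
def act (a : Fq[X]) (x : KK Fq) : KK Fq := evalTau (φ.toAlgHom a) x

/-- The torsion points `φ[a] = {x ∈ 𝕂 : φ_a(x) = 0}`. -/
def torsion (a : Fq[X]) : Set (KK Fq) := {x | φ.act a x = 0}

/-- The slope of the segment joining `(q^n, -deg A_n)` and `(q^m, -deg A_m)`. -/
def slope (n m : ℕ) : ℝ :=
  (-deg (φ.A m) - -deg (φ.A n)) / ((Fintype.card Fq : ℝ) ^ m - (Fintype.card Fq : ℝ) ^ n)

/-- `(q^{d_0}, -deg A_{d_0}), …, (q^{d_s}, -deg A_{d_s})` are the vertices, from left to right, of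
the Newton polygon of `φ_t(x) = θ x + A_1 x^q + ⋯ + A_r x^{q^r}`, i.e. of the lower boundary of the
convex hull of the points `(q^i, -deg A_i)`, `A_i ≠ 0`, `0 ≤ i ≤ r`: they are among these points,
start and end at the extreme ones, successive edges have strictly increasing slopes, and all
points lie on or above the line through each edge. -/
structure IsNewtonVertices (s : ℕ) (d : Fin (s + 1) → ℕ) : Prop where
  first : d 0 = 0
  last : d (Fin.last s) = r
  strictMono : StrictMono d
  ne_zero : ∀ k, φ.A (d k) ≠ 0
  slope_strictMono : StrictMono fun k : Fin s => φ.slope (d k.castSucc) (d k.succ)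
  le_points : ∀ k : Fin s, ∀ i ≤ r, φ.A i ≠ 0 →
    -deg (φ.A (d k.castSucc)) + φ.slope (d k.castSucc) (d k.succ) *
      ((Fintype.card Fq : ℝ) ^ i - (Fintype.card Fq : ℝ) ^ d k.castSucc) ≤ -deg (φ.A i)

/-- `x_1, …, x_r` is a strict basis of `φ[t]`: an `𝔽_q`-basis such that `deg x_j = λ_k` whenever
`d_{k-1} + 1 ≤ j ≤ d_k`, where `λ_k` is the slope of the `k`-th edge of the Newton polygon.
(Here `j : Fin r` starts at `0`.) -/
structure IsStrictBasis (x : Fin r → KK Fq) : Prop where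
  linearIndependent : LinearIndependent Fq x
  span_eq : (Submodule.span Fq (Set.range x) : Set (KK Fq)) = φ.torsion Polynomial.X
  strict : ∃ (s : ℕ) (d : Fin (s + 1) → ℕ), φ.IsNewtonVertices s d ∧
    ∀ (k : Fin s) (j : Fin r), d k.castSucc ≤ (j : ℕ) → (j : ℕ) < d k.succ →
      deg (x j) = φ.slope (d k.castSucc) (d k.succ)

/-- `μ_n = (deg A_n - q^n) / (q^n - 1)`. -/
def mu (n : ℕ) : ℝ :=
  (deg (φ.A n) - (Fintype.card Fq : ℝ) ^ n) / ((Fintype.card Fq : ℝ) ^ n - 1)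

/-- `R_φ = |θ|^(-μ_m)`, where `μ_m` is the largest of the `μ_i` with `1 ≤ i ≤ r`, `A_i ≠ 0`. -/
def R : ℝ := ‖theta Fq‖ ^ (-sSup (φ.mu '' {i | 1 ≤ i ∧ i ≤ r ∧ φ.A i ≠ 0}))

/-- The points `ξ_1, …, ξ_r ∈ φ[t^N]` lie suitably over `x_1, …, x_r`: `|ξ_j| < R_φ`,
`φ_{t^{N-1}}(ξ_j) = x_j` and `|φ_{t^{N-1}}(ξ_j)| > ⋯ > |φ_t(ξ_j)| > |ξ_j|`. -/
structure IsDivisionData (x : Fin r → KK Fq) (N : ℕ) (ξ : Fin r → KK Fq) : Prop where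
  one_le : 1 ≤ N
  mem_torsion : ∀ j, ξ j ∈ φ.torsion (Polynomial.X ^ N)
  norm_lt : ∀ j, ‖ξ j‖ < φ.R
  act_eq : ∀ j, φ.act (Polynomial.X ^ (N - 1)) (ξ j) = x j
  norm_act_lt : ∀ j, ∀ k, k + 1 ≤ N - 1 →
    ‖φ.act (Polynomial.X ^ k) (ξ j)‖ < ‖φ.act (Polynomial.X ^ (k + 1)) (ξ j)‖

/-- `h = φ_{t^{N-1}}(ξ) + φ_{t^{N-2}}(ξ) t + ⋯ + ξ t^{N-1} ∈ 𝕂[t]`. -/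
def h (N : ℕ) (ξ : KK Fq) : (KK Fq)[X] :=
  ∑ m ∈ Finset.range N,
    Polynomial.C (φ.act (Polynomial.X ^ (N - 1 - m)) ξ) * Polynomial.X ^ m

/-- The matrix `B = (h_j^{(i-1)}) ∈ Mat_r(𝕂[t])` (with `i : Fin r` starting at `0`). -/
def B (N : ℕ) (ξ : Fin r → KK Fq) : Matrix (Fin r) (Fin r) (KK Fq)[X] :=
  Matrix.of fun i j => (φ.h N (ξ j)).map ((frob Fq ^ (i : ℕ) : KK Fq →ₐ[Fq] KK Fq) : KK Fq →+* KK Fq)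

/-- The matrix `Θ ∈ Mat_r(𝕂[t])`, with ones above the diagonal, last row
`((t - θ)/A_r, -A_1/A_r, …, -A_{r-1}/A_r)`, and zeros elsewhere. -/
def Theta : Matrix (Fin r) (Fin r) (KK Fq)[X] :=
  Matrix.of fun i j =>
    if (i : ℕ) + 1 < r then (if (j : ℕ) = i + 1 then 1 else 0)
    else if (j : ℕ) = 0 then Polynomial.C (φ.A r)⁻¹ * (Polynomial.X - Polynomial.C (theta Fq))
    else -Polynomial.C (φ.A j / φ.A r)

/-! ### The `t`-motive -/

/-- Right multiplication by `φ_t` on `𝕂[τ]`, as a left `𝕂`-linear map. -/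
def mulRight : KTau Fq →ₗ[KK Fq] KTau Fq where
  toFun m := m * φ.toAlgHom Polynomial.X
  map_add' := fun a b => add_mul a b _
  map_smul' := fun c m => smul_mul_assoc c m _

/-- The `t`-motive `M(φ)`: the left `𝕂[τ]`-module `𝕂[τ]` with the `𝕂[t]`-module structure
`c t^i · m = c m φ_{t^i}`. -/
abbrev TMotive : Type _ := Module.AEval' φ.mulRight

/-- Left multiplication by `τ` on `M(φ)`. -/
def tau (m : φ.TMotive) : φ.TMotive :=
  Module.AEval'.of φ.mulRight
    ((SkewPolynomial.X : KTau Fq) * (Module.AEval'.of φ.mulRight).symm m)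

/-- The family `1, τ, …, τ^{r-1}` of elements of `M(φ)`. -/
def tauPowers (i : Fin r) : φ.TMotive :=
  Module.AEval'.of φ.mulRight ((SkewPolynomial.X : KTau Fq) ^ (i : ℕ))

end DrinfeldModule

/-! ### The Tate algebra -/

section Tate

variable (Fq : Type*) [Field Fq] [Fintype Fq]

/-- The Tate algebra `𝕋 = {∑ c_i t^i ∈ 𝕂⟦t⟧ : |c_i| → 0}`. -/
abbrev tate : Subring (PowerSeries (KK Fq)) := PowerSeries.IsRestricted.subring 1

theorem mem_tate_iff (f : PowerSeries (KK Fq)) :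
    f ∈ tate Fq ↔ Filter.Tendsto (fun i => ‖PowerSeries.coeff i f‖) Filter.atTop (𝓝 0) := by
  have : f ∈ tate Fq ↔ PowerSeries.IsRestricted 1 f := Iff.rfl
  rw [this, PowerSeries.isRestricted_iff']
  simp

/-- The Frobenius twist `∑ c_i t^i ↦ ∑ c_i^q t^i` on `𝕋`; its `n`-th power is `f ↦ f^{(n)}`. -/
def twist : tate Fq →+* tate Fq :=
  (PowerSeries.map (frob Fq : KK Fq →+* KK Fq)).restrict (tate Fq) (tate Fq) (by
    intro f hf
    rw [mem_tate_iff] at hf ⊢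
    have h0 : Fintype.card Fq ≠ 0 := Fintype.card_ne_zero
    simpa [h0] using hf.pow (Fintype.card Fq))

/-- The inclusion `𝕂[t] ⊆ 𝕋`. -/
def polyToTate : (KK Fq)[X] →+* tate Fq :=
  (Polynomial.coeToPowerSeries.ringHom (R := KK Fq)).codRestrict (tate Fq) (by
    intro f
    rw [mem_tate_iff]
    refine tendsto_const_nhds.congr' ?_
    filter_upwards [Filter.eventually_gt_atTop f.natDegree] with i hi
    simp [Polynomial.coeff_eq_zero_of_natDegree_lt hi])

variable {Fq}

/-- The Gauss norm `‖∑ c_i t^i‖ = sup |c_i|` on `𝕋`. -/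
def gaussNorm (f : tate Fq) : ℝ := PowerSeries.gaussNorm (fun c : KK Fq => ‖c‖) 1 (f : PowerSeries (KK Fq))

variable {r : ℕ}

/-- The Gauss norm `‖F‖ = max_{i,j} ‖f_ij‖` on `Mat_r(𝕋)`. -/
def matNorm (F : Matrix (Fin r) (Fin r) (tate Fq)) : ℝ := ⨆ ij : Fin r × Fin r, gaussNorm (F ij.1 ij.2)

/-- The `n`-th Frobenius twist `F^{(n)}` of a matrix over `𝕋`. -/
def matTwist (n : ℕ) (F : Matrix (Fin r) (Fin r) (tate Fq)) : Matrix (Fin r) (Fin r) (tate Fq) :=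
  F.map (twist Fq ^ n : tate Fq →+* tate Fq)

/-- The partial product `F F^{(1)} ⋯ F^{(n-1)}`, successive factors multiplied on the right. -/
def twistProd (F : Matrix (Fin r) (Fin r) (tate Fq)) (n : ℕ) : Matrix (Fin r) (Fin r) (tate Fq) :=
  ((List.range n).map fun k => matTwist k F).prod

/-- The infinite product `∏_{n ≥ 0} F^{(n)}` converges to `P` for the Gauss norm. -/
def HasTwistProd (F P : Matrix (Fin r) (Fin r) (tate Fq)) : Prop :=
  Filter.Tendsto (fun n => matNorm (twistProd F n - P)) Filter.atTop (𝓝 0)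

/-- A matrix over `𝕂[t]` viewed as a matrix over `𝕋`. -/
def toTate (F : Matrix (Fin r) (Fin r) (KK Fq)[X]) : Matrix (Fin r) (Fin r) (tate Fq) :=
  F.map (polyToTate Fq)

/-- `Υ` is a rigid analytic trivialization of the `t`-motive `M(φ)` with respect to `Θ`: there
`m` is a `𝕂[t]`-basis of `M(φ)`, `Θ` represents multiplication by `τ` in the sense `τ m = Θ m`, and
`Υ ∈ GL_r(𝕋)` satisfies `Υ^{(1)} = Θ Υ`. -/
structure IsRigidAnalyticTrivialization (φ : DrinfeldModule Fq r) (m : Fin r → φ.TMotive)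
    (Θ : Matrix (Fin r) (Fin r) (KK Fq)[X]) (Υ : Matrix (Fin r) (Fin r) (tate Fq)) : Prop where
  linearIndependent : LinearIndependent (KK Fq)[X] m
  span_eq : Submodule.span (KK Fq)[X] (Set.range m) = ⊤
  tau_eq : ∀ i, φ.tau (m i) = ∑ j, Θ i j • m j
  isUnit : IsUnit Υ
  twist_eq : matTwist 1 Υ = toTate Θ * Υ

end Tate

end DrinfeldRAT

end

/-! The field `KK` is algebraically closed and `φ_t(x)` is separable (its derivative is `θ`), so
`φ[t]` has dimension `r` over `𝔽_q`. The notion behind everything is orthogonality: a combination of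
basis vectors is never shorter than a vector occurring in it. A basis minimising the sum of the
norms is orthogonal. If it is also sorted, expanding `A_r ∏ (y - v)`, `v ∈ φ[t]`, one basis vector
at a time bounds every `|A_i|`, with equality at the indices where the norms jump. The Newton
polygon can then be read off, and the basis is strict (`exists_isNewtonVertices`). Conversely the
polygon of a strict basis forces the product of the norms to take its extremal value, so strict
bases are orthogonal (`IsStrictBasis.isOrtho`). Division points come from choosing smallest
preimages: each division by `t` shrinks the norm by a factor at least `|θ|`
(`IsAdditivePoly.exists_small_root`).

For part (b), `φ_t` applied to the coefficients of `h_j` gives `t h_j - ξ_j t^N`. Hence `B^{(1)} = Θ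
B` up to the last row, and `Θ⁻¹ B^{(1)} = B + Z`, where `Z` has only a first row, with entries `-ξ_j
t^N / (t - θ)` of norm at most `|ξ_j| / |θ|`. The factor minus `1` is therefore `B⁻¹ Z`, and only
the first column of `B⁻¹` matters. Its entries have norm at most `1 / |x_l|`
(`isUnit_B_and_inv_le`): the Lagrange polynomials of the orthogonal basis turn the constant term of
`B` into the identity, and the higher terms are small in a weighted norm. Every nonzero point of
`φ[t]` has norm at least `R_φ / |θ|` (`R_le_of_act_eq_zero`), so `|ξ_j| < R_φ` makes the factor `F`
satisfy `‖F - 1‖ < 1`.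

Twisting raises Gauss norms to `q`-th powers, so the product converges to an invertible `P` with `P
= F P^{(1)}` (`exists_hasTwistProd`), and `Π = B P` satisfies `Π^{(1)} = Θ Π`. The statement on the
`t`-motive is a comparison of degrees in `τ`. -/

open scoped NNReal Topology Polynomial

noncomputable section

set_option linter.unusedSectionVars false

/-! ### Algebraic closedness of `𝕂` and the normalisation `|θ| = q` -/

namespace DrinfeldRAT

/-- A complete nonarchimedean field with a dense algebraically closed subfield is algebraically
closed, in any characteristic. -/
theorem isAlgClosed_of_denseRange {K L : Type*} [Field K] [IsAlgClosed K]
    [NontriviallyNormedField L] [CompleteSpace L] [IsUltrametricDist L] [Algebra K L]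
    (hi : DenseRange (algebraMap K L)) : IsAlgClosed L := by
  apply IsAlgClosed.of_exists_root
  intro f fmon firr
  have fnatdeg0 : f.natDegree ≠ 0 := (Irreducible.natDegree_pos firr).ne'
  let F := f.SplittingField
  let : NormedField F := spectralNorm.normedField L F
  let : NormedAlgebra L F := spectralNorm.normedAlgebra L F
  obtain ⟨a, ha⟩ := (Polynomial.SplittingField.splits f).exists_eval_eq_zero
    (by simpa using Polynomial.degree_ne_of_natDegree_ne fnatdeg0)
  have fa0 : f.aeval a = 0 := by
    rwa [← Polynomial.eval_map_algebraMap]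
  have hclosed : IsClosed (Set.range (algebraMap L F)) :=
    (algebraMap_isometry L F).isClosedEmbedding.isClosed_range
  have hmem : a ∈ closure (Set.range (algebraMap L F)) := by
    rw [Metric.mem_closure_iff]
    intro δ hδ
    have hM : 0 < max ‖a‖ 1 := by positivity
    -- The tolerance is reverse-engineered: continuity of roots multiplies it by `n + 1`, takes the
    -- `n`-th root and multiplies by `max ‖a‖ 1`, which leaves exactly `δ`.
    have hε : (δ / (max ‖a‖ 1)) ^ f.natDegree / (f.natDegree + 1) > 0 := by positivity
    obtain ⟨g, gmon, gdeg, gcoeff⟩ :=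
      Polynomial.exists_monic_and_natDegree_eq_and_norm_map_algebraMap_coeff_sub_lt hi fmon hε
    obtain ⟨b, hb, hab⟩ := Polynomial.exists_aroots_norm_sub_lt_of_norm_coeff_sub_lt
      hε fa0 fmon (gmon.map _) (gdeg ▸ (g.natDegree_map _)) gcoeff
      (by simpa [Polynomial.map_map] using
        (IsAlgClosed.splits g).map ((algebraMap L F).comp (algebraMap K L)))
    rw [mul_div_cancel₀ _ (by positivity), Real.pow_rpow_inv_natCast (by positivity) fnatdeg0,
      div_mul_cancel₀ _ hM.ne'] at hab
    rw [Polynomial.aroots_def, Polynomial.Splits.roots_map ((IsAlgClosed.splits g).map _),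
      Multiset.mem_map] at hb
    obtain ⟨c, _, rfl⟩ := hb
    exact ⟨_, ⟨c, rfl⟩, by rwa [dist_eq_norm]⟩
  rw [hclosed.closure_eq] at hmem
  obtain ⟨c, rfl⟩ := hmem
  refine ⟨c, ?_⟩
  apply (algebraMap L F).injective
  rwa [map_zero, ← Polynomial.aeval_algebraMap_apply_eq_algebraMap_eval]

variable (Fq : Type*) [Field Fq] [Fintype Fq]

theorem norm_algToKK (x : KInfAlg Fq) : ‖algToKK Fq x‖ = ‖x‖ :=
  UniformSpace.Completion.norm_coe (E := KInfAlg Fq) x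

theorem norm_algebraMap_kInfAlg (x : KInf Fq) : ‖algebraMap (KInf Fq) (KInfAlg Fq) x‖ = ‖x‖ :=
  spectralNorm_extends (K := KInf Fq) (L := KInfAlg Fq) x

theorem norm_theta : ‖theta Fq‖ = Fintype.card Fq := by
  have h : ‖theta Fq‖ = ‖algebraMap (RatFunc Fq) (KInf Fq) RatFunc.X‖ := by
    rw [theta, ratToKK, RingHom.comp_apply, RingHom.comp_apply, norm_algToKK,
      norm_algebraMap_kInfAlg]
  rw [h]
  change ((WithZeroMulInt.toNNReal (one_lt_q Fq).ne_zero
    (MonoidWithZeroHom.ValueGroup₀.embedding ((Valued.v : Valuation (KInf Fq) _).restrict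
      (algebraMap (RatFunc Fq) (KInf Fq) RatFunc.X))) : ℝ≥0) : ℝ) = _
  rw [Valuation.embedding_restrict, kInf_v_coe, RatFunc.inftyValuation.X,
    WithZeroMulInt.toNNReal_neg_apply _ (by simp)]
  have : (WithZero.unzero (show (WithZero.exp (1 : ℤ)) ≠ 0 by simp)).toAdd = 1 := rfl
  simp [this]

instance kkIsAlgClosed : IsAlgClosed (KK Fq) := by
  let : NontriviallyNormedField (KK Fq) :=
    { kkNormed Fq with
      non_trivial := ⟨theta Fq, by
        have := norm_theta Fq
        change 1 < ‖theta Fq‖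
        rw [this]
        exact_mod_cast Fintype.one_lt_card⟩ }
  let : Algebra (KInfAlg Fq) (KK Fq) := (algToKK Fq).toAlgebra
  exact isAlgClosed_of_denseRange (K := KInfAlg Fq)
    (UniformSpace.Completion.denseRange_coe (α := KInfAlg Fq))

end DrinfeldRAT

namespace DrinfeldRAT

/-! ### Additive polynomials and products over finite `𝔽_q`-spaces -/

section Additive

variable {Fq K ι : Type*} [Field Fq] [Fintype Fq] [Field K] [Algebra Fq K]

theorem add_pow_card (y z : K) :
    (y + z) ^ Fintype.card Fq = y ^ Fintype.card Fq + z ^ Fintype.card Fq :=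
  map_add (FiniteField.frobeniusAlgHom Fq K) y z

theorem smul_pow_card (a : Fq) (y : K) :
    (a • y) ^ Fintype.card Fq = a • y ^ Fintype.card Fq :=
  map_smul (FiniteField.frobeniusAlgHom Fq K) a y

theorem sum_pow_card {κ : Type*} (s : Finset κ) (f : κ → K) :
    (∑ i ∈ s, f i) ^ Fintype.card Fq = ∑ i ∈ s, f i ^ Fintype.card Fq :=
  map_sum (FiniteField.frobeniusAlgHom Fq K) f s

theorem add_pow_card_pow (n : ℕ) (y z : K) :
    (y + z) ^ Fintype.card Fq ^ n = y ^ Fintype.card Fq ^ n + z ^ Fintype.card Fq ^ n := by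
  induction n with
  | zero => simp
  | succ n ih => rw [pow_succ, pow_mul, pow_mul, pow_mul, ih, add_pow_card]

theorem smul_pow_card_pow (n : ℕ) (a : Fq) (y : K) :
    (a • y) ^ Fintype.card Fq ^ n = a • y ^ Fintype.card Fq ^ n := by
  induction n with
  | zero => simp
  | succ n ih => rw [pow_succ, pow_mul, pow_mul, ih, smul_pow_card]

theorem prod_X_sub_C_card :
    ∏ c : Fq, (Polynomial.X - Polynomial.C c) = Polynomial.X ^ Fintype.card Fq - Polynomial.X := by
  have hq : 1 < Fintype.card Fq := Fintype.one_lt_card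
  have := Polynomial.prod_multiset_X_sub_C_of_monic_of_roots_card_eq
    (p := (Polynomial.X ^ Fintype.card Fq - Polynomial.X : Fq[X]))
    (Polynomial.monic_X_pow_sub (by simpa using hq))
    (by rw [FiniteField.roots_X_pow_card_sub_X, FiniteField.X_pow_card_sub_X_natDegree_eq _ hq]
        rfl)
  rwa [FiniteField.roots_X_pow_card_sub_X] at this

/-- This is the homogeneous form of `∏ (X - c) = X^q - X`, obtained by evaluating at `y / z`. -/
theorem prod_sub_smul (y z : K) :
    ∏ c : Fq, (y - c • z) = y ^ Fintype.card Fq - z ^ (Fintype.card Fq - 1) * y := by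
  have hq : 1 < Fintype.card Fq := Fintype.one_lt_card
  rcases eq_or_ne z 0 with rfl | hz
  · simp [Nat.sub_ne_zero_of_lt hq]
  · have h : ∀ u : K, ∏ c : Fq, (u - algebraMap Fq K c) = u ^ Fintype.card Fq - u := by
      intro u
      have := congrArg (Polynomial.aeval u) (prod_X_sub_C_card (Fq := Fq))
      simpa [map_prod] using this
    have h1 : ∏ c : Fq, (y - c • z) = ∏ c : Fq, (z * (y / z - algebraMap Fq K c)) := by
      refine Finset.prod_congr rfl fun c _ => ?_
      rw [Algebra.smul_def]
      field_simp
    rw [h1, Finset.prod_mul_distrib, h, Finset.prod_const, Finset.card_univ, mul_sub, div_pow,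
      mul_div_cancel₀ _ (pow_ne_zero _ hz)]
    congr 1
    obtain ⟨m, hm⟩ := Nat.exists_eq_add_of_lt hq
    rw [hm, show 1 + m + 1 - 1 = m + 1 by omega, show 1 + m + 1 = (m + 1) + 1 by omega,
      pow_succ _ (m + 1)]
    field_simp

/-- `f` is the function `y ↦ ∑_{i ≤ n} c_i y^(q^i)`. -/
def IsAdditivePoly (Fq : Type*) [Fintype Fq] (n : ℕ) (c : ℕ → K) (f : K → K) : Prop :=
  ∀ y, f y = ∑ i ∈ Finset.range (n + 1), c i * y ^ Fintype.card Fq ^ i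

theorem IsAdditivePoly.map_add {n : ℕ} {c : ℕ → K} {f : K → K} (h : IsAdditivePoly Fq n c f)
    (y z : K) : f (y + z) = f y + f z := by
  simp only [h _, add_pow_card_pow, mul_add, Finset.sum_add_distrib]

theorem IsAdditivePoly.map_smul {n : ℕ} {c : ℕ → K} {f : K → K} (h : IsAdditivePoly Fq n c f)
    (a : Fq) (y : K) : f (a • y) = a • f y := by
  simp only [h _, smul_pow_card_pow, mul_smul_comm, Finset.smul_sum]

theorem IsAdditivePoly.map_sub {n : ℕ} {c : ℕ → K} {f : K → K} (h : IsAdditivePoly Fq n c f)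
    (y z : K) : f (y - z) = f y - f z := by
  rw [eq_sub_iff_add_eq, ← h.map_add, sub_add_cancel]

theorem IsAdditivePoly.map_sub_smul {n : ℕ} {c : ℕ → K} {f : K → K}
    (h : IsAdditivePoly Fq n c f) (a : Fq) (y z : K) : f (y - a • z) = f y - a • f z := by
  rw [h.map_sub, h.map_smul]

/-- The coefficients of `f^q - w^(q-1) f` in terms of those of `f`. -/
def stepCoeff (Fq : Type*) [Fintype Fq] (w : K) (c : ℕ → K) : ℕ → K
  | 0 => -(w ^ (Fintype.card Fq - 1) * c 0)
  | i + 1 => c i ^ Fintype.card Fq - w ^ (Fintype.card Fq - 1) * c (i + 1)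

theorem IsAdditivePoly.step {n : ℕ} {c : ℕ → K} {f : K → K} (h : IsAdditivePoly Fq n c f)
    (hc : c (n + 1) = 0) (w : K) :
    IsAdditivePoly Fq (n + 1) (stepCoeff Fq w c)
      (fun y => f y ^ Fintype.card Fq - w ^ (Fintype.card Fq - 1) * f y) := by
  intro y
  -- Since `c (n + 1) = 0`, the sum may be given one more term, so that it runs over the same
  -- exponents as `f y ^ q`.
  have h2 : f y = ∑ i ∈ Finset.range (n + 1), c (i + 1) * y ^ Fintype.card Fq ^ (i + 1)
      + c 0 * y := by
    have : ∑ i ∈ Finset.range (n + 2), c i * y ^ Fintype.card Fq ^ i = f y := by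
      rw [Finset.sum_range_succ, hc, h y]; ring
    rw [← this, Finset.sum_range_succ']; simp
  have h1 : f y ^ Fintype.card Fq =
      ∑ i ∈ Finset.range (n + 1), c i ^ Fintype.card Fq * y ^ Fintype.card Fq ^ (i + 1) := by
    rw [h y, sum_pow_card]
    refine Finset.sum_congr rfl fun i _ => ?_
    rw [mul_pow, ← pow_mul, ← pow_succ]
  rw [Finset.sum_range_succ']
  simp only [h1, stepCoeff, sub_mul, Finset.sum_sub_distrib]
  conv_lhs => rw [h2]
  rw [mul_add, Finset.mul_sum]
  simp only [pow_zero, pow_one, mul_assoc]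
  ring

variable [Fintype ι]

open Classical in
/-- The coordinate vectors supported in `s`. -/
def coordSet (Fq : Type*) [Field Fq] [Fintype Fq] (s : Finset ι) : Finset (ι → Fq) :=
  Finset.univ.filter fun a => ∀ i ∉ s, a i = 0

theorem mem_coordSet {s : Finset ι} {a : ι → Fq} : a ∈ coordSet Fq s ↔ ∀ i ∉ s, a i = 0 := by
  simp [coordSet]

theorem zero_mem_coordSet (s : Finset ι) : (0 : ι → Fq) ∈ coordSet Fq s := by
  simp [mem_coordSet]

theorem coordSet_empty : coordSet Fq (∅ : Finset ι) = {0} := by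
  ext a; simp [mem_coordSet, funext_iff]

/-- `∏ (y - v)`, where `v` runs over the `𝔽_q`-linear combinations of the `x_i`, `i ∈ s`. -/
def shiftProd (Fq : Type*) [Field Fq] [Fintype Fq] [Algebra Fq K] (x : ι → K) (s : Finset ι)
    (y : K) : K :=
  ∏ a ∈ coordSet Fq s, (y - ∑ i, a i • x i)

theorem shiftProd_empty (x : ι → K) (y : K) : shiftProd Fq x ∅ y = y := by
  simp [shiftProd, coordSet_empty]

variable [DecidableEq ι]

theorem prod_coordSet_insert {M : Type*} [CommMonoid M] {s : Finset ι} {j : ι} (hj : j ∉ s)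
    (f : (ι → Fq) → M) :
    ∏ a ∈ coordSet Fq (insert j s), f a =
      ∏ c : Fq, ∏ b ∈ coordSet Fq s, f (Function.update b j c) := by
  rw [← Finset.prod_product']
  symm
  refine Finset.prod_bij' (fun p _ => Function.update p.2 j p.1)
    (fun a _ => (a j, Function.update a j 0)) ?_ ?_ ?_ ?_ ?_
  · rintro ⟨c, b⟩ h
    simp only [Finset.mem_product, Finset.mem_univ, true_and, mem_coordSet] at h
    simp only [mem_coordSet, Finset.mem_insert, not_or]
    rintro i ⟨hij, his⟩
    rw [Function.update_of_ne hij, h i his]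
  · intro a h
    simp only [mem_coordSet, Finset.mem_insert, not_or] at h
    simp only [Finset.mem_product, Finset.mem_univ, true_and, mem_coordSet]
    intro i his
    rcases eq_or_ne i j with rfl | hij
    · simp
    · rw [Function.update_of_ne hij, h i ⟨hij, his⟩]
  · rintro ⟨c, b⟩ h
    simp only [Finset.mem_product, Finset.mem_univ, true_and, mem_coordSet] at h
    have := h j hj
    simp [← this]
  · intro a h
    simp
  · rintro ⟨c, b⟩ h
    rfl

theorem sum_update_smul {b : ι → Fq} {j : ι} (hb : b j = 0) (c : Fq) (x : ι → K) :
    ∑ i, Function.update b j c i • x i = c • x j + ∑ i, b i • x i := by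
  have h : Function.update b j c = Pi.single j c + b := by
    ext i
    rcases eq_or_ne i j with rfl | hij
    · simp [hb]
    · simp [hij]
  simp only [h, Pi.add_apply, add_smul, Finset.sum_add_distrib]
  congr 1
  rw [Finset.sum_eq_single j] <;> simp +contextual

/-- The combinations of `insert j s` are the translates by `c • x j` of those of `s`. By additivity
of `e = shiftProd x s`, the product is `∏_c (e y - c • e (x j))`, to which `prod_sub_smul` applies.
The `x i` need not be independent. -/
theorem shiftProd_insert {x : ι → K} {s : Finset ι} {n : ℕ} {c : ℕ → K}
    (h : IsAdditivePoly Fq n c (shiftProd Fq x s)) {j : ι} (hj : j ∉ s) (y : K) :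
    shiftProd Fq x (insert j s) y = shiftProd Fq x s y ^ Fintype.card Fq -
      shiftProd Fq x s (x j) ^ (Fintype.card Fq - 1) * shiftProd Fq x s y := by
  rw [← prod_sub_smul]
  simp only [← h.map_sub_smul]
  rw [shiftProd, prod_coordSet_insert hj]
  refine Finset.prod_congr rfl fun c _ => Finset.prod_congr rfl fun b hb => ?_
  rw [sum_update_smul (mem_coordSet.1 hb j hj), sub_sub]

end Additive

section AdditiveExists

variable {Fq K ι : Type*} [Field Fq] [Fintype Fq] [Field K] [Algebra Fq K] [Fintype ι]

/-- `∏ (y - v)` over a finite `𝔽_q`-subspace is an additive polynomial in `y`. -/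
theorem exists_isAdditivePoly_shiftProd (x : ι → K) (s : Finset ι) :
    ∃ c : ℕ → K, (∀ i, s.card < i → c i = 0) ∧ c s.card = 1 ∧
      IsAdditivePoly Fq s.card c (shiftProd Fq x s) := by
  classical
  induction s using Finset.induction_on with
  | empty =>
    refine ⟨fun i => if i = 0 then 1 else 0, ?_, by simp, fun y => ?_⟩
    · intro i hi
      simp at hi
      simp [hi.ne']
    · simp [shiftProd_empty]
  | insert j s hj ih =>
    obtain ⟨c, h0, h1, hc⟩ := ih
    rw [Finset.card_insert_of_notMem hj]
    refine ⟨stepCoeff Fq (shiftProd Fq x s (x j)) c, ?_, ?_, ?_⟩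
    · intro i hi
      obtain ⟨k, rfl⟩ := Nat.exists_eq_add_of_lt (Nat.zero_lt_of_lt hi)
      rw [zero_add] at hi ⊢
      have := Fintype.card_ne_zero (α := Fq)
      simp [stepCoeff, h0 k (by omega), h0 (k + 1) (by omega)]
    · simp [stepCoeff, h1, h0]
    · have := hc.step (h0 _ (Nat.lt_succ_self _)) (shiftProd Fq x s (x j))
      intro y
      rw [← this y, shiftProd_insert hc hj]

end AdditiveExists

end DrinfeldRAT

namespace DrinfeldRAT

theorem norm_sub_le_max_of_ultra {E : Type*} [SeminormedAddCommGroup E] [IsUltrametricDist E]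
    (x y : E) : ‖x - y‖ ≤ max ‖x‖ ‖y‖ := by
  simpa [sub_eq_add_neg] using IsUltrametricDist.norm_add_le_max x (-y)

/-! ### Orthogonal families over `𝔽_q` -/

section Ortho

variable {Fq K ι : Type*} [Field Fq] [Fintype Fq] [NormedField K] [Algebra Fq K]

theorem norm_smul_of_ne_zero {a : Fq} (ha : a ≠ 0) (y : K) : ‖a • y‖ = ‖y‖ := by
  have h1 : ‖algebraMap Fq K a‖ = 1 := by
    refine (pow_eq_one_iff_of_nonneg (norm_nonneg _)
      (Nat.sub_ne_zero_of_lt (Fintype.one_lt_card (α := Fq)))).1 ?_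
    rw [← norm_pow, ← map_pow, FiniteField.pow_card_sub_one_eq_one a ha, map_one, norm_one]
  rw [Algebra.smul_def, norm_mul, h1, one_mul]

variable [Fintype ι]

theorem norm_sum_smul_le [IsUltrametricDist K] {x : ι → K} {a : ι → Fq} {M : ℝ} (hM : 0 ≤ M)
    (h : ∀ i, a i ≠ 0 → ‖x i‖ ≤ M) : ‖∑ i, a i • x i‖ ≤ M := by
  refine IsUltrametricDist.norm_sum_le_of_forall_le_of_nonneg hM fun i _ => ?_
  rcases eq_or_ne (a i) 0 with h0 | h0
  · simpa [h0]
  · rw [norm_smul_of_ne_zero h0]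
    exact h i h0

/-- A family whose `𝔽_q`-linear combinations have norm the maximum of the norms of the vectors
involved. -/
def IsOrtho (Fq : Type*) [Field Fq] [Algebra Fq K] (x : ι → K) : Prop :=
  ∀ (a : ι → Fq) (i : ι), a i ≠ 0 → ‖x i‖ ≤ ‖∑ k, a k • x k‖

/-- Every finite `𝔽_q`-subspace has an orthogonal basis sorted by norm. -/
theorem exists_isOrtho_basis (V : Submodule Fq K) [Finite V] {n : ℕ}
    (hn : Module.finrank Fq V = n) :
    ∃ x : Fin n → K, LinearIndependent Fq x ∧ Submodule.span Fq (Set.range x) = V ∧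
      IsOrtho Fq x ∧ Monotone fun i => ‖x i‖ := by
  have : Module.Finite Fq V := Module.Finite.of_finite
  let S : Set (Fin n → V) := {x | LinearIndependent Fq x}
  have hne : S.Nonempty :=
    ⟨_, (Module.finBasisOfFinrankEq Fq V hn).linearIndependent⟩
  -- Among the finitely many bases, one minimises the sum of the norms. A combination involving `y
  -- i` but shorter than `y i` could replace it, which would lower the sum.
  obtain ⟨y, hy, hmin⟩ := Set.exists_min_image S (fun x => ∑ i, ‖(x i : K)‖) (Set.toFinite S) hne
  have hortho : IsOrtho Fq (fun i => (y i : K)) := by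
    intro a i hai
    by_contra! hlt
    let z : Fin n → V := Function.update y i (∑ k, a k • y k)
    have hz : LinearIndependent Fq z := by
      have hy := Fintype.linearIndependent_iff.1 (show LinearIndependent Fq y from hy)
      rw [Fintype.linearIndependent_iff]
      intro g hg
      have h1 : ∑ k, (Function.update g i 0 k + g i * a k) • y k = 0 := by
        have e1 : ∑ k, g k • z k = g i • z i + ∑ k ∈ Finset.univ.erase i, g k • y k := by
          rw [← Finset.add_sum_erase _ _ (Finset.mem_univ i)]
          congr 1
          refine Finset.sum_congr rfl fun k hk => ?_
          simp only [z]
          rw [Function.update_of_ne (Finset.ne_of_mem_erase hk)]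
        have e2 : ∑ k, Function.update g i 0 k • y k = ∑ k ∈ Finset.univ.erase i, g k • y k := by
          rw [← Finset.add_sum_erase _ _ (Finset.mem_univ i)]
          simp only [Function.update_self, zero_smul, zero_add]
          refine Finset.sum_congr rfl fun k hk => ?_
          rw [Function.update_of_ne (Finset.ne_of_mem_erase hk)]
        rw [← hg, e1, ← e2]
        simp only [add_smul, Finset.sum_add_distrib, mul_smul, ← Finset.smul_sum]
        rw [add_comm]
        simp [z]
      have h2 := hy _ h1
      have h3 : g i = 0 := by
        have := h2 i
        simpa [hai] using this
      intro k
      rcases eq_or_ne k i with rfl | hk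
      · exact h3
      · simpa [h3, hk] using h2 k
    have h4 := hmin z hz
    refine absurd h4 (not_le.2 ?_)
    refine Finset.sum_lt_sum (fun k _ => ?_) ⟨i, Finset.mem_univ i, ?_⟩
    · rcases eq_or_ne k i with rfl | hk
      · simpa [z] using hlt.le
      · simp [z, hk]
    · simpa [z] using hlt
  let σ := Tuple.sort fun i => ‖(y i : K)‖
  have hli : LinearIndependent Fq (fun i => (y (σ i) : K)) := by
    have h1 : LinearIndependent Fq (fun i => (y i : K)) :=
      LinearIndependent.map' hy V.subtype (Submodule.ker_subtype V)
    exact h1.comp σ σ.injective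
  refine ⟨fun i => (y (σ i) : K), hli, ?_, ?_, Tuple.monotone_sort fun i => ‖(y i : K)‖⟩
  · have hfin : Module.Finite Fq V := inferInstance
    refine Submodule.eq_of_le_of_finrank_eq ?_ ?_
    · rw [Submodule.span_le]
      rintro _ ⟨i, rfl⟩
      exact (y (σ i)).2
    · rw [finrank_span_eq_card hli, hn, Fintype.card_fin]
  · intro a i hai
    have := hortho (a ∘ σ.symm) (σ i) (by simpa using hai)
    rw [← Equiv.sum_comp σ] at this
    simpa using this

/-- The element `j` of `Fin r` is not smaller in norm modulo the span of the previous ones. -/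
theorem isOrtho_of_norm_sub {r : ℕ} {x : Fin r → K} (hmono : Monotone fun i => ‖x i‖)
    (h : ∀ j, ∀ a ∈ coordSet Fq (Finset.univ.filter fun i : Fin r => i < j),
      ‖x j‖ ≤ ‖x j - ∑ k, a k • x k‖) : IsOrtho Fq x := by
  classical
  intro a i hai
  let S := Finset.univ.filter fun k => a k ≠ 0
  have hS : S.Nonempty := ⟨i, by simpa [S] using hai⟩
  let j := S.max' hS
  have hj : a j ≠ 0 := (Finset.mem_filter.1 (S.max'_mem hS)).2
  have hij : i ≤ j := S.le_max' i (by simpa [S] using hai)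
  have hgt : ∀ k, j < k → a k = 0 := by
    intro k hk
    by_contra h0
    exact absurd (S.le_max' k (by simpa [S] using h0)) (not_le.2 hk)
  -- Dividing by the coefficient of the last vector involved, `x j`, gives `x j` minus a combination
  -- of earlier vectors.
  let b : Fin r → Fq := fun k => if k < j then -((a j)⁻¹ * a k) else 0
  have hb : b ∈ coordSet Fq (Finset.univ.filter fun i : Fin r => i < j) := by
    rw [mem_coordSet]
    intro k hk
    simp only [Finset.mem_filter, Finset.mem_univ, true_and] at hk
    simp [b, hk]
  have hsum : ∑ k, a k • x k = a j • (x j - ∑ k, b k • x k) := by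
    rw [smul_sub, Finset.smul_sum, ← Finset.add_sum_erase _ _ (Finset.mem_univ j),
      ← Finset.add_sum_erase (a := j) (f := fun k => a j • b k • x k) _ (Finset.mem_univ j)]
    have hbj : b j = 0 := by simp [b]
    rw [hbj, zero_smul, smul_zero, zero_add, sub_eq_add_neg, ← Finset.sum_neg_distrib]
    congr 1
    refine Finset.sum_congr rfl fun k hk => ?_
    rcases lt_or_gt_of_ne (Finset.ne_of_mem_erase hk) with h1 | h1
    · simp only [b, h1, if_true, smul_smul, ← neg_smul]
      congr 1
      field_simp
    · simp [b, hgt k h1, h1.not_gt]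
  rw [hsum, norm_smul_of_ne_zero hj]
  exact (hmono hij).trans (h j b hb)

theorem IsOrtho.norm_sub {x : ι → K} [IsUltrametricDist K] (hx : IsOrtho Fq x) {j : ι}
    {a : ι → Fq} (haj : a j = 0) (ha : ∀ i, a i ≠ 0 → ‖x i‖ ≤ ‖x j‖) :
    ‖x j - ∑ k, a k • x k‖ = ‖x j‖ := by
  classical
  refine le_antisymm ((norm_sub_le_max_of_ultra _ _).trans
    (max_le le_rfl (norm_sum_smul_le (norm_nonneg _) ha))) ?_
  have := hx (Function.update (-a) j 1) j (by simp)
  rw [sum_update_smul (by simp [haj])] at this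
  simpa [sub_eq_add_neg] using this

end Ortho

/-! ### Sizes of the coefficients in the recursion `e_{j+1} = e_j^q - w_j^(q-1) e_j` -/

section MooreCoeff

variable {Fq K : Type*} [Field Fq] [Fintype Fq] [NormedField K] [Algebra Fq K]

/-- Coefficients of the iterated additive polynomial `e_{j+1} = e_j^q - w_j^(q-1) e_j`, `e_0(y) = y`. -/
def mooreCoeff (Fq : Type*) [Fintype Fq] (w : ℕ → K) : ℕ → ℕ → K
  | 0 => fun i => if i = 0 then 1 else 0
  | j + 1 => stepCoeff Fq (w j) (mooreCoeff Fq w j)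

theorem mooreCoeff_of_lt (w : ℕ → K) {j i : ℕ} (h : j < i) : mooreCoeff Fq w j i = 0 := by
  induction j generalizing i with
  | zero => simp [mooreCoeff, h.ne']
  | succ j ih =>
    obtain ⟨k, rfl⟩ := Nat.exists_eq_add_of_lt h
    simp [mooreCoeff, stepCoeff, ih (show j < j + 1 + k by omega),
      ih (show j < j + 1 + k + 1 by omega), Fintype.card_ne_zero]

theorem mooreCoeff_self (w : ℕ → K) (j : ℕ) : mooreCoeff Fq w j j = 1 := by
  induction j with
  | zero => simp [mooreCoeff]
  | succ j ih =>
    simp [mooreCoeff, stepCoeff, ih, mooreCoeff_of_lt w (Nat.lt_succ_self j)]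

theorem norm_mooreCoeff_zero (w : ℕ → K) (j : ℕ) :
    ‖mooreCoeff Fq w j 0‖ = ∏ l ∈ Finset.range j, ‖w l‖ ^ (Fintype.card Fq - 1) := by
  induction j with
  | zero => simp [mooreCoeff]
  | succ j ih => simp [mooreCoeff, stepCoeff, ih, Finset.prod_range_succ, mul_comm]

variable {w : ℕ → K} {X : ℕ → ℝ} {r : ℕ}

/-- Raising to the `q`-th power turns the exponent `q^l (q-1)` into `q^(l+1) (q-1)`, and `X l ≤ X (l
+ 1)` does the rest. This compares the term `e_j^q` of the recursion with the term `w_j^(q-1) e_j`;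
the next lemma makes it strict when `X` jumps at `i`. -/
theorem prod_shift_le (hpos : ∀ l < r, 0 < X l) (hmono : ∀ l, l + 1 < r → X l ≤ X (l + 1))
    {i j : ℕ} (hj : j < r) :
    (∏ l ∈ Finset.Ico i j, X l ^ (Fintype.card Fq ^ l * (Fintype.card Fq - 1))) ^ Fintype.card Fq
      ≤ ∏ l ∈ Finset.Ico (i + 1) (j + 1), X l ^ (Fintype.card Fq ^ l * (Fintype.card Fq - 1)) := by
  rw [← Finset.prod_Ico_add' _ i j 1, ← Finset.prod_pow]
  refine Finset.prod_le_prod (fun l hl => ?_) (fun l hl => ?_)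
  · have := hpos l (by simp at hl; omega)
    positivity
  · rw [← pow_mul]
    simp only [Finset.mem_Ico] at hl
    have h := hpos l (by omega)
    calc _ = X l ^ (Fintype.card Fq ^ (l + 1) * (Fintype.card Fq - 1)) := by ring_nf
      _ ≤ _ := pow_le_pow_left₀ h.le (hmono l (by omega)) _

theorem prod_shift_lt (hpos : ∀ l < r, 0 < X l) (hmono : ∀ l, l + 1 < r → X l ≤ X (l + 1))
    {i j : ℕ} (hj : j < r) (hij : i < j) (hlt : X i < X (i + 1)) :
    (∏ l ∈ Finset.Ico i j, X l ^ (Fintype.card Fq ^ l * (Fintype.card Fq - 1))) ^ Fintype.card Fq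
      < ∏ l ∈ Finset.Ico (i + 1) (j + 1), X l ^ (Fintype.card Fq ^ l * (Fintype.card Fq - 1)) := by
  rw [← Finset.prod_Ico_add' _ i j 1, ← Finset.prod_pow]
  have key : ∀ l, (X l ^ (Fintype.card Fq ^ l * (Fintype.card Fq - 1))) ^ Fintype.card Fq =
      X l ^ (Fintype.card Fq ^ (l + 1) * (Fintype.card Fq - 1)) := fun l => by
    rw [← pow_mul]; ring_nf
  refine Finset.prod_lt_prod (fun l hl => ?_) (fun l hl => ?_) ⟨i, by simp [hij], ?_⟩
  · have := hpos l (by simp at hl; omega)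
    positivity
  · simp only [Finset.mem_Ico] at hl
    have h := hpos l (by omega)
    rw [key]
    exact pow_le_pow_left₀ h.le (hmono l (by omega)) _
  · rw [key]
    refine pow_lt_pow_left₀ hlt (hpos i (by omega)).le ?_
    have : 1 < Fintype.card Fq := Fintype.one_lt_card
    have h2 : Fintype.card Fq - 1 ≠ 0 := by omega
    positivity

/-- Of the two terms of the recursion, the second satisfies the bound by induction and the first by
`prod_shift_le`. -/
theorem norm_mooreCoeff_le [IsUltrametricDist K] (hpos : ∀ l < r, 0 < X l)
    (hmono : ∀ l, l + 1 < r → X l ≤ X (l + 1))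
    (hw : ∀ l < r, ‖w l‖ = X l ^ Fintype.card Fq ^ l) {i j : ℕ} (hij : i ≤ j) (hj : j ≤ r) :
    ‖mooreCoeff Fq w j i‖ ≤
      ∏ l ∈ Finset.Ico i j, X l ^ (Fintype.card Fq ^ l * (Fintype.card Fq - 1)) := by
  induction j generalizing i with
  | zero => obtain rfl : i = 0 := by omega
            simp [mooreCoeff]
  | succ j ih =>
    rcases hij.eq_or_lt with rfl | hij
    · simp [mooreCoeff_self]
    have h2 : ‖w j ^ (Fintype.card Fq - 1) * mooreCoeff Fq w j i‖ ≤
        ∏ l ∈ Finset.Ico i (j + 1), X l ^ (Fintype.card Fq ^ l * (Fintype.card Fq - 1)) := by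
      rw [Finset.prod_Ico_succ_top (by omega), norm_mul, norm_pow, hw j (by omega), ← pow_mul,
        mul_comm]
      have := hpos j (by omega)
      gcongr
      exact ih (by omega) (by omega)
    cases i with
    | zero => simpa [mooreCoeff, stepCoeff] using h2
    | succ i =>
      refine (norm_sub_le_max_of_ultra _ _).trans (max_le ?_ h2)
      rw [norm_pow]
      refine le_trans ?_ (prod_shift_le (Fq := Fq) hpos hmono (i := i) (j := j) (by omega))
      gcongr
      exact ih (by omega) (by omega)

/-- At a jump the second term of the recursion strictly dominates, so there is no cancellation. The
condition `hjump` is vacuous for `i = 0`, where the first term is absent, and for `i = r`. -/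
theorem norm_mooreCoeff_eq [IsUltrametricDist K] (hpos : ∀ l < r, 0 < X l)
    (hmono : ∀ l, l + 1 < r → X l ≤ X (l + 1))
    (hw : ∀ l < r, ‖w l‖ = X l ^ Fintype.card Fq ^ l) {i j : ℕ} (hij : i ≤ j) (hj : j ≤ r)
    (hjump : ∀ k, i = k + 1 → k + 1 < r → X k < X (k + 1)) :
    ‖mooreCoeff Fq w j i‖ =
      ∏ l ∈ Finset.Ico i j, X l ^ (Fintype.card Fq ^ l * (Fintype.card Fq - 1)) := by
  induction j with
  | zero => obtain rfl : i = 0 := by omega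
            simp [mooreCoeff]
  | succ j ih =>
    rcases hij.eq_or_lt with rfl | hij
    · simp [mooreCoeff_self]
    have h2 : ‖w j ^ (Fintype.card Fq - 1) * mooreCoeff Fq w j i‖ =
        ∏ l ∈ Finset.Ico i (j + 1), X l ^ (Fintype.card Fq ^ l * (Fintype.card Fq - 1)) := by
      rw [Finset.prod_Ico_succ_top (by omega), norm_mul, norm_pow, hw j (by omega), ← pow_mul,
        mul_comm, ih (by omega) (by omega)]
    cases i with
    | zero => simpa [mooreCoeff, stepCoeff] using h2
    | succ i =>
      have h1 : ‖mooreCoeff Fq w j i ^ Fintype.card Fq‖ <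
          ‖w j ^ (Fintype.card Fq - 1) * mooreCoeff Fq w j (i + 1)‖ := by
        rw [h2, norm_pow]
        refine lt_of_le_of_lt ?_ (prod_shift_lt (Fq := Fq) hpos hmono (i := i) (j := j) (by omega)
          (by omega) (hjump i rfl (by omega)))
        gcongr
        exact norm_mooreCoeff_le hpos hmono hw (by omega) (by omega)
      rw [← h2]
      change ‖_ - _‖ = _
      rw [sub_eq_add_neg, IsUltrametricDist.norm_add_eq_max_of_norm_ne_norm (by
        rw [norm_neg]; exact h1.ne), norm_neg, max_eq_right h1.le]

end MooreCoeff

end DrinfeldRAT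

namespace DrinfeldRAT

/-! ### Kernels of additive polynomials -/

section Kernel

variable {Fq K ι : Type*} [Field Fq] [Fintype Fq] [Field K] [Algebra Fq K]

/-- The polynomial `∑_{i ≤ n} c_i X^(q^i)`. -/
def addPoly (Fq : Type*) [Fintype Fq] (n : ℕ) (c : ℕ → K) : K[X] :=
  ∑ i ∈ Finset.range (n + 1), Polynomial.C (c i) * Polynomial.X ^ Fintype.card Fq ^ i

theorem card_pow_injective : Function.Injective fun i : ℕ => Fintype.card Fq ^ i :=
  Nat.pow_right_injective Fintype.one_lt_card

theorem coeff_addPoly (n : ℕ) (c : ℕ → K) {i : ℕ} (hi : i ≤ n) :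
    (addPoly Fq n c).coeff (Fintype.card Fq ^ i) = c i := by
  rw [addPoly, Polynomial.finsetSum_coeff, Finset.sum_eq_single i]
  · simp
  · intro j _ hj
    rw [Polynomial.coeff_C_mul_X_pow, if_neg]
    exact fun h => hj (card_pow_injective (Fq := Fq) h).symm
  · intro h
    exact absurd (Finset.mem_range.2 (by omega)) h

theorem eval_addPoly (n : ℕ) (c : ℕ → K) (y : K) :
    (addPoly Fq n c).eval y = ∑ i ∈ Finset.range (n + 1), c i * y ^ Fintype.card Fq ^ i := by
  simp [addPoly, Polynomial.eval_finsetSum]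

theorem natDegree_addPoly_le (n : ℕ) (c : ℕ → K) :
    (addPoly Fq n c).natDegree ≤ Fintype.card Fq ^ n := by
  refine Polynomial.natDegree_sum_le_of_forall_le _ _ fun i hi => ?_
  refine (Polynomial.natDegree_C_mul_X_pow_le _ _).trans ?_
  exact Nat.pow_le_pow_right Fintype.card_pos (by simp at hi; omega)

theorem natDegree_addPoly {n : ℕ} {c : ℕ → K} (hc : c n ≠ 0) :
    (addPoly Fq n c).natDegree = Fintype.card Fq ^ n :=
  le_antisymm (natDegree_addPoly_le n c)
    (Polynomial.le_natDegree_of_ne_zero (by rwa [coeff_addPoly n c le_rfl]))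

theorem cast_card_eq_zero : (Fintype.card Fq : K) = 0 := by
  rw [← map_natCast (algebraMap Fq K), FiniteField.cast_card_eq_zero, map_zero]

theorem derivative_addPoly (n : ℕ) (c : ℕ → K) :
    Polynomial.derivative (addPoly Fq n c) = Polynomial.C (c 0) := by
  rw [addPoly, Polynomial.derivative_sum, Finset.sum_range_succ', Finset.sum_eq_zero]
  · simp
  · intro i _
    rw [Polynomial.derivative_C_mul_X_pow, Nat.cast_pow, cast_card_eq_zero]
    simp

theorem IsAdditivePoly.eval_eq {n : ℕ} {c : ℕ → K} {f : K → K} (h : IsAdditivePoly Fq n c f)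
    (y : K) : (addPoly Fq n c).eval y = f y := by
  rw [eval_addPoly, h y]

/-- The kernel of an additive polynomial. -/
def IsAdditivePoly.ker {n : ℕ} {c : ℕ → K} {f : K → K} (h : IsAdditivePoly Fq n c f) :
    Submodule Fq K where
  carrier := {y | f y = 0}
  add_mem' {a b} ha hb := by
    change f (a + b) = 0
    rw [h.map_add, show f a = 0 from ha, show f b = 0 from hb, add_zero]
  zero_mem' := by
    have := h.map_smul 0 0
    simpa using this
  smul_mem' a y hy := by
    change f (a • y) = 0
    rw [h.map_smul, show f y = 0 from hy, smul_zero]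

theorem IsAdditivePoly.mem_ker {n : ℕ} {c : ℕ → K} {f : K → K} (h : IsAdditivePoly Fq n c f)
    {y : K} : y ∈ h.ker ↔ f y = 0 := Iff.rfl

theorem IsAdditivePoly.ker_eq_rootSet {n : ℕ} {c : ℕ → K} {f : K → K}
    (h : IsAdditivePoly Fq n c f) (hn : c n ≠ 0) :
    (h.ker : Set K) = (addPoly Fq n c).rootSet K := by
  have h0 : addPoly Fq n c ≠ 0 := by
    intro h0
    have := coeff_addPoly (Fq := Fq) n c le_rfl
    rw [h0, Polynomial.coeff_zero] at this
    exact hn this.symm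
  ext y
  rw [SetLike.mem_coe, h.mem_ker, Polynomial.mem_rootSet_of_ne h0, Polynomial.coe_aeval_eq_eval,
    h.eval_eq]

theorem IsAdditivePoly.finite_ker {n : ℕ} {c : ℕ → K} {f : K → K}
    (h : IsAdditivePoly Fq n c f) (hn : c n ≠ 0) : Finite h.ker := by
  have : (h.ker : Set K).Finite := by
    rw [h.ker_eq_rootSet hn]
    exact Polynomial.rootSet_finite _ _
  exact this.to_subtype

/-- The derivative is the constant `c 0 ≠ 0`, so the polynomial is separable and has `q^n` roots. -/
theorem IsAdditivePoly.finrank_ker [IsAlgClosed K] {n : ℕ} {c : ℕ → K} {f : K → K}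
    (h : IsAdditivePoly Fq n c f) (h0 : c 0 ≠ 0) (hn : c n ≠ 0) :
    Module.finrank Fq h.ker = n := by
  have hfin := h.finite_ker hn
  have := Fintype.ofFinite h.ker
  have hcard : Nat.card h.ker = Fintype.card Fq ^ n := by
    have hsep : (addPoly Fq n c).Separable := by
      rw [Polynomial.separable_def, derivative_addPoly]
      exact ⟨0, Polynomial.C (c 0)⁻¹, by rw [zero_mul, zero_add, ← Polynomial.C_mul,
        inv_mul_cancel₀ h0, Polynomial.C_1]⟩
    have h1 := Polynomial.card_rootSet_eq_natDegree (K := K) hsep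
      (IsAlgClosed.splits _)
    rw [natDegree_addPoly hn, ← Nat.card_eq_fintype_card] at h1
    rw [← h1]
    exact Nat.card_congr (Equiv.setCongr (h.ker_eq_rootSet hn))
  rw [Nat.card_eq_fintype_card, Module.card_eq_pow_finrank (K := Fq)] at hcard
  exact card_pow_injective (Fq := Fq) hcard

variable [Fintype ι]

theorem injective_sum_smul {x : ι → K} (hx : LinearIndependent Fq x) :
    Function.Injective fun a : ι → Fq => ∑ i, a i • x i := by
  intro a b hab
  rw [Fintype.linearIndependent_iff] at hx
  funext i
  have := hx (a - b) (by simpa [sub_smul, sub_eq_zero] using hab) i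
  simpa [sub_eq_zero] using this

/-- An additive polynomial is determined by its leading coefficient and its kernel. -/
theorem IsAdditivePoly.coeff_unique {n : ℕ} {c e : ℕ → K} {f g : K → K}
    (hf : IsAdditivePoly Fq n c f) (hg : IsAdditivePoly Fq n e g) (hlead : c n = e n)
    {x : ι → K} (hx : LinearIndependent Fq x) (hcard : Fintype.card ι = n)
    (hfx : ∀ i, f (x i) = 0) (hgx : ∀ i, g (x i) = 0) {i : ℕ} (hi : i ≤ n) : c i = e i := by
  classical
  have hspan : ∀ {c : ℕ → K} {f : K → K} (hf : IsAdditivePoly Fq n c f),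
      (∀ i, f (x i) = 0) → ∀ a : ι → Fq, f (∑ i, a i • x i) = 0 := by
    intro c f hf h a
    exact hf.mem_ker.1 (Submodule.sum_mem _ fun i _ => Submodule.smul_mem _ _ (hf.mem_ker.2 (h i)))
  let D : K[X] := addPoly Fq n c - addPoly Fq n e
  have hD : D = ∑ i ∈ Finset.range n,
      Polynomial.C (c i - e i) * Polynomial.X ^ Fintype.card Fq ^ i := by
    simp only [D, addPoly, Finset.sum_range_succ, hlead, Polynomial.C_sub, sub_mul, Finset.sum_sub_distrib]
    ring
  -- The leading terms cancel, so the degree drops to at most `q^(n-1)`, while `D` vanishes at the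
  -- `q^n` combinations of the `x i`.
  have hdeg : D.natDegree < Fintype.card (ι → Fq) := by
    rw [Fintype.card_fun, hcard]
    have hq : 1 < Fintype.card Fq := Fintype.one_lt_card
    rcases Nat.eq_zero_or_pos n with rfl | hn
    · simp [hD]
    · refine lt_of_le_of_lt (b := Fintype.card Fq ^ (n - 1)) ?_
        (Nat.pow_lt_pow_right hq (by omega))
      rw [hD]
      refine Polynomial.natDegree_sum_le_of_forall_le _ _ fun i hi => ?_
      refine (Polynomial.natDegree_C_mul_X_pow_le _ _).trans ?_
      exact Nat.pow_le_pow_right Fintype.card_pos (by simp at hi; omega)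
  have h0 : D = 0 := by
    refine Polynomial.eq_zero_of_natDegree_lt_card_of_eval_eq_zero D (injective_sum_smul hx) ?_ hdeg
    intro a
    rw [Polynomial.eval_sub, hf.eval_eq, hg.eval_eq, hspan hf hfx, hspan hg hgx, sub_zero]
  rw [← coeff_addPoly (Fq := Fq) n c hi, ← coeff_addPoly (Fq := Fq) n e hi, sub_eq_zero.1 h0]

theorem shiftProd_self {x : ι → K} {s : Finset ι} {i : ι} (hi : i ∈ s) :
    shiftProd Fq x s (x i) = 0 := by
  classical
  refine Finset.prod_eq_zero (i := Pi.single i 1) ?_ ?_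
  · rw [mem_coordSet]
    intro j hj
    exact Pi.single_eq_of_ne (by rintro rfl; exact hj hi) _
  · rw [Finset.sum_eq_single i] <;> simp +contextual

/-- An additive polynomial as the product over its kernel. -/
theorem IsAdditivePoly.eq_mul_shiftProd {n : ℕ} {c : ℕ → K} {f : K → K}
    (hf : IsAdditivePoly Fq n c f) {x : ι → K} (hx : LinearIndependent Fq x)
    (hcard : Fintype.card ι = n) (hfx : ∀ i, f (x i) = 0) {e : ℕ → K} (he1 : e n = 1)
    (he : IsAdditivePoly Fq n e (shiftProd Fq x Finset.univ)) :
    (∀ i ≤ n, c i = c n * e i) ∧ ∀ y, f y = c n * shiftProd Fq x Finset.univ y := by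
  have hg : IsAdditivePoly Fq n (fun i => c n * e i)
      (fun y => c n * shiftProd Fq x Finset.univ y) := by
    intro y
    simp only [he y, Finset.mul_sum, mul_assoc]
  have h := fun i (hi : i ≤ n) => hf.coeff_unique hg (by simp [he1]) hx hcard hfx
    (fun i => by simp [shiftProd_self]) hi
  refine ⟨h, fun y => ?_⟩
  refine (hf y).trans (Eq.trans ?_ (hg y).symm)
  exact Finset.sum_congr rfl fun i hi => by rw [h i (by simp at hi; omega)]

open Classical in
-- Both expressions for `shiftProd` are divisible by `y`; the quotients are compared at `0`. As `K`
-- is infinite, equality of functions gives the equality of polynomials needed to cancel `y`.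
theorem IsAdditivePoly.coeff_zero_shiftProd [Infinite K] {n : ℕ} {e : ℕ → K} {x : ι → K}
    {s : Finset ι} (he : IsAdditivePoly Fq n e (shiftProd Fq x s)) :
    e 0 = ∏ a ∈ (coordSet Fq s).erase 0, -∑ i, a i • x i := by
  let p : K[X] := ∏ a ∈ (coordSet Fq s).erase 0, (Polynomial.X - Polynomial.C (∑ i, a i • x i))
  let g : K[X] := ∑ i ∈ Finset.range (n + 1),
    Polynomial.C (e i) * Polynomial.X ^ (Fintype.card Fq ^ i - 1)
  have hpg : Polynomial.X * p = Polynomial.X * g := by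
    refine Polynomial.funext fun y => ?_
    have h1 := he y
    rw [shiftProd, ← Finset.mul_prod_erase _ _ (zero_mem_coordSet s)] at h1
    simp only [Pi.zero_apply, zero_smul, Finset.sum_const_zero, sub_zero] at h1
    simp only [Polynomial.eval_mul, Polynomial.eval_X, p, g, Polynomial.eval_prod,
      Polynomial.eval_sub, Polynomial.eval_C, Polynomial.eval_finsetSum, Polynomial.eval_pow]
    rw [h1, Finset.mul_sum]
    refine Finset.sum_congr rfl fun i _ => ?_
    have : 0 < Fintype.card Fq ^ i := pow_pos Fintype.card_pos i
    rw [mul_left_comm, ← pow_succ', Nat.sub_add_cancel this]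
  have h2 := congrArg (Polynomial.eval 0) (mul_left_cancel₀ Polynomial.X_ne_zero hpg)
  simp only [p, g, Polynomial.eval_prod, Polynomial.eval_sub, Polynomial.eval_X,
    Polynomial.eval_C, zero_sub, Polynomial.eval_finsetSum, Polynomial.eval_mul,
    Polynomial.eval_pow] at h2
  rw [h2, Finset.sum_range_succ', Finset.sum_eq_zero]
  · simp
  · intro i _
    have : 1 < Fintype.card Fq ^ (i + 1) := Nat.one_lt_pow (by omega) Fintype.one_lt_card
    rw [zero_pow (by omega), mul_zero]

end Kernel

/-! ### Small preimages under additive polynomials -/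

section SmallRoot

variable {Fq K ι : Type*} [Field Fq] [Fintype Fq] [NormedField K] [Algebra Fq K]

theorem IsAdditivePoly.exists_eq [IsAlgClosed K] {n : ℕ} {c : ℕ → K} {f : K → K}
    (h : IsAdditivePoly Fq n c f) (hn : c n ≠ 0) (y : K) : ∃ ξ, f ξ = y := by
  have hq : 0 < Fintype.card Fq ^ n := pow_pos Fintype.card_pos n
  obtain ⟨ξ, hξ⟩ := IsAlgClosed.exists_root (addPoly Fq n c - Polynomial.C y) (by
    rw [Polynomial.degree_sub_C]
    · rw [Polynomial.degree_eq_natDegree, natDegree_addPoly hn]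
      · exact_mod_cast hq.ne'
      · intro h0
        have := natDegree_addPoly (Fq := Fq) hn
        rw [h0, Polynomial.natDegree_zero] at this
        omega
    · rw [← Polynomial.natDegree_pos_iff_degree_pos, natDegree_addPoly hn]
      exact hq)
  refine ⟨ξ, ?_⟩
  rw [Polynomial.IsRoot, Polynomial.eval_sub, Polynomial.eval_C, sub_eq_zero, h.eval_eq] at hξ
  exact hξ

/-- The smallest solution of `f(ξ) = y` satisfies `|c_0 ξ| ≤ |y|`. -/
theorem IsAdditivePoly.exists_small_root [IsAlgClosed K] [IsUltrametricDist K]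
    {n : ℕ} {c : ℕ → K} {f : K → K} (h : IsAdditivePoly Fq n c f) (h0 : c 0 ≠ 0) (hn : c n ≠ 0)
    (y : K) : ∃ ξ, f ξ = y ∧ ‖c 0‖ * ‖ξ‖ ≤ ‖y‖ := by
  classical
  have hfin := h.finite_ker hn
  obtain ⟨x, hx, hspan, -, -⟩ := exists_isOrtho_basis h.ker (h.finrank_ker h0 hn)
  have hfx : ∀ i, f (x i) = 0 := fun i => h.mem_ker.1 (hspan ▸ Submodule.subset_span ⟨i, rfl⟩)
  obtain ⟨e, -, he1, he⟩ := exists_isAdditivePoly_shiftProd (Fq := Fq) x Finset.univ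
  rw [Finset.card_univ, Fintype.card_fin] at he1 he
  obtain ⟨hce, hfe⟩ := h.eq_mul_shiftProd hx (Fintype.card_fin n) hfx he1 he
  obtain ⟨ξ₀, hξ₀⟩ := h.exists_eq hn y
  -- `ξ = ξ₀ - v` is a shortest element of its coset of the kernel. Then `‖u‖ ≤ ‖ξ - u‖` for every
  -- `u` in the kernel, so `c 0 * ξ`, which is `c n * ξ * ∏ (-u)` over `u ≠ 0`, is bounded factor by
  -- factor by `y = c n * ∏ (ξ - u)`.
  obtain ⟨v, hv⟩ := Finite.exists_min fun v : h.ker => ‖ξ₀ - v‖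
  refine ⟨ξ₀ - v, by rw [h.map_sub, h.mem_ker.1 v.2, sub_zero, hξ₀], ?_⟩
  set ξ := ξ₀ - v with hξ
  have hmem : ∀ a : Fin n → Fq, ∑ i, a i • x i ∈ h.ker := fun a =>
    Submodule.sum_mem _ fun i _ => Submodule.smul_mem _ _ (h.mem_ker.2 (hfx i))
  have hmin : ∀ a : Fin n → Fq, ‖ξ‖ ≤ ‖ξ - ∑ i, a i • x i‖ := by
    intro a
    have := hv (v + ⟨_, hmem a⟩)
    simpa [hξ, sub_sub] using this
  have hmin2 : ∀ a : Fin n → Fq, ‖∑ i, a i • x i‖ ≤ ‖ξ - ∑ i, a i • x i‖ := by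
    intro a
    have : ∑ i, a i • x i = ξ - (ξ - ∑ i, a i • x i) := by abel
    calc ‖∑ i, a i • x i‖ = ‖ξ - (ξ - ∑ i, a i • x i)‖ := by rw [← this]
      _ ≤ _ := (norm_sub_le_max_of_ultra _ _).trans (max_le (hmin a) le_rfl)
  have hy : y = c n * shiftProd Fq x Finset.univ ξ := by
    rw [← hfe, hξ, h.map_sub, h.mem_ker.1 v.2, sub_zero, hξ₀]
  rw [hy, hce 0 (Nat.zero_le n), he.coeff_zero_shiftProd, shiftProd,
    ← Finset.mul_prod_erase _ _ (zero_mem_coordSet Finset.univ), norm_mul, norm_mul, norm_mul,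
    norm_prod, norm_prod, mul_assoc, mul_comm _ ‖ξ‖]
  gcongr with a ha
  · simp
  · rw [norm_neg]
    exact hmin2 a

end SmallRoot

end DrinfeldRAT

namespace DrinfeldRAT

/-! ### Families sorted by norm and their pivots -/

section Sorted

variable {Fq K : Type*} [Field Fq] [Fintype Fq] [NormedField K] [Algebra Fq K]

/-- Used to write a power with exponent `q^l` as a product over `coordSet`, which can then be
compared factor by factor with a `shiftProd`. -/
theorem prod_coordSet_const {ι M : Type*} [Fintype ι] [CommMonoid M] (s : Finset ι) (y : M) :
    ∏ _a ∈ coordSet Fq s, y = y ^ Fintype.card Fq ^ s.card := by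
  classical
  induction s using Finset.induction_on with
  | empty => simp [coordSet_empty]
  | insert j s hj ih =>
    rw [prod_coordSet_insert hj]
    simp only [ih, Finset.prod_const, Finset.card_univ, Finset.card_insert_of_notMem hj]
    rw [← pow_mul, ← pow_succ]

variable {r : ℕ}

/-- The indices below `j`. -/
def below (r j : ℕ) : Finset (Fin r) := Finset.univ.filter fun i => (i : ℕ) < j

theorem mem_below {j : ℕ} {i : Fin r} : i ∈ below r j ↔ (i : ℕ) < j := by simp [below]

theorem below_succ {j : ℕ} (hj : j < r) : below r (j + 1) = insert ⟨j, hj⟩ (below r j) := by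
  ext i
  simp only [mem_below, Finset.mem_insert, Fin.ext_iff]
  omega

theorem card_below {j : ℕ} (hj : j ≤ r) : (below r j).card = j := by
  induction j with
  | zero => simp [below]
  | succ j ih =>
    rw [below_succ (by omega), Finset.card_insert_of_notMem (by simp [mem_below]), ih (by omega)]

theorem prod_coordSet_below {M : Type*} [CommMonoid M] {j : ℕ} (hj : j ≤ r) (y : M) :
    ∏ _a ∈ coordSet Fq (below r j), y = y ^ Fintype.card Fq ^ j := by
  rw [prod_coordSet_const, card_below hj]

theorem below_self : below r r = Finset.univ := by
  ext i; simp [mem_below]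

/-- The value at `x_l` of `∏ (y - v)`, `v` in the span of the `x_i` with `i < l`. -/
def pivot (Fq : Type*) [Field Fq] [Fintype Fq] [Algebra Fq K] (x : Fin r → K) (l : ℕ) : K :=
  if h : l < r then shiftProd Fq x (below r l) (x ⟨l, h⟩) else 0

/-- The norms of the members of a family, as a sequence. -/
def normSeq (x : Fin r → K) (l : ℕ) : ℝ := if h : l < r then ‖x ⟨l, h⟩‖ else 0

theorem isAdditivePoly_mooreCoeff (x : Fin r → K) {j : ℕ} (hj : j ≤ r) :
    IsAdditivePoly Fq j (mooreCoeff Fq (pivot Fq x) j) (shiftProd Fq x (below r j)) := by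
  induction j with
  | zero =>
    intro y
    have : below r 0 = ∅ := by ext; simp [mem_below]
    simp [this, shiftProd_empty, mooreCoeff]
  | succ j ih =>
    have h := (ih (by omega)).step (mooreCoeff_of_lt _ (Nat.lt_succ_self j)) (pivot Fq x j)
    intro y
    rw [below_succ (by omega), shiftProd_insert (ih (by omega)) (by simp [mem_below])]
    have h2 := h y
    rw [pivot, dif_pos (show j < r by omega)] at h2
    simpa only [mooreCoeff, pivot, dif_pos (show j < r by omega)] using h2

variable [IsUltrametricDist K] {x : Fin r → K}

theorem norm_sub_le_of_below (hmono : Monotone fun i => ‖x i‖) (j : Fin r) {a : Fin r → Fq}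
    (ha : a ∈ coordSet Fq (below r j)) : ‖x j - ∑ k, a k • x k‖ ≤ ‖x j‖ := by
  refine (norm_sub_le_max_of_ultra _ _).trans (max_le le_rfl
    (norm_sum_smul_le (norm_nonneg _) fun i hi => hmono ?_))
  by_contra hij
  refine hi (mem_coordSet.1 ha i ?_)
  rw [mem_below]
  exact fun h => hij (Fin.le_iff_val_le_val.2 h.le)

/-- For a sorted orthogonal family, subtracting earlier vectors does not change the norm of `x l`,
so all `q^l` factors of the pivot have that norm. -/
theorem norm_pivot_eq (hmono : Monotone fun i => ‖x i‖) (hx : IsOrtho Fq x) {l : ℕ}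
    (hl : l < r) : ‖pivot Fq x l‖ = normSeq x l ^ Fintype.card Fq ^ l := by
  rw [pivot, dif_pos hl, shiftProd, norm_prod, normSeq, dif_pos hl]
  rw [← prod_coordSet_below (Fq := Fq) hl.le]
  refine Finset.prod_congr rfl fun a ha => ?_
  rw [mem_coordSet] at ha
  refine hx.norm_sub (ha _ (by simp [mem_below])) fun i hi => hmono ?_
  by_contra hij
  exact hi (ha i (by rw [mem_below]; exact fun h => hij (Fin.le_iff_val_le_val.2 h.le)))

theorem norm_pivot_le (hmono : Monotone fun i => ‖x i‖) {l : ℕ} (hl : l < r) :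
    ‖pivot Fq x l‖ ≤ normSeq x l ^ Fintype.card Fq ^ l := by
  rw [pivot, dif_pos hl, shiftProd, norm_prod, normSeq, dif_pos hl]
  rw [← prod_coordSet_below (Fq := Fq) hl.le]
  exact Finset.prod_le_prod (fun a _ => norm_nonneg _)
    fun a ha => norm_sub_le_of_below hmono ⟨l, hl⟩ ha

theorem sub_sum_ne_zero (hli : LinearIndependent Fq x) {j : Fin r} {a : Fin r → Fq}
    (ha : a j = 0) : x j - ∑ k, a k • x k ≠ 0 := by
  intro h
  have h1 : ∑ k, Function.update (-a) j 1 k • x k = 0 := by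
    rw [sum_update_smul (by simp [ha])]
    simpa [sub_eq_add_neg] using h
  have := Fintype.linearIndependent_iff.1 hli _ h1 j
  simp at this

/-- A basis sorted by norm is orthogonal if the product of the norms is extremal. -/
theorem isOrtho_of_prod_eq (hmono : Monotone fun i => ‖x i‖) (hli : LinearIndependent Fq x)
    (h : ∏ l ∈ Finset.range r, normSeq x l ^ (Fintype.card Fq ^ l * (Fintype.card Fq - 1)) =
      ‖mooreCoeff Fq (pivot Fq x) r 0‖) : IsOrtho Fq x := by
  refine isOrtho_of_norm_sub hmono fun j a ha => ?_
  have ha' : a ∈ coordSet Fq (below r j) := ha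
  by_contra! hlt
  have hpos : ∀ l < r, 0 < ‖pivot Fq x l‖ := by
    intro l hl
    rw [pivot, dif_pos hl, shiftProd, norm_pos_iff, Finset.prod_ne_zero_iff]
    intro b hb
    exact sub_sum_ne_zero hli (mem_coordSet.1 hb _ (by simp [mem_below]))
  -- A single combination that shortens `x j` makes one factor of its pivot strictly smaller. The
  -- constant coefficient has norm exactly the product of the pivot norms to the power `q - 1`, so
  -- it would fall below the assumed value.
  have hj : ‖pivot Fq x j‖ < normSeq x j ^ Fintype.card Fq ^ (j : ℕ) := by
    rw [pivot, dif_pos j.2, shiftProd, norm_prod, normSeq, dif_pos j.2]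
    rw [← prod_coordSet_below (Fq := Fq) j.2.le]
    refine Finset.prod_lt_prod (fun b hb => ?_)
      (fun b hb => norm_sub_le_of_below hmono j hb) ⟨a, ha', hlt⟩
    rw [norm_pos_iff]
    exact sub_sum_ne_zero hli (mem_coordSet.1 hb _ (by simp [mem_below]))
  refine absurd h (ne_of_gt ?_)
  rw [norm_mooreCoeff_zero]
  have hq : Fintype.card Fq - 1 ≠ 0 := Nat.sub_ne_zero_of_lt Fintype.one_lt_card
  refine Finset.prod_lt_prod (fun l hl => pow_pos (hpos l (Finset.mem_range.1 hl)) _)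
    (fun l hl => ?_) ⟨j, Finset.mem_range.2 j.2, ?_⟩
  · rw [pow_mul]
    exact pow_le_pow_left₀ (norm_nonneg _) (norm_pivot_le hmono (Finset.mem_range.1 hl)) _
  · rw [pow_mul]
    exact pow_lt_pow_left₀ hj (norm_nonneg _) hq

end Sorted

/-! ### The action of `𝕂[τ]` and of `φ` on `𝕂` -/

section Action

variable {Fq : Type*} [Field Fq] [Fintype Fq]

theorem frob_pow_apply (n : ℕ) (s : KK Fq) : (frob Fq ^ n) s = s ^ Fintype.card Fq ^ n := by
  induction n with
  | zero => simp
  | succ n ih =>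
    rw [pow_succ', AlgHom.mul_apply, ih, pow_succ, pow_mul]
    rfl

theorem kkFrob_iterate (n : ℕ) (s : KK Fq) :
    (SkewPolynomial.φ^[n] s : KK Fq) = s ^ Fintype.card Fq ^ n := by
  rw [SkewPolynomial.φ_iterate_apply]
  exact frob_pow_apply n s

theorem evalTau_eq_sum {Δ : KTau Fq} {n : ℕ}
    (h : ∀ i, n < i → SkewPolynomial.coeff Δ i = 0) (y : KK Fq) :
    evalTau Δ y = ∑ i ∈ Finset.range (n + 1),
      SkewPolynomial.coeff Δ i * y ^ Fintype.card Fq ^ i := by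
  rw [evalTau]
  refine SkewPolynomial.sum_eq_of_subset _ (fun i => zero_mul _) fun i hi => ?_
  rw [SkewPolynomial.mem_support_iff] at hi
  rw [Finset.mem_range]
  by_contra hlt
  exact hi (h i (by omega))

theorem evalTau_zero (y : KK Fq) : evalTau (0 : KTau Fq) y = 0 := by
  rw [evalTau, SkewPolynomial.sum_zero_index]

theorem evalTau_add (Δ Δ' : KTau Fq) (y : KK Fq) :
    evalTau (Δ + Δ') y = evalTau Δ y + evalTau Δ' y :=
  SkewPolynomial.sum_add_index _ _ _ (fun _ => zero_mul _) fun _ _ _ => add_mul _ _ _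

theorem evalTau_monomial (n : ℕ) (b y : KK Fq) :
    evalTau (SkewPolynomial.monomial n b : KTau Fq) y = b * y ^ Fintype.card Fq ^ n :=
  SkewPolynomial.sum_monomial_index (n := n) (zero_mul _)

theorem evalTau_one (y : KK Fq) : evalTau (1 : KTau Fq) y = y := by
  rw [← SkewPolynomial.monomial_zero_one, evalTau_monomial]
  simp

theorem evalTau_monomial_mul (n : ℕ) (b : KK Fq) (Δ : KTau Fq) (y : KK Fq) :
    evalTau (SkewPolynomial.monomial n b * Δ) y = b * evalTau Δ y ^ Fintype.card Fq ^ n := by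
  induction Δ using SkewPolynomial.induction with
  | h0 =>
    rw [mul_zero, evalTau_zero, zero_pow (pow_ne_zero _ Fintype.card_ne_zero), mul_zero]
  | ha m s Δ _ _ ih =>
    rw [mul_add, evalTau_add, ih, evalTau_add, add_pow_card_pow, mul_add,
      SkewPolynomial.monomial_mul_monomial, evalTau_monomial, evalTau_monomial, kkFrob_iterate,
      mul_pow, ← pow_mul, ← pow_add, add_comm m n, mul_assoc]

theorem evalTau_mul (Δ Δ' : KTau Fq) (y : KK Fq) :
    evalTau (Δ * Δ') y = evalTau Δ (evalTau Δ' y) := by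
  induction Δ using SkewPolynomial.induction with
  | h0 => rw [zero_mul, evalTau_zero, evalTau_zero]
  | ha m s Δ _ _ ih =>
    rw [add_mul, evalTau_add, ih, evalTau_add, evalTau_monomial_mul, evalTau_monomial]

namespace DrinfeldModule

variable {r : ℕ} (φ : DrinfeldModule Fq r)

theorem isAdditivePoly_act : IsAdditivePoly Fq r φ.A (φ.act Polynomial.X) :=
  fun y => evalTau_eq_sum φ.coeff_gt y

theorem act_one (y : KK Fq) : φ.act 1 y = y := by
  rw [act, map_one, evalTau_one]

theorem act_mul (a b : Fq[X]) (y : KK Fq) : φ.act (a * b) y = φ.act a (φ.act b y) := by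
  rw [act, map_mul, evalTau_mul]; rfl

theorem act_pow_succ (k : ℕ) (y : KK Fq) :
    φ.act (Polynomial.X ^ (k + 1)) y = φ.act Polynomial.X (φ.act (Polynomial.X ^ k) y) := by
  rw [pow_succ', act_mul]

theorem A_zero : φ.A 0 = theta Fq := φ.coeff_zero

theorem theta_ne_zero : theta Fq ≠ 0 := by
  rw [← norm_ne_zero_iff, norm_theta]
  exact_mod_cast Fintype.card_ne_zero

theorem A_zero_ne_zero : φ.A 0 ≠ 0 := by
  rw [A_zero]; exact theta_ne_zero

theorem A_rank_ne_zero : φ.A r ≠ 0 := φ.coeff_rank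

theorem torsion_eq_ker : φ.torsion Polynomial.X = (φ.isAdditivePoly_act.ker : Set (KK Fq)) := rfl

end DrinfeldModule

end Action

end DrinfeldRAT

namespace DrinfeldRAT

/-! ### The Newton polygon of `φ_t`, strict bases and division points -/

namespace DrinfeldModule

variable {Fq : Type*} [Field Fq] [Fintype Fq] {r : ℕ} (φ : DrinfeldModule Fq r)

theorem one_lt_card_real : (1 : ℝ) < Fintype.card Fq := by
  exact_mod_cast Fintype.one_lt_card

theorem exists_isOrtho_basis_torsion : ∃ x : Fin r → KK Fq, LinearIndependent Fq x ∧
    (Submodule.span Fq (Set.range x) : Set (KK Fq)) = φ.torsion Polynomial.X ∧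
      IsOrtho Fq x ∧ Monotone fun i => ‖x i‖ := by
  have hfin := φ.isAdditivePoly_act.finite_ker φ.A_rank_ne_zero
  obtain ⟨x, h1, h2, h3, h4⟩ := exists_isOrtho_basis φ.isAdditivePoly_act.ker
    (φ.isAdditivePoly_act.finrank_ker φ.A_zero_ne_zero φ.A_rank_ne_zero)
  exact ⟨x, h1, by rw [h2, torsion_eq_ker], h3, h4⟩

variable {φ} {x : Fin r → KK Fq}

theorem A_eq_mooreCoeff (hli : LinearIndependent Fq x)
    (hx : ∀ i, φ.act Polynomial.X (x i) = 0) {i : ℕ} (hi : i ≤ r) :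
    φ.A i = φ.A r * mooreCoeff Fq (pivot Fq x) r i := by
  have h := isAdditivePoly_mooreCoeff (Fq := Fq) x le_rfl
  rw [below_self] at h
  exact (φ.isAdditivePoly_act.eq_mul_shiftProd hli (Fintype.card_fin r) hx
    (mooreCoeff_self _ _) h).1 i hi

theorem normSeq_pos (hli : LinearIndependent Fq x) {l : ℕ} (hl : l < r) : 0 < normSeq x l := by
  rw [normSeq, dif_pos hl, norm_pos_iff]
  exact hli.ne_zero _

theorem normSeq_le (hmono : Monotone fun i => ‖x i‖) {l m : ℕ} (hlm : l ≤ m) (hm : m < r) :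
    normSeq x l ≤ normSeq x m := by
  rw [normSeq, normSeq, dif_pos hm, dif_pos (by omega)]
  exact hmono (Fin.mk_le_mk.2 hlm)

/-- The degree `log_q |x_l|`, as a sequence. -/
def degSeq (x : Fin r → KK Fq) (l : ℕ) : ℝ := Real.logb (Fintype.card Fq) (normSeq x l)

theorem degSeq_le (hli : LinearIndependent Fq x) (hmono : Monotone fun i => ‖x i‖) {l m : ℕ}
    (hlm : l ≤ m) (hm : m < r) : degSeq x l ≤ degSeq x m :=
  Real.logb_le_logb_of_le one_lt_card_real (normSeq_pos hli (by omega)) (normSeq_le hmono hlm hm)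

theorem degSeq_coe (x : Fin r → KK Fq) (j : Fin r) : degSeq x j = deg (x j) := by
  rw [degSeq, normSeq, dif_pos j.2, deg]

/-- The exponent `q^l (q-1) = q^(l+1) - q^l` is the distance between consecutive abscissae of the
Newton polygon, so logarithms of the products are sums of slope times length. -/
theorem logb_prod_normSeq (hli : LinearIndependent Fq x) {i j : ℕ} (hj : j ≤ r) :
    Real.logb (Fintype.card Fq)
      (∏ l ∈ Finset.Ico i j, normSeq x l ^ (Fintype.card Fq ^ l * (Fintype.card Fq - 1))) =
      ∑ l ∈ Finset.Ico i j,
        ((Fintype.card Fq : ℝ) ^ (l + 1) - (Fintype.card Fq : ℝ) ^ l) * degSeq x l := by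
  rw [Real.logb_prod]
  · refine Finset.sum_congr rfl fun l _ => ?_
    rw [Real.logb_pow, degSeq]
    have : 1 ≤ Fintype.card Fq := Fintype.card_pos
    push_cast [this]
    ring
  · intro l hl
    have := normSeq_pos hli (show l < r by simp at hl; omega)
    positivity

theorem sum_Ico_card_pow {i j : ℕ} (hij : i ≤ j) :
    ∑ l ∈ Finset.Ico i j, ((Fintype.card Fq : ℝ) ^ (l + 1) - (Fintype.card Fq : ℝ) ^ l) =
      (Fintype.card Fq : ℝ) ^ j - (Fintype.card Fq : ℝ) ^ i :=
  Finset.sum_Ico_sub (fun l => (Fintype.card Fq : ℝ) ^ l) hij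

theorem card_pow_lt {i j : ℕ} (hij : i < j) :
    (Fintype.card Fq : ℝ) ^ i < (Fintype.card Fq : ℝ) ^ j :=
  pow_lt_pow_right₀ one_lt_card_real hij

theorem card_pow_succ_sub_nonneg (l : ℕ) :
    0 ≤ (Fintype.card Fq : ℝ) ^ (l + 1) - (Fintype.card Fq : ℝ) ^ l :=
  sub_nonneg.2 (card_pow_lt (Nat.lt_succ_self l)).le

/-- The points `(q^i, -deg A_i)` lie on or above the graph of a piecewise linear function with slope
`degSeq x l` on `[q^l, q^(l+1)]`. By `deg_A_eq` they lie on it at `0`, at `r` and at the jumps. -/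
theorem deg_A_le (hli : LinearIndependent Fq x) (hmono : Monotone fun i => ‖x i‖)
    (hx : ∀ i, φ.act Polynomial.X (x i) = 0) (hortho : IsOrtho Fq x) {i : ℕ} (hi : i ≤ r)
    (hA : φ.A i ≠ 0) :
    deg (φ.A i) ≤ deg (φ.A r) + ∑ l ∈ Finset.Ico i r,
      ((Fintype.card Fq : ℝ) ^ (l + 1) - (Fintype.card Fq : ℝ) ^ l) * degSeq x l := by
  have h := norm_mooreCoeff_le (w := pivot Fq x) (fun l hl => normSeq_pos hli hl)
    (fun l hl => normSeq_le hmono (Nat.le_succ l) hl)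
    (fun l hl => norm_pivot_eq hmono hortho hl) hi le_rfl
  have hA' := A_eq_mooreCoeff hli hx hi
  have hne : mooreCoeff Fq (pivot Fq x) r i ≠ 0 := by
    intro h0; rw [h0, mul_zero] at hA'; exact hA hA'
  rw [hA', deg, norm_mul, Real.logb_mul (norm_ne_zero_iff.2 φ.A_rank_ne_zero)
    (norm_ne_zero_iff.2 hne), ← logb_prod_normSeq hli le_rfl]
  exact add_le_add le_rfl
    (Real.logb_le_logb_of_le one_lt_card_real (norm_pos_iff.2 hne) h)

theorem deg_A_eq (hli : LinearIndependent Fq x) (hmono : Monotone fun i => ‖x i‖)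
    (hx : ∀ i, φ.act Polynomial.X (x i) = 0) (hortho : IsOrtho Fq x) {i : ℕ} (hi : i ≤ r)
    (hjump : ∀ k, i = k + 1 → k + 1 < r → normSeq x k < normSeq x (k + 1)) :
    φ.A i ≠ 0 ∧ deg (φ.A i) = deg (φ.A r) + ∑ l ∈ Finset.Ico i r,
      ((Fintype.card Fq : ℝ) ^ (l + 1) - (Fintype.card Fq : ℝ) ^ l) * degSeq x l := by
  have h := norm_mooreCoeff_eq (w := pivot Fq x) (fun l hl => normSeq_pos hli hl)
    (fun l hl => normSeq_le hmono (Nat.le_succ l) hl)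
    (fun l hl => norm_pivot_eq hmono hortho hl) hi le_rfl hjump
  have hpos : 0 < ‖mooreCoeff Fq (pivot Fq x) r i‖ := by
    rw [h]
    refine Finset.prod_pos fun l hl => pow_pos (normSeq_pos hli ?_) _
    simp at hl
    omega
  have hne := norm_pos_iff.1 hpos
  have hA' := A_eq_mooreCoeff hli hx hi
  refine ⟨by rw [hA']; exact mul_ne_zero φ.A_rank_ne_zero hne, ?_⟩
  rw [hA', deg, norm_mul, Real.logb_mul (norm_ne_zero_iff.2 φ.A_rank_ne_zero) hpos.ne',
    ← logb_prod_normSeq hli le_rfl, h]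
  rfl

/-- The partial sums of a monotone sequence with the given weights form a convex function. -/
theorem slope_mul_le_sum (hli : LinearIndependent Fq x) (hmono : Monotone fun i => ‖x i‖)
    {n i : ℕ} (hn : n < r) (hi : i ≤ r) :
    degSeq x n * ((Fintype.card Fq : ℝ) ^ i - (Fintype.card Fq : ℝ) ^ n) ≤
      ∑ l ∈ Finset.Ico n r,
        ((Fintype.card Fq : ℝ) ^ (l + 1) - (Fintype.card Fq : ℝ) ^ l) * degSeq x l -
      ∑ l ∈ Finset.Ico i r,
        ((Fintype.card Fq : ℝ) ^ (l + 1) - (Fintype.card Fq : ℝ) ^ l) * degSeq x l := by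
  rcases le_total n i with hni | hni
  · rw [← Finset.sum_Ico_consecutive _ hni hi, add_sub_cancel_right, ← sum_Ico_card_pow hni,
      Finset.mul_sum]
    refine Finset.sum_le_sum fun l hl => ?_
    simp only [Finset.mem_Ico] at hl
    rw [mul_comm]
    exact mul_le_mul_of_nonneg_left (degSeq_le hli hmono hl.1 (by omega))
      (card_pow_succ_sub_nonneg l)
  · rw [← Finset.sum_Ico_consecutive _ hni hn.le, sub_add_cancel_right, ← neg_sub, mul_neg,
      neg_le_neg_iff, ← sum_Ico_card_pow hni, Finset.mul_sum]
    refine Finset.sum_le_sum fun l hl => ?_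
    simp only [Finset.mem_Ico] at hl
    rw [mul_comm (degSeq x n)]
    exact mul_le_mul_of_nonneg_left (degSeq_le hli hmono hl.2.le hn)
      (card_pow_succ_sub_nonneg l)

/-- The graph in `deg_A_le` is convex because the basis is sorted, it breaks exactly where the norms
jump, and there it passes through a point of the polygon. Hence it is the lower hull, and its slopes
are the degrees of the basis vectors. -/
theorem exists_isNewtonVertices (hli : LinearIndependent Fq x) (hmono : Monotone fun i => ‖x i‖)
    (hx : ∀ i, φ.act Polynomial.X (x i) = 0) (hortho : IsOrtho Fq x) :
    ∃ (s : ℕ) (d : Fin (s + 1) → ℕ), φ.IsNewtonVertices s d ∧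
      ∀ (k : Fin s) (j : Fin r), d k.castSucc ≤ (j : ℕ) → (j : ℕ) < d k.succ →
        deg (x j) = φ.slope (d k.castSucc) (d k.succ) := by
  classical
  -- The set of vertices: the jump condition is vacuous at `0` and at `r`, so both endpoints belong
  -- to it.
  let J : Finset ℕ := (Finset.range (r + 1)).filter fun i =>
    ∀ k, i = k + 1 → k + 1 < r → normSeq x k < normSeq x (k + 1)
  have hJ : ∀ {i}, i ∈ J ↔ i ≤ r ∧ ∀ k, i = k + 1 → k + 1 < r →
      normSeq x k < normSeq x (k + 1) := by
    intro i
    simp only [J, Finset.mem_filter, Finset.mem_range, Nat.lt_succ_iff]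
  have h0 : 0 ∈ J := hJ.2 ⟨Nat.zero_le _, fun k hk => by omega⟩
  have hr : r ∈ J := hJ.2 ⟨le_rfl, fun k hk hk' => by omega⟩
  obtain ⟨s, hs⟩ : ∃ s, J.card = s + 1 :=
    ⟨J.card - 1, by have := Finset.card_pos.2 ⟨0, h0⟩; omega⟩
  let d : Fin (s + 1) → ℕ := J.orderEmbOfFin hs
  have hd : StrictMono d := (J.orderEmbOfFin hs).strictMono
  have hdJ : ∀ k, d k ∈ J := fun k => J.orderEmbOfFin_mem hs k
  have hsurj : ∀ i ∈ J, ∃ k, d k = i := by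
    intro i hi
    have : i ∈ Set.range (J.orderEmbOfFin hs) := by rw [Finset.range_orderEmbOfFin]; exact hi
    exact this
  have hdr : ∀ k, d k ≤ r := fun k => (hJ.1 (hdJ k)).1
  have hfirst : d 0 = 0 := by
    obtain ⟨k, hk⟩ := hsurj 0 h0
    have := hd.monotone (Fin.zero_le k)
    omega
  have hlast : d (Fin.last s) = r := by
    obtain ⟨k, hk⟩ := hsurj r hr
    have := hd.monotone (Fin.le_last k)
    have := hdr (Fin.last s)
    omega
  have hstep : ∀ k : Fin s, d k.castSucc < d k.succ := fun k => hd (Fin.castSucc_lt_succ)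
  have hconst : ∀ (k : Fin s) (l : ℕ), d k.castSucc ≤ l → l < d k.succ →
      normSeq x l = normSeq x (d k.castSucc) := by
    intro k l hl
    induction l, hl using Nat.le_induction with
    | base => intro _; rfl
    | succ l hl ih =>
      intro hlt
      rw [← ih (by omega)]
      have hlr := hdr k.succ
      have hnot : l + 1 ∉ J := by
        intro hmem
        obtain ⟨m, hm⟩ := hsurj _ hmem
        have h1 : k.castSucc < m := hd.lt_iff_lt.1 (by omega)
        have h2 : m < k.succ := hd.lt_iff_lt.1 (by omega)
        simp only [Fin.lt_def, Fin.val_castSucc, Fin.val_succ] at h1 h2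
        omega
      refine le_antisymm (not_lt.1 fun hlt2 => hnot (hJ.2 ⟨by omega, ?_⟩))
        (normSeq_le hmono (Nat.le_succ l) (by omega))
      intro k' hk' _
      obtain rfl : k' = l := by omega
      exact hlt2
  have hdeg := fun k => deg_A_eq hli hmono hx hortho (hdr k) (hJ.1 (hdJ k)).2
  have hslope : ∀ k : Fin s, φ.slope (d k.castSucc) (d k.succ) = degSeq x (d k.castSucc) := by
    intro k
    have h1 := (hdeg k.castSucc).2
    have h2 := (hdeg k.succ).2
    rw [← Finset.sum_Ico_consecutive _ (hstep k).le (hdr k.succ)] at h1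
    have h3 : ∑ l ∈ Finset.Ico (d k.castSucc) (d k.succ),
        ((Fintype.card Fq : ℝ) ^ (l + 1) - (Fintype.card Fq : ℝ) ^ l) * degSeq x l =
        ((Fintype.card Fq : ℝ) ^ d k.succ - (Fintype.card Fq : ℝ) ^ d k.castSucc) *
          degSeq x (d k.castSucc) := by
      rw [← sum_Ico_card_pow (hstep k).le, Finset.sum_mul]
      refine Finset.sum_congr rfl fun l hl => ?_
      simp only [Finset.mem_Ico] at hl
      rw [degSeq, hconst k l hl.1 hl.2, degSeq]
    have h4 := card_pow_lt (Fq := Fq) (hstep k)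
    rw [slope, div_eq_iff (by linarith)]
    rw [h3] at h1
    linarith
  refine ⟨s, d, ⟨hfirst, hlast, hd, fun k => (hdeg k).1, ?_, ?_⟩, ?_⟩
  · intro k k' hkk'
    simp only [hslope]
    have h1 : d k.succ ≤ d k'.castSucc := hd.monotone (by
      rw [Fin.le_def, Fin.val_succ, Fin.val_castSucc]; exact hkk')
    have h2 := hstep k'
    have h3 := hdr k'.succ
    have h4 := hstep k
    have h5 := (hJ.1 (hdJ k.succ)).2 (d k.succ - 1) (by omega) (by omega)
    rw [hconst k _ (by omega) (by omega), show d k.succ - 1 + 1 = d k.succ by omega] at h5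
    exact Real.logb_lt_logb one_lt_card_real (normSeq_pos hli (by omega))
      (h5.trans_le (normSeq_le hmono h1 (by omega)))
  · intro k i hi hA
    rw [hslope]
    have h1 := (hdeg k.castSucc).2
    have h2 := deg_A_le hli hmono hx hortho hi hA
    have h3 := slope_mul_le_sum hli hmono (n := d k.castSucc)
      (lt_of_lt_of_le (hstep k) (hdr _)) hi
    linarith
  · intro k j h1 h2
    rw [hslope, ← degSeq_coe, degSeq, hconst k j h1 h2, degSeq]

variable (φ) in
theorem exists_isStrictBasis : ∃ x : Fin r → KK Fq, φ.IsStrictBasis x := by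
  obtain ⟨x, hli, hspan, hortho, hmono⟩ := φ.exists_isOrtho_basis_torsion
  refine ⟨x, hli, hspan, exists_isNewtonVertices hli hmono (fun i => ?_) hortho⟩
  have : x i ∈ φ.torsion Polynomial.X := hspan ▸ Submodule.subset_span ⟨i, rfl⟩
  exact this

theorem IsStrictBasis.act_eq_zero (hx : φ.IsStrictBasis x) (i : Fin r) :
    φ.act Polynomial.X (x i) = 0 := by
  have : x i ∈ φ.torsion Polynomial.X := hx.span_eq ▸ Submodule.subset_span ⟨i, rfl⟩
  exact this

theorem IsNewtonVertices.exists_edge {s : ℕ} {d : Fin (s + 1) → ℕ} (h : φ.IsNewtonVertices s d)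
    {j : ℕ} (hj : j < r) : ∃ k : Fin s, d k.castSucc ≤ j ∧ j < d k.succ := by
  have key : ∀ m : Fin (s + 1), j < d m → ∃ k : Fin s, d k.castSucc ≤ j ∧ j < d k.succ := by
    intro m
    induction m using Fin.induction with
    | zero => intro h0; rw [h.first] at h0; omega
    | succ i ih =>
      intro hi
      by_cases hlt : j < d i.castSucc
      · exact ih hlt
      · exact ⟨i, by omega, hi⟩
  exact key (Fin.last s) (by rwa [h.last])

/-- Strict bases are orthogonal. -/
theorem IsStrictBasis.isOrtho (hx : φ.IsStrictBasis x) : IsOrtho Fq x := by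
  have hli := hx.linearIndependent
  obtain ⟨s, d, hd, hdeg⟩ := hx.strict
  have hmono : Monotone fun i => ‖x i‖ := by
    intro j j' hjj'
    obtain ⟨k, hk1, hk2⟩ := hd.exists_edge j.2
    obtain ⟨k', hk1', hk2'⟩ := hd.exists_edge j'.2
    have hkk' : k ≤ k' := by
      by_contra hlt
      have : d k'.succ ≤ d k.castSucc := hd.strictMono.monotone (by
        rw [Fin.le_def, Fin.val_succ, Fin.val_castSucc]; exact not_le.1 hlt)
      have : (j : ℕ) ≤ j' := hjj'
      omega
    have h1 := hd.slope_strictMono.monotone hkk'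
    rw [← hdeg k j hk1 hk2, ← hdeg k' j' hk1' hk2'] at h1
    exact (Real.logb_le_logb one_lt_card_real (norm_pos_iff.2 (hli.ne_zero j))
      (norm_pos_iff.2 (hli.ne_zero j'))).1 h1
  have hdr : ∀ k, d k ≤ r := fun k => by
    rw [← hd.last]; exact hd.strictMono.monotone (Fin.le_last k)
  -- Adding slope times length along the edges telescopes to a difference of heights. At the last
  -- vertex this gives `log_q |A_0 / A_r|`, the extremal value required by `isOrtho_of_prod_eq`.
  have hsum : ∀ m : Fin (s + 1), ∑ l ∈ Finset.Ico 0 (d m),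
      ((Fintype.card Fq : ℝ) ^ (l + 1) - (Fintype.card Fq : ℝ) ^ l) * degSeq x l =
      deg (φ.A 0) - deg (φ.A (d m)) := by
    intro m
    induction m using Fin.induction with
    | zero => simp [hd.first]
    | succ i ih =>
      have hlt : d i.castSucc < d i.succ := hd.strictMono Fin.castSucc_lt_succ
      rw [← Finset.sum_Ico_consecutive _ (Nat.zero_le _) hlt.le, ih]
      have h3 : ∑ l ∈ Finset.Ico (d i.castSucc) (d i.succ),
          ((Fintype.card Fq : ℝ) ^ (l + 1) - (Fintype.card Fq : ℝ) ^ l) * degSeq x l =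
          ((Fintype.card Fq : ℝ) ^ d i.succ - (Fintype.card Fq : ℝ) ^ d i.castSucc) *
            φ.slope (d i.castSucc) (d i.succ) := by
        rw [← sum_Ico_card_pow hlt.le, Finset.sum_mul]
        refine Finset.sum_congr rfl fun l hl => ?_
        simp only [Finset.mem_Ico] at hl
        have hlr : l < r := lt_of_lt_of_le hl.2 (hdr _)
        have := hdeg i ⟨l, hlr⟩ hl.1 hl.2
        rw [← this, ← degSeq_coe]
      have h4 := card_pow_lt (Fq := Fq) hlt
      rw [h3, slope, mul_div_cancel₀ _ (by linarith)]
      ring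
  refine isOrtho_of_prod_eq hmono hli ?_
  have hA := A_eq_mooreCoeff hli hx.act_eq_zero (Nat.zero_le r)
  have hne : mooreCoeff Fq (pivot Fq x) r 0 ≠ 0 := by
    intro h0; rw [h0, mul_zero] at hA; exact φ.A_zero_ne_zero hA
  refine Real.logb_injOn_pos (one_lt_card_real (Fq := Fq)) ?_ (norm_pos_iff.2 hne) ?_
  · exact Finset.prod_pos fun l hl => pow_pos (normSeq_pos hli (Finset.mem_range.1 hl)) _
  · have h1 := hsum (Fin.last s)
    have h2 := logb_prod_normSeq hli (i := 0) le_rfl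
    rw [hd.last] at h1
    rw [Finset.range_eq_Ico, h2, h1, hA, deg, norm_mul,
      Real.logb_mul (norm_ne_zero_iff.2 φ.A_rank_ne_zero) (norm_ne_zero_iff.2 hne), deg]
    ring

/-- With `g` choosing a small preimage under `φ_t`, the points are `ξ_j = g^(N-1)(x_j)`. Since `q ‖g
y‖ ≤ ‖y‖`, the norms decrease along the chain and `|ξ_j| ≤ q^(1-N) |x_j|`, which the bound on `N`
puts below `R_φ`. -/
theorem exists_isDivisionData (hx : φ.IsStrictBasis x) {N : ℕ} (hN : 1 ≤ N)
    (h : ∀ j, deg (x j) - Real.logb (Fintype.card Fq) φ.R + 1 < N) :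
    ∃ ξ : Fin r → KK Fq, φ.IsDivisionData x N ξ := by
  have hq := one_lt_card_real (Fq := Fq)
  choose g hg1 hg2 using fun y => φ.isAdditivePoly_act.exists_small_root φ.A_zero_ne_zero
    φ.A_rank_ne_zero y
  simp only [A_zero, norm_theta] at hg2
  have hact : ∀ (k m : ℕ) (y : KK Fq),
      φ.act (Polynomial.X ^ k) (g^[k + m] y) = g^[m] y := by
    intro k m y
    induction k generalizing m with
    | zero => simp [act_one]
    | succ k ih =>
      rw [act_pow_succ, show k + 1 + m = k + (m + 1) by ring, ih, Function.iterate_succ_apply', hg1]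
  have hnorm : ∀ (m : ℕ) (y : KK Fq), (Fintype.card Fq : ℝ) ^ m * ‖g^[m] y‖ ≤ ‖y‖ := by
    intro m y
    induction m with
    | zero => simp
    | succ m ih =>
      refine le_trans ?_ ih
      rw [pow_succ, mul_assoc, Function.iterate_succ_apply']
      exact mul_le_mul_of_nonneg_left (hg2 _) (by positivity)
  -- Nonvanishing makes the decrease of the norms strict and allows logarithms to be taken.
  have hne : ∀ (m : ℕ) (j : Fin r), g^[m] (x j) ≠ 0 := by
    intro m j h0
    have h1 := hact m 0 (x j)
    rw [add_zero, h0] at h1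
    refine hx.linearIndependent.ne_zero j ?_
    rw [← Function.iterate_zero_apply g (x j), ← h1]
    have : ∀ k, φ.act (Polynomial.X ^ k) 0 = 0 := by
      intro k
      induction k with
      | zero => rw [pow_zero, act_one]
      | succ k ih => rw [act_pow_succ, ih]; exact φ.isAdditivePoly_act.ker.zero_mem
    exact this m
  have hRpos : 0 < φ.R := Real.rpow_pos_of_pos (by rw [norm_theta]; linarith) _
  refine ⟨fun j => g^[N - 1] (x j), hN, fun j => ?_, fun j => ?_, fun j => ?_, fun j k hk => ?_⟩
  · change φ.act _ _ = 0
    have := hact (N - 1) 0 (x j)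
    rw [add_zero] at this
    rw [show N = N - 1 + 1 by omega, act_pow_succ, Nat.add_sub_cancel, this]
    exact hx.act_eq_zero j
  · have h1 := h j
    have h2 := hnorm (N - 1) (x j)
    have hpos := norm_pos_iff.2 (hne (N - 1) j)
    have h3 := Real.logb_le_logb_of_le hq (by positivity) h2
    rw [Real.logb_mul (by positivity) hpos.ne', Real.logb_pow, Real.logb_self_eq_one hq] at h3
    refine (Real.logb_lt_logb_iff hq hpos hRpos).1 ?_
    rw [deg] at h1
    push_cast [hN] at h3
    linarith
  · simpa using hact (N - 1) 0 (x j)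
  · obtain ⟨m, hm⟩ : ∃ m, N - 1 = k + 1 + m := ⟨N - 1 - (k + 1), by omega⟩
    rw [hm, hact, add_assoc, hact, add_comm 1 m, Function.iterate_succ_apply']
    have h1 := hg2 (g^[m] (x j))
    have hpos := norm_pos_iff.2 (hne (m + 1) j)
    rw [Function.iterate_succ_apply'] at hpos
    nlinarith

end DrinfeldModule

end DrinfeldRAT

namespace DrinfeldRAT

/-! ### The Gauss norm, completeness, and units of the Tate algebra -/

section GaussNorm

variable {Fq : Type*} [Field Fq] [Fintype Fq]

/-- The coefficient of `t^i`. -/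
abbrev tcoeff (i : ℕ) (f : tate Fq) : KK Fq := PowerSeries.coeff i (f : PowerSeries (KK Fq))

theorem tate_ext {f g : tate Fq} (h : ∀ i, tcoeff i f = tcoeff i g) : f = g :=
  Subtype.ext (PowerSeries.ext h)

theorem tendsto_norm_tcoeff (f : tate Fq) :
    Filter.Tendsto (fun i => ‖tcoeff i f‖) Filter.atTop (𝓝 0) :=
  (mem_tate_iff Fq _).1 f.2

theorem gaussNorm_eq_iSup (f : tate Fq) : gaussNorm f = ⨆ i, ‖tcoeff i f‖ := by
  rw [gaussNorm, PowerSeries.gaussNorm_eq]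
  simp

theorem norm_tcoeff_le (f : tate Fq) (i : ℕ) : ‖tcoeff i f‖ ≤ gaussNorm f := by
  rw [gaussNorm_eq_iSup]
  exact le_ciSup (tendsto_norm_tcoeff f).bddAbove_range i

theorem gaussNorm_le_iff {f : tate Fq} {M : ℝ} : gaussNorm f ≤ M ↔ ∀ i, ‖tcoeff i f‖ ≤ M := by
  refine ⟨fun h i => (norm_tcoeff_le f i).trans h, fun h => ?_⟩
  rw [gaussNorm_eq_iSup]
  exact ciSup_le h

/-- Since the coefficients tend to `0`, all but finitely many lie below `M / 2`, so strictness
survives the supremum. -/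
theorem gaussNorm_lt {f : tate Fq} {M : ℝ} (hM : 0 < M) (h : ∀ i, ‖tcoeff i f‖ < M) :
    gaussNorm f < M := by
  obtain ⟨n, hn⟩ := Filter.eventually_atTop.1
    ((tendsto_norm_tcoeff f).eventually (gt_mem_nhds (half_pos hM)))
  obtain ⟨m, -, hm⟩ := Finset.exists_max_image (Finset.range (n + 1)) (fun i => ‖tcoeff i f‖)
    ⟨0, by simp⟩
  refine lt_of_le_of_lt (b := max (M / 2) ‖tcoeff m f‖) (gaussNorm_le_iff.2 fun i => ?_)
    (max_lt (by linarith) (h m))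
  rcases le_total n i with hi | hi
  · exact le_max_of_le_left (hn i hi).le
  · exact le_max_of_le_right (hm i (Finset.mem_range.2 (by omega)))

theorem gaussNorm_nonneg (f : tate Fq) : 0 ≤ gaussNorm f :=
  (norm_nonneg _).trans (norm_tcoeff_le f 0)

theorem gaussNorm_zero : gaussNorm (0 : tate Fq) = 0 :=
  le_antisymm (gaussNorm_le_iff.2 fun i => by simp [tcoeff]) (gaussNorm_nonneg _)

theorem eq_zero_of_gaussNorm_le {f : tate Fq} (h : gaussNorm f ≤ 0) : f = 0 := by
  refine tate_ext fun i => ?_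
  have := gaussNorm_le_iff.1 h i
  rw [norm_le_zero_iff.1 this]
  simp [tcoeff]

theorem gaussNorm_neg (f : tate Fq) : gaussNorm (-f) = gaussNorm f := by
  simp [gaussNorm_eq_iSup, tcoeff]

theorem gaussNorm_add_le (f g : tate Fq) : gaussNorm (f + g) ≤ max (gaussNorm f) (gaussNorm g) := by
  refine gaussNorm_le_iff.2 fun i => ?_
  have : tcoeff i (f + g) = tcoeff i f + tcoeff i g := by simp [tcoeff]
  rw [this]
  exact (IsUltrametricDist.norm_add_le_max _ _).trans
    (max_le_max (norm_tcoeff_le f i) (norm_tcoeff_le g i))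

theorem gaussNorm_sub_le (f g : tate Fq) : gaussNorm (f - g) ≤ max (gaussNorm f) (gaussNorm g) := by
  rw [sub_eq_add_neg]
  exact (gaussNorm_add_le f (-g)).trans (by rw [gaussNorm_neg])

theorem gaussNorm_sum_le {ι : Type*} {s : Finset ι} {f : ι → tate Fq} {M : ℝ} (hM : 0 ≤ M)
    (h : ∀ i ∈ s, gaussNorm (f i) ≤ M) : gaussNorm (∑ i ∈ s, f i) ≤ M := by
  classical
  induction s using Finset.induction_on with
  | empty => simpa [gaussNorm_zero]
  | insert j s hj ih =>
    rw [Finset.sum_insert hj]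
    exact (gaussNorm_add_le _ _).trans (max_le (h j (Finset.mem_insert_self _ _))
      (ih fun i hi => h i (Finset.mem_insert_of_mem hi)))

theorem gaussNorm_mul_le (f g : tate Fq) : gaussNorm (f * g) ≤ gaussNorm f * gaussNorm g := by
  refine gaussNorm_le_iff.2 fun i => ?_
  have : tcoeff i (f * g) = ∑ p ∈ Finset.HasAntidiagonal.antidiagonal i, tcoeff p.1 f * tcoeff p.2 g := by
    simp [tcoeff, PowerSeries.coeff_mul]
  rw [this]
  refine IsUltrametricDist.norm_sum_le_of_forall_le_of_nonneg
    (mul_nonneg (gaussNorm_nonneg f) (gaussNorm_nonneg g)) fun p _ => ?_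
  rw [norm_mul]
  exact mul_le_mul (norm_tcoeff_le f _) (norm_tcoeff_le g _) (norm_nonneg _) (gaussNorm_nonneg f)

theorem gaussNorm_one_le : gaussNorm (1 : tate Fq) ≤ 1 := by
  refine gaussNorm_le_iff.2 fun i => ?_
  simp only [tcoeff, OneMemClass.coe_one, PowerSeries.coeff_one]
  split_ifs <;> simp

theorem gaussNorm_prod_le {ι : Type*} (s : Finset ι) (f : ι → tate Fq) :
    gaussNorm (∏ i ∈ s, f i) ≤ ∏ i ∈ s, gaussNorm (f i) := by
  classical
  induction s using Finset.induction_on with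
  | empty => simpa using gaussNorm_one_le
  | insert j s hj ih =>
    rw [Finset.prod_insert hj, Finset.prod_insert hj]
    exact (gaussNorm_mul_le _ _).trans (mul_le_mul_of_nonneg_left ih (gaussNorm_nonneg _))

theorem gaussNorm_pow_le (f : tate Fq) (n : ℕ) : gaussNorm (f ^ n) ≤ gaussNorm f ^ n := by
  induction n with
  | zero => simpa using gaussNorm_one_le
  | succ n ih =>
    rw [pow_succ, pow_succ]
    exact (gaussNorm_mul_le _ _).trans (mul_le_mul_of_nonneg_right ih (gaussNorm_nonneg _))

theorem tcoeff_twist (f : tate Fq) (i : ℕ) : tcoeff i (twist Fq f) = tcoeff i f ^ Fintype.card Fq := by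
  change PowerSeries.coeff i (PowerSeries.map (frob Fq : KK Fq →+* KK Fq) f) = _
  rw [PowerSeries.coeff_map]
  rfl

theorem gaussNorm_twist_le (f : tate Fq) : gaussNorm (twist Fq f) ≤ gaussNorm f ^ Fintype.card Fq := by
  refine gaussNorm_le_iff.2 fun i => ?_
  rw [tcoeff_twist, norm_pow]
  exact pow_le_pow_left₀ (norm_nonneg _) (norm_tcoeff_le f i) _

theorem gaussNorm_twist_pow_le (f : tate Fq) (n : ℕ) :
    gaussNorm ((twist Fq ^ n) f) ≤ gaussNorm f ^ Fintype.card Fq ^ n := by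
  induction n with
  | zero => simp
  | succ n ih =>
    rw [pow_succ' (twist Fq), pow_succ, pow_mul]
    exact (gaussNorm_twist_le _).trans (pow_le_pow_left₀ (gaussNorm_nonneg _) ih _)

/-- The Gauss norm is complete, for sequences with geometrically small increments. -/
theorem exists_gaussNorm_sub_le {f : ℕ → tate Fq} {ρ : ℝ} (h0 : 0 ≤ ρ) (h1 : ρ < 1)
    (h : ∀ n, gaussNorm (f (n + 1) - f n) ≤ ρ ^ n) :
    ∃ g : tate Fq, ∀ n, gaussNorm (f n - g) ≤ ρ ^ n := by
  -- By the ultrametric inequality a sum of increments is no larger than the largest, so the rate `ρ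
  -- ^ n` is kept without a constant.
  have hdiff : ∀ n m, gaussNorm (f (n + m) - f n) ≤ ρ ^ n := by
    intro n m
    induction m with
    | zero => simpa [gaussNorm_zero] using pow_nonneg h0 n
    | succ m ih =>
      have : f (n + (m + 1)) - f n = (f (n + m + 1) - f (n + m)) + (f (n + m) - f n) := by
        rw [← add_assoc]; abel
      rw [this]
      refine (gaussNorm_add_le _ _).trans (max_le ((h _).trans ?_) ih)
      exact pow_le_pow_of_le_one h0 h1.le (by omega)
  have hsub : ∀ (i : ℕ) (a b : tate Fq), tcoeff i (a - b) = tcoeff i a - tcoeff i b := by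
    intro i a b; simp [tcoeff]
  have hlim : ∀ i, ∃ c, Filter.Tendsto (fun n => tcoeff i (f n)) Filter.atTop (𝓝 c) := by
    intro i
    refine cauchySeq_tendsto_of_complete (cauchySeq_of_le_geometric ρ 1 h1 fun n => ?_)
    rw [dist_comm, dist_eq_norm, one_mul, ← hsub]
    exact (norm_tcoeff_le _ i).trans (h n)
  choose c hc using hlim
  have hle : ∀ n i, ‖tcoeff i (f n) - c i‖ ≤ ρ ^ n := by
    intro n i
    have ht : Filter.Tendsto (fun m => ‖tcoeff i (f n) - tcoeff i (f m)‖) Filter.atTop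
        (𝓝 ‖tcoeff i (f n) - c i‖) := (tendsto_const_nhds.sub (hc i)).norm
    refine le_of_tendsto ht ?_
    filter_upwards [Filter.eventually_ge_atTop n] with m hm
    obtain ⟨k, rfl⟩ := Nat.exists_eq_add_of_le hm
    rw [norm_sub_rev, ← hsub]
    exact (norm_tcoeff_le _ i).trans (hdiff n k)
  -- The approximation by `f n` is uniform in the coefficient index, so the decay of the
  -- coefficients passes to the limit.
  have hg : PowerSeries.mk c ∈ tate Fq := by
    rw [mem_tate_iff]
    simp only [PowerSeries.coeff_mk]
    rw [Metric.tendsto_atTop]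
    intro ε hε
    obtain ⟨n, hn⟩ := exists_pow_lt_of_lt_one hε h1
    obtain ⟨M, hM⟩ := Metric.tendsto_atTop.1 (tendsto_norm_tcoeff (f n)) ε hε
    refine ⟨M, fun i hi => ?_⟩
    have h2 := hM i hi
    rw [dist_zero_right, norm_norm] at h2 ⊢
    have : c i = tcoeff i (f n) - (tcoeff i (f n) - c i) := by abel
    rw [this]
    exact (norm_sub_le_max_of_ultra _ _).trans_lt (max_lt h2 ((hle n i).trans_lt hn))
  refine ⟨⟨_, hg⟩, fun n => gaussNorm_le_iff.2 fun i => ?_⟩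
  rw [hsub]
  simpa [tcoeff] using hle n i

theorem isUnit_one_sub_of_gaussNorm_lt {g : tate Fq} (hg : gaussNorm g < 1) : IsUnit (1 - g) := by
  obtain ⟨s, hs⟩ := exists_gaussNorm_sub_le (f := fun n => ∑ k ∈ Finset.range n, g ^ k)
    (gaussNorm_nonneg g) hg (fun n => by
      simp only [Finset.sum_range_succ, add_sub_cancel_left]
      exact gaussNorm_pow_le g n)
  refine IsUnit.of_mul_eq_one s ?_
  rw [← sub_eq_zero]
  refine eq_zero_of_gaussNorm_le (ge_of_tendsto' (tendsto_pow_atTop_nhds_zero_of_lt_one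
    (gaussNorm_nonneg g) hg) fun n => ?_)
  have h1 : (1 - g) * s - 1 =
      -(g ^ n) - (1 - g) * ((∑ k ∈ Finset.range n, g ^ k) - s) := by
    rw [mul_sub, mul_neg_geom_sum]; ring
  rw [h1]
  refine (gaussNorm_sub_le _ _).trans (max_le ?_ ?_)
  · rw [gaussNorm_neg]; exact gaussNorm_pow_le g n
  · refine (gaussNorm_mul_le _ _).trans ?_
    have h2 : gaussNorm (1 - g) ≤ 1 :=
      (gaussNorm_sub_le _ _).trans (max_le gaussNorm_one_le hg.le)
    exact (mul_le_mul h2 (hs n) (gaussNorm_nonneg _) zero_le_one).trans (by rw [one_mul])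

theorem gaussNorm_units_smul (u : ℤˣ) (f : tate Fq) : gaussNorm (u • f) = gaussNorm f := by
  rcases Int.units_eq_one_or u with rfl | rfl
  · simp
  · simp [gaussNorm_neg]

/-- The smaller factors are only required to be nonnegative, because Gauss norms of matrix entries
and factors of `shiftProd` may vanish. -/
theorem prod_lt_prod_of_exists_lt {ι : Type*} {s : Finset ι} {f g : ι → ℝ}
    (h0 : ∀ i ∈ s, 0 ≤ f i) (hg : ∀ i ∈ s, 0 < g i) (h : ∀ i ∈ s, f i ≤ g i)
    {j : ι} (hj : j ∈ s) (hlt : f j < g j) : ∏ i ∈ s, f i < ∏ i ∈ s, g i := by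
  classical
  rw [← Finset.mul_prod_erase _ _ hj, ← Finset.mul_prod_erase _ _ hj]
  refine lt_of_le_of_lt (mul_le_mul_of_nonneg_left (Finset.prod_le_prod
    (fun i hi => h0 i (Finset.mem_of_mem_erase hi))
    fun i hi => h i (Finset.mem_of_mem_erase hi)) (h0 j hj)) ?_
  exact mul_lt_mul_of_pos_right hlt
    (Finset.prod_pos fun i hi => hg i (Finset.mem_of_mem_erase hi))

theorem gaussNorm_prod_sub_one_lt {ι : Type*} (s : Finset ι) (f : ι → tate Fq)
    (h : ∀ i ∈ s, gaussNorm (f i - 1) < 1) : gaussNorm (∏ i ∈ s, f i - 1) < 1 := by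
  classical
  induction s using Finset.induction_on with
  | empty => simp [gaussNorm_zero]
  | insert j s hj ih =>
    rw [Finset.prod_insert hj]
    have h1 := h j (Finset.mem_insert_self _ _)
    have h2 := ih fun i hi => h i (Finset.mem_insert_of_mem hi)
    have h3 : f j * ∏ i ∈ s, f i - 1 =
        (f j - 1) * (∏ i ∈ s, f i - 1) + ((f j - 1) + (∏ i ∈ s, f i - 1)) := by ring
    rw [h3]
    refine (gaussNorm_add_le _ _).trans_lt (max_lt ?_ ((gaussNorm_add_le _ _).trans_lt
      (max_lt h1 h2)))
    exact (gaussNorm_mul_le _ _).trans_lt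
      (mul_lt_one_of_nonneg_of_lt_one_left (gaussNorm_nonneg _) h1 h2.le)

variable {r : ℕ}

/-- A matrix that is close to the identity for the operator norm attached to positive weights is
invertible. -/
theorem isUnit_of_weighted {M : Matrix (Fin r) (Fin r) (tate Fq)} {δ : Fin r → ℝ}
    (hδ : ∀ i, 0 < δ i) (h : ∀ l j, δ l * gaussNorm ((M - 1) l j) < δ j) : IsUnit M := by
  rw [Matrix.isUnit_iff_isUnit_det]
  have hdiag : ∀ i, gaussNorm (M i i - 1) < 1 := by
    intro i
    have := h i i
    rw [Matrix.sub_apply, Matrix.one_apply_eq] at this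
    exact (mul_lt_iff_lt_one_right (hδ i)).1 this
  have hle : ∀ l j, gaussNorm (M l j) ≤ δ j / δ l := by
    intro l j
    rcases eq_or_ne l j with rfl | hlj
    · rw [div_self (hδ l).ne', ← sub_add_cancel (M l l) 1]
      exact (gaussNorm_add_le _ _).trans (max_le (hdiag l).le gaussNorm_one_le)
    · have := h l j
      rw [Matrix.sub_apply, Matrix.one_apply_ne hlj, sub_zero] at this
      rw [le_div_iff₀ (hδ l), mul_comm]
      exact this.le
  have hdet : gaussNorm (1 - M.det) < 1 := by
    rw [← gaussNorm_neg, neg_sub, Matrix.det_apply,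
      ← Finset.add_sum_erase _ _ (Finset.mem_univ (1 : Equiv.Perm (Fin r))), add_sub_right_comm]
    refine (gaussNorm_add_le _ _).trans_lt (max_lt ?_ ?_)
    · simpa using gaussNorm_prod_sub_one_lt Finset.univ (fun i => M i i) fun i _ => hdiag i
    · have hlt : ∀ σ ∈ Finset.univ.erase (1 : Equiv.Perm (Fin r)),
          gaussNorm (Equiv.Perm.sign σ • ∏ i, M (σ i) i) < 1 := by
        intro σ hσ
        obtain ⟨i, hi⟩ : ∃ i, σ i ≠ i := by
          by_contra! hall
          exact Finset.ne_of_mem_erase hσ (Equiv.ext hall)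
        rw [gaussNorm_units_smul]
        refine (gaussNorm_prod_le _ _).trans_lt ?_
        -- The weights cancel around every permutation, so each non-identity term of the determinant
        -- has norm below `1`, while the identity term is congruent to `1`.
        have h1 : ∏ i, δ i / δ (σ i) = 1 := by
          rw [Finset.prod_div_distrib, Equiv.prod_comp σ δ,
            div_self (Finset.prod_ne_zero_iff.2 fun i _ => (hδ i).ne')]
        rw [← h1]
        refine prod_lt_prod_of_exists_lt (fun _ _ => gaussNorm_nonneg _)
          (fun i _ => div_pos (hδ _) (hδ _)) (fun i _ => hle _ _) (Finset.mem_univ i) ?_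
        have := h (σ i) i
        rw [Matrix.sub_apply, Matrix.one_apply_ne hi, sub_zero] at this
        rw [lt_div_iff₀ (hδ _), mul_comm]
        exact this
      rcases (Finset.univ.erase (1 : Equiv.Perm (Fin r))).eq_empty_or_nonempty with he | hne
      · rw [he, Finset.sum_empty, gaussNorm_zero]; exact zero_lt_one
      · obtain ⟨σ, hσ, hmax⟩ := Finset.exists_max_image _
          (fun σ : Equiv.Perm (Fin r) => gaussNorm (Equiv.Perm.sign σ • ∏ i, M (σ i) i)) hne
        exact (gaussNorm_sum_le (gaussNorm_nonneg _) hmax).trans_lt (hlt σ hσ)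
  have := isUnit_one_sub_of_gaussNorm_lt hdet
  rwa [sub_sub_cancel] at this

end GaussNorm

end DrinfeldRAT

namespace DrinfeldRAT

/-! ### Convergence of twisted infinite products -/

section TwistProd

variable {Fq : Type*} [Field Fq] [Fintype Fq] {r : ℕ}

theorem gaussNorm_matMul_le {M M' : Matrix (Fin r) (Fin r) (tate Fq)} {a b : ℝ}
    (ha : 0 ≤ a) (hb : 0 ≤ b) (hM : ∀ i j, gaussNorm (M i j) ≤ a)
    (hM' : ∀ i j, gaussNorm (M' i j) ≤ b) (i j : Fin r) : gaussNorm ((M * M') i j) ≤ a * b := by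
  rw [Matrix.mul_apply]
  exact gaussNorm_sum_le (mul_nonneg ha hb) fun k _ => (gaussNorm_mul_le _ _).trans
    (mul_le_mul (hM i k) (hM' k j) (gaussNorm_nonneg _) ha)

theorem gaussNorm_matTwist_le {M : Matrix (Fin r) (Fin r) (tate Fq)} {ρ : ℝ}
    (hM : ∀ i j, gaussNorm (M i j) ≤ ρ) (n : ℕ) (i j : Fin r) :
    gaussNorm (matTwist n M i j) ≤ ρ ^ Fintype.card Fq ^ n :=
  (gaussNorm_twist_pow_le (M i j) n).trans (pow_le_pow_left₀ (gaussNorm_nonneg _) (hM i j) _)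

theorem matTwist_mul (n : ℕ) (M M' : Matrix (Fin r) (Fin r) (tate Fq)) :
    matTwist n (M * M') = matTwist n M * matTwist n M' := Matrix.map_mul

theorem matTwist_sub (n : ℕ) (M M' : Matrix (Fin r) (Fin r) (tate Fq)) :
    matTwist n (M - M') = matTwist n M - matTwist n M' :=
  Matrix.map_sub _ (map_sub _) _ _

theorem matTwist_one (n : ℕ) : matTwist n (1 : Matrix (Fin r) (Fin r) (tate Fq)) = 1 :=
  Matrix.map_one _ (map_zero _) (map_one _)

theorem matTwist_one_matTwist (n : ℕ) (M : Matrix (Fin r) (Fin r) (tate Fq)) :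
    matTwist 1 (matTwist n M) = matTwist (n + 1) M := by
  ext i j : 2
  simp only [matTwist, Matrix.map_apply]
  rw [pow_one, pow_succ' (twist Fq) n]
  rfl

theorem twistProd_succ (F : Matrix (Fin r) (Fin r) (tate Fq)) (n : ℕ) :
    twistProd F (n + 1) = twistProd F n * matTwist n F := by
  simp [twistProd, List.range_succ]

/-- Peeling off the leftmost factor leaves a twist of the shorter product; in the limit this becomes
`P = F P^{(1)}`. -/
theorem twistProd_succ' (F : Matrix (Fin r) (Fin r) (tate Fq)) (n : ℕ) :
    twistProd F (n + 1) = F * matTwist 1 (twistProd F n) := by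
  induction n with
  | zero =>
    rw [twistProd_succ]
    have h0 : twistProd F 0 = 1 := by simp [twistProd]
    have h1 : matTwist 0 F = F := by ext i j : 2; simp [matTwist]
    rw [h0, matTwist_one, h1, one_mul, mul_one]
  | succ n ih =>
    rw [twistProd_succ F (n + 1)]
    nth_rewrite 1 [ih]
    rw [twistProd_succ F n, matTwist_mul, matTwist_one_matTwist, mul_assoc]

theorem tendsto_matNorm {M : ℕ → Matrix (Fin r) (Fin r) (tate Fq)} {ρ : ℝ} (h0 : 0 ≤ ρ)
    (h1 : ρ < 1) (h : ∀ n i j, gaussNorm (M n i j) ≤ ρ ^ n) :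
    Filter.Tendsto (fun n => matNorm (M n)) Filter.atTop (𝓝 0) :=
  squeeze_zero (fun _ => Real.iSup_nonneg fun _ => gaussNorm_nonneg _)
    (fun n => Real.iSup_le (fun ij => h n ij.1 ij.2) (pow_nonneg h0 n))
    (tendsto_pow_atTop_nhds_zero_of_lt_one h0 h1)

theorem gaussNorm_one_apply_le (i j : Fin r) :
    gaussNorm ((1 : Matrix (Fin r) (Fin r) (tate Fq)) i j) ≤ 1 := by
  rw [Matrix.one_apply]
  split_ifs
  · exact gaussNorm_one_le
  · rw [gaussNorm_zero]; exact zero_le_one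

theorem gaussNorm_apply_le_one {F : Matrix (Fin r) (Fin r) (tate Fq)} {ρ : ℝ}
    (h1 : ρ < 1) (hF : ∀ i j, gaussNorm ((F - 1) i j) ≤ ρ) (i j : Fin r) :
    gaussNorm (F i j) ≤ 1 := by
  have : F i j = (F - 1) i j + (1 : Matrix (Fin r) (Fin r) (tate Fq)) i j := by
    rw [Matrix.sub_apply, sub_add_cancel]
  rw [this]
  exact (gaussNorm_add_le _ _).trans (max_le ((hF i j).trans h1.le) (gaussNorm_one_apply_le i j))

theorem twistProd_zero (F : Matrix (Fin r) (Fin r) (tate Fq)) : twistProd F 0 = 1 := rfl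

theorem gaussNorm_twistProd_le_one {F : Matrix (Fin r) (Fin r) (tate Fq)}
    (hF : ∀ i j, gaussNorm (F i j) ≤ 1) (n : ℕ) (i j : Fin r) :
    gaussNorm (twistProd F n i j) ≤ 1 := by
  induction n generalizing i j with
  | zero => rw [twistProd_zero]; exact gaussNorm_one_apply_le i j
  | succ n ih =>
    rw [twistProd_succ]
    refine (gaussNorm_matMul_le zero_le_one zero_le_one ih (fun i j =>
      (gaussNorm_matTwist_le hF n i j).trans (by rw [one_pow])) i j).trans (by rw [one_mul])

theorem pow_card_pow_le {ρ : ℝ} (h0 : 0 ≤ ρ) (h1 : ρ < 1) (n : ℕ) :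
    ρ ^ Fintype.card Fq ^ n ≤ ρ ^ n :=
  pow_le_pow_of_le_one h0 h1.le (Nat.lt_pow_self (Fintype.one_lt_card (α := Fq))).le

theorem gaussNorm_twistProd_succ_sub_le {F : Matrix (Fin r) (Fin r) (tate Fq)} {ρ : ℝ}
    (h0 : 0 ≤ ρ) (h1 : ρ < 1) (hF : ∀ i j, gaussNorm ((F - 1) i j) ≤ ρ) (n : ℕ) (i j : Fin r) :
    gaussNorm (twistProd F (n + 1) i j - twistProd F n i j) ≤ ρ ^ n := by
  have h2 : twistProd F (n + 1) - twistProd F n = twistProd F n * matTwist n (F - 1) := by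
    rw [twistProd_succ, matTwist_sub, matTwist_one, mul_sub, mul_one]
  rw [← Matrix.sub_apply, h2]
  exact (gaussNorm_matMul_le zero_le_one (pow_nonneg h0 n)
    (gaussNorm_twistProd_le_one (gaussNorm_apply_le_one h1 hF) n) (fun i j =>
    (gaussNorm_matTwist_le hF n i j).trans (pow_card_pow_le (Fq := Fq) h0 h1 n)) i j).trans (by rw [one_mul])

theorem eq_mul_matTwist_of_tendsto {F P : Matrix (Fin r) (Fin r) (tate Fq)} {ρ : ℝ}
    (h0 : 0 ≤ ρ) (h1 : ρ < 1) (hF : ∀ i j, gaussNorm (F i j) ≤ 1)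
    (hP : ∀ n i j, gaussNorm ((twistProd F n - P) i j) ≤ ρ ^ n) : P = F * matTwist 1 P := by
  rw [← sub_eq_zero]
  refine Matrix.ext fun i j => ?_
  refine eq_zero_of_gaussNorm_le (ge_of_tendsto' (tendsto_pow_atTop_nhds_zero_of_lt_one
    h0 h1) fun n => ?_)
  have h2 : P - F * matTwist 1 P =
      F * matTwist 1 (twistProd F n - P) - (twistProd F (n + 1) - P) := by
    rw [matTwist_sub, mul_sub, twistProd_succ']; abel
  rw [h2, Matrix.sub_apply]
  refine (gaussNorm_sub_le _ _).trans (max_le ?_ ((hP (n + 1) i j).trans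
    (pow_le_pow_of_le_one h0 h1.le (Nat.le_succ n))))
  refine (gaussNorm_matMul_le zero_le_one (pow_nonneg h0 n) hF (fun i j =>
    (gaussNorm_matTwist_le (hP n) 1 i j).trans ?_) i j).trans (by rw [one_mul])
  exact pow_le_of_le_one (pow_nonneg h0 n) (pow_le_one₀ h0 h1.le)
    (pow_ne_zero 1 (Fintype.card_ne_zero (α := Fq)))

/-- All the later corrections have norm at most `ρ < 1`, so `P` is as close to the identity as `F`.
-/
theorem isUnit_of_gaussNorm_sub_lt {F P : Matrix (Fin r) (Fin r) (tate Fq)} {ρ : ℝ}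
    (h1 : ρ < 1) (hF : ∀ i j, gaussNorm ((F - 1) i j) ≤ ρ)
    (hP : ∀ i j, gaussNorm ((F - P) i j) ≤ ρ) : IsUnit P := by
  refine isUnit_of_weighted (δ := fun _ => 1) (fun _ => zero_lt_one) fun l j => ?_
  rw [one_mul]
  have h2 : P - 1 = (F - 1) - (F - P) := by abel
  rw [h2, Matrix.sub_apply]
  exact (gaussNorm_sub_le _ _).trans_lt (max_lt ((hF l j).trans_lt h1) ((hP l j).trans_lt h1))

/-- The twisted product of a matrix close to the identity converges to an invertible matrix. -/
theorem exists_hasTwistProd {F : Matrix (Fin r) (Fin r) (tate Fq)} {ρ : ℝ} (h0 : 0 ≤ ρ)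
    (h1 : ρ < 1) (hF : ∀ i j, gaussNorm ((F - 1) i j) ≤ ρ) :
    ∃ P, HasTwistProd F P ∧ IsUnit P ∧ P = F * matTwist 1 P := by
  choose P hP using fun i j =>
    exists_gaussNorm_sub_le (f := fun n => twistProd F n i j) h0 h1 (fun n => gaussNorm_twistProd_succ_sub_le h0 h1 hF n i j)
  have hPn : ∀ n i j, gaussNorm ((twistProd F n - Matrix.of P) i j) ≤ ρ ^ n := fun n i j => by
    rw [Matrix.sub_apply, Matrix.of_apply]; exact hP i j n
  have hone : twistProd F 1 = F := by
    rw [twistProd_succ', twistProd_zero, matTwist_one, mul_one]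
  refine ⟨Matrix.of P, tendsto_matNorm h0 h1 hPn, isUnit_of_gaussNorm_sub_lt h1 hF fun i j => ?_,
    eq_mul_matTwist_of_tendsto h0 h1 (gaussNorm_apply_le_one h1 hF) hPn⟩
  have := hPn 1 i j
  rwa [hone, pow_one] at this

end TwistProd

end DrinfeldRAT

namespace DrinfeldRAT

/-! ### Lagrange polynomials dual to an orthogonal family -/

section Dual

variable {Fq K : Type*} [Field Fq] [Fintype Fq] [NormedField K] [Algebra Fq K]
  [IsUltrametricDist K] {r : ℕ} {x : Fin r → K}

theorem IsOrtho.le_norm_sub (hx : IsOrtho Fq x) {j : Fin r} {a : Fin r → Fq} (haj : a j = 0)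
    {i : Fin r} (hi : i = j ∨ a i ≠ 0) : ‖x i‖ ≤ ‖x j - ∑ k, a k • x k‖ := by
  have h := hx (Function.update (-a) j 1) i (by
    rcases eq_or_ne i j with rfl | hij
    · simp
    · simpa [hij] using hi)
  rw [sum_update_smul (by simp [haj])] at h
  simpa [sub_eq_add_neg] using h

/-- Exchanging the coordinates `k` and `l` matches combinations avoiding `x k` with combinations
avoiding `x l`. The only vector that the exchange loses is `x l`, and it reappears as the leading
term on the right. -/
theorem IsOrtho.norm_sum_le_norm_sub_swap (hx : IsOrtho Fq x) {k : Fin r} (l : Fin r)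
    {a : Fin r → Fq} (ha : a k = 0) :
    ‖∑ i, a i • x i‖ ≤ ‖x l - ∑ i, a (Equiv.swap k l i) • x i‖ := by
  refine norm_sum_smul_le (norm_nonneg _) fun i hi => ?_
  refine hx.le_norm_sub (a := fun i => a (Equiv.swap k l i)) (by simpa using ha) ?_
  by_cases hil : i = l
  · exact Or.inl hil
  · have hik : i ≠ k := by rintro rfl; exact hi ha
    exact Or.inr (by simpa [Equiv.swap_apply_of_ne_of_ne hik hil] using hi)

theorem mem_coordSet_erase {l : Fin r} {a : Fin r → Fq} :
    a ∈ coordSet Fq (Finset.univ.erase l) ↔ a l = 0 := by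
  simp [mem_coordSet]

theorem prod_coordSet_swap {M : Type*} [CommMonoid M] (k l : Fin r) (f : (Fin r → Fq) → M) :
    ∏ a ∈ coordSet Fq (Finset.univ.erase k), f (fun i => a (Equiv.swap k l i)) =
      ∏ a ∈ coordSet Fq (Finset.univ.erase l), f a := by
  refine Finset.prod_nbij' (fun a i => a (Equiv.swap k l i)) (fun a i => a (Equiv.swap k l i))
    ?_ ?_ ?_ ?_ ?_
  · intro a ha
    simpa [mem_coordSet_erase] using ha
  · intro a ha
    simpa [mem_coordSet_erase] using ha
  · intro a _; simp
  · intro a _; simp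
  · intro a _; rfl

/-- After the exchange of `l` and `j` the products are compared factor by factor. The factor at `a =
0` compares `‖y‖` with `‖x j‖` and is strict. -/
theorem norm_shiftProd_erase_lt (hli : LinearIndependent Fq x) (hx : IsOrtho Fq x) (l j : Fin r)
    {y : K} (hy : ‖y‖ < ‖x j‖) :
    ‖shiftProd Fq x (Finset.univ.erase l) y‖ < ‖shiftProd Fq x (Finset.univ.erase j) (x j)‖ := by
  rw [shiftProd, shiftProd, norm_prod, norm_prod,
    ← prod_coordSet_swap l j fun a => ‖x j - ∑ i, a i • x i‖]
  have hle : ∀ a ∈ coordSet Fq (Finset.univ.erase l),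
      ‖x j‖ ≤ ‖x j - ∑ i, a (Equiv.swap l j i) • x i‖ := fun a ha =>
    hx.le_norm_sub (a := fun i => a (Equiv.swap l j i))
      (by simpa using mem_coordSet_erase.1 ha) (Or.inl rfl)
  refine prod_lt_prod_of_exists_lt (fun _ _ => norm_nonneg _)
    (fun a ha => (norm_pos_iff.2 (hli.ne_zero j)).trans_le (hle a ha)) (fun a ha => ?_)
    (zero_mem_coordSet _) (by simpa using hy)
  exact (norm_sub_le_max_of_ultra _ _).trans (max_le (hy.le.trans (hle a ha))
    (hx.norm_sum_le_norm_sub_swap j (mem_coordSet_erase.1 ha)))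

theorem norm_coeff_zero_mul_le [Infinite K] (hx : IsOrtho Fq x) (k l : Fin r) {n : ℕ} {e : ℕ → K}
    (he : IsAdditivePoly Fq n e (shiftProd Fq x (Finset.univ.erase k))) :
    ‖e 0‖ * ‖x l‖ ≤ ‖shiftProd Fq x (Finset.univ.erase l) (x l)‖ := by
  classical
  rw [he.coeff_zero_shiftProd, shiftProd, norm_prod, norm_prod,
    ← prod_coordSet_swap k l fun a => ‖x l - ∑ i, a i • x i‖,
    ← Finset.mul_prod_erase _ _ (zero_mem_coordSet _), mul_comm]
  gcongr with a ha
  · simp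
  · rw [norm_neg]
    exact hx.norm_sum_le_norm_sub_swap l (mem_coordSet_erase.1 (Finset.mem_of_mem_erase ha))

/-- Additive polynomials dual to an orthogonal family, with bounds in terms of weights `δ`. -/
theorem exists_dual_coeff [Infinite K] (hli : LinearIndependent Fq x) (hx : IsOrtho Fq x) :
    ∃ (b : Fin r → ℕ → K) (δ : Fin r → ℝ), (∀ l, 0 < δ l) ∧
      (∀ l k, ∑ i : Fin r, b l i * x k ^ Fintype.card Fq ^ (i : ℕ) = if l = k then 1 else 0) ∧
      (∀ l j y, ‖y‖ < ‖x j‖ →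
        δ l * ‖∑ i : Fin r, b l i * y ^ Fintype.card Fq ^ (i : ℕ)‖ < δ j) ∧
      ∀ k l, δ k * ‖b k 0‖ * ‖x l‖ ≤ δ l := by
  choose e _ _ he using fun l : Fin r =>
    exists_isAdditivePoly_shiftProd (Fq := Fq) x (Finset.univ.erase l)
  have hne : ∀ l, shiftProd Fq x (Finset.univ.erase l) (x l) ≠ 0 := by
    intro l
    rw [shiftProd, Finset.prod_ne_zero_iff]
    exact fun a ha => sub_sum_ne_zero hli (mem_coordSet_erase.1 ha)
  have hsum : ∀ l y, ∑ i : Fin r, e l i / shiftProd Fq x (Finset.univ.erase l) (x l) *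
      y ^ Fintype.card Fq ^ (i : ℕ) = shiftProd Fq x (Finset.univ.erase l) y /
        shiftProd Fq x (Finset.univ.erase l) (x l) := by
    intro l y
    have hcard : (Finset.univ.erase l).card + 1 = r := by
      have : 0 < r := l.pos
      rw [Finset.card_erase_of_mem (Finset.mem_univ l), Finset.card_univ, Fintype.card_fin]
      omega
    rw [he l y, hcard, Finset.sum_div, Finset.sum_range]
    exact Finset.sum_congr rfl fun i _ => by ring
  -- The Lagrange quotient vanishes at every `x k` with `k ≠ l` and is `1` at `x l`. The weight `δ
  -- l` is the norm of its denominator, so multiplying by `δ l` leaves only numerators to be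
  -- estimated.
  refine ⟨fun l i => e l i / shiftProd Fq x (Finset.univ.erase l) (x l),
    fun l => ‖shiftProd Fq x (Finset.univ.erase l) (x l)‖, fun l => norm_pos_iff.2 (hne l),
    fun l k => ?_, fun l j y hy => ?_, fun k l => ?_⟩
  · rw [hsum]
    split_ifs with h
    · rw [h, div_self (hne k)]
    · rw [shiftProd_self (by simpa using Ne.symm h), zero_div]
  · rw [hsum, norm_div, mul_div_cancel₀ _ (norm_ne_zero_iff.2 (hne l))]
    exact norm_shiftProd_erase_lt hli hx l j hy
  · rw [norm_div, mul_div_cancel₀ _ (norm_ne_zero_iff.2 (hne k))]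
    exact norm_coeff_zero_mul_le hx k l (he k)

end Dual

/-! ### Linear systems close to the identity -/

section LinearSystem

variable {Fq : Type*} [Field Fq] [Fintype Fq] {r : ℕ}

/-- If the largest weighted entry `u k` exceeded `M`, then in `u k = c k - ∑ j, (U - 1) k j * u j`
both terms on the right would be strictly smaller than `u k`, against the ultrametric inequality. -/
theorem weighted_solution_le {U : Matrix (Fin r) (Fin r) (tate Fq)} {δ : Fin r → ℝ}
    (hδ : ∀ i, 0 < δ i) (h : ∀ l j, δ l * gaussNorm ((U - 1) l j) < δ j)
    {u c : Fin r → tate Fq} (hu : ∀ l, ∑ j, U l j * u j = c l) {M : ℝ} (hM : 0 ≤ M)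
    (hc : ∀ l, δ l * gaussNorm (c l) ≤ M) (l : Fin r) : δ l * gaussNorm (u l) ≤ M := by
  have hr : Nonempty (Fin r) := ⟨l⟩
  obtain ⟨k, hk⟩ := Finite.exists_max fun l => δ l * gaussNorm (u l)
  refine (hk l).trans ?_
  by_contra! hlt
  have hu' : u k = c k - ∑ j, (U - 1) k j * u j := by
    rw [← hu k]
    simp only [Matrix.sub_apply, sub_mul, Finset.sum_sub_distrib]
    simp [Matrix.one_apply]
  have hsum : gaussNorm (∑ j, (U - 1) k j * u j) < gaussNorm (u k) := by
    have hpos : 0 < gaussNorm (u k) := by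
      refine pos_of_mul_pos_right (hM.trans_lt hlt) (hδ k).le
    have hterm : ∀ j, gaussNorm ((U - 1) k j * u j) < gaussNorm (u k) := by
      intro j
      refine (gaussNorm_mul_le _ _).trans_lt ?_
      rcases (gaussNorm_nonneg (u j)).eq_or_lt with h0 | h0
      · rwa [← h0, mul_zero]
      · refine lt_of_mul_lt_mul_left ?_ (hδ k).le
        rw [← mul_assoc]
        exact (mul_lt_mul_of_pos_right (h k j) h0).trans_le (hk j)
    obtain ⟨j, hj⟩ := Finite.exists_max fun j => gaussNorm ((U - 1) k j * u j)
    exact (gaussNorm_sum_le (gaussNorm_nonneg _) fun i _ => hj i).trans_lt (hterm j)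
  have h1 := gaussNorm_sub_le (c k) (∑ j, (U - 1) k j * u j)
  rw [← hu'] at h1
  rcases le_max_iff.1 h1 with h2 | h2
  · exact absurd ((mul_le_mul_of_nonneg_left h2 (hδ k).le).trans (hc k)) (not_le.2 hlt)
  · exact absurd h2 (not_le.2 hsum)

end LinearSystem

end DrinfeldRAT

namespace DrinfeldRAT

/-! ### Polynomials inside the Tate algebra -/

section Tate

variable {Fq : Type*} [Field Fq] [Fintype Fq]

theorem tcoeff_polyToTate (p : (KK Fq)[X]) (i : ℕ) : tcoeff i (polyToTate Fq p) = p.coeff i := by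
  change PowerSeries.coeff i (p : PowerSeries (KK Fq)) = _
  rw [Polynomial.coeff_coe]

theorem gaussNorm_polyToTate_C_le (c : KK Fq) : gaussNorm (polyToTate Fq (Polynomial.C c)) ≤ ‖c‖ := by
  refine gaussNorm_le_iff.2 fun i => ?_
  rw [tcoeff_polyToTate, Polynomial.coeff_C]
  split_ifs <;> simp

theorem gaussNorm_polyToTate_X_pow_le (n : ℕ) :
    gaussNorm (polyToTate Fq (Polynomial.X ^ n)) ≤ 1 := by
  refine gaussNorm_le_iff.2 fun i => ?_
  rw [tcoeff_polyToTate, Polynomial.coeff_X_pow]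
  split_ifs <;> simp

theorem twist_polyToTate (p : (KK Fq)[X]) :
    twist Fq (polyToTate Fq p) =
      polyToTate Fq (p.map (frob Fq : KK Fq →+* KK Fq)) := by
  refine tate_ext fun i => ?_
  rw [tcoeff_twist, tcoeff_polyToTate, tcoeff_polyToTate, Polynomial.coeff_map]
  rfl

theorem X_sub_C_mul_mk_eq_one {K : Type*} [Field K] {a : K} (ha : a ≠ 0) :
    ((Polynomial.X - Polynomial.C a : K[X]) : PowerSeries K) *
      PowerSeries.mk (fun i => -(a⁻¹ ^ (i + 1))) = 1 := by
  rw [Polynomial.coe_sub, Polynomial.coe_X, Polynomial.coe_C, sub_mul]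
  ext i
  rw [map_sub, PowerSeries.coeff_C_mul, PowerSeries.coeff_mk, PowerSeries.coeff_one]
  cases i with
  | zero => simp [ha]
  | succ i =>
    rw [PowerSeries.coeff_succ_X_mul, PowerSeries.coeff_mk, if_neg (Nat.succ_ne_zero i),
      pow_succ a⁻¹ (i + 1), mul_neg, mul_left_comm, mul_inv_cancel₀ ha, mul_one, sub_self]

/-- `t - θ` is invertible in `𝕋`. -/
theorem exists_inverse_X_sub_theta : ∃ v : tate Fq,
    polyToTate Fq (Polynomial.X - Polynomial.C (theta Fq)) * v = 1 ∧
      ‖theta Fq‖ * gaussNorm v ≤ 1 := by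
  have hθ : theta Fq ≠ 0 := DrinfeldModule.theta_ne_zero
  have hn : 0 < ‖theta Fq‖ := norm_pos_iff.2 hθ
  have h1 : ‖theta Fq‖⁻¹ < 1 := by
    rw [norm_theta]
    exact inv_lt_one_of_one_lt₀ (by exact_mod_cast Fintype.one_lt_card)
  have hmem : PowerSeries.mk (fun i => -((theta Fq)⁻¹ ^ (i + 1))) ∈ tate Fq := by
    rw [mem_tate_iff]
    simp only [PowerSeries.coeff_mk, norm_neg, norm_pow, norm_inv]
    exact (tendsto_pow_atTop_nhds_zero_of_lt_one (by positivity) h1).comp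
      (Filter.tendsto_add_atTop_nat 1)
  refine ⟨⟨_, hmem⟩, Subtype.ext (X_sub_C_mul_mk_eq_one hθ), ?_⟩
  rw [← le_div_iff₀' hn, one_div]
  refine gaussNorm_le_iff.2 fun i => ?_
  simp only [tcoeff, PowerSeries.coeff_mk, norm_neg, norm_pow, norm_inv]
  exact pow_le_of_le_one (by positivity) h1.le (Nat.succ_ne_zero i)

variable {r : ℕ}

theorem toTate_mul (M M' : Matrix (Fin r) (Fin r) (KK Fq)[X]) :
    toTate (M * M') = toTate M * toTate M' := Matrix.map_mul

theorem toTate_add (M M' : Matrix (Fin r) (Fin r) (KK Fq)[X]) :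
    toTate (M + M') = toTate M + toTate M' := Matrix.map_add _ (map_add _) _ _

theorem toTate_one : toTate (1 : Matrix (Fin r) (Fin r) (KK Fq)[X]) = 1 :=
  Matrix.map_one _ (map_zero _) (map_one _)

theorem toTate_sub (M M' : Matrix (Fin r) (Fin r) (KK Fq)[X]) :
    toTate (M - M') = toTate M - toTate M' := Matrix.map_sub _ (map_sub _) _ _

theorem matTwist_one_toTate (M : Matrix (Fin r) (Fin r) (KK Fq)[X]) :
    matTwist 1 (toTate M) =
      toTate (M.map (Polynomial.map (frob Fq : KK Fq →+* KK Fq))) := by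
  refine Matrix.ext fun i j => ?_
  simp only [matTwist, toTate, Matrix.map_apply, pow_one]
  exact twist_polyToTate _

end Tate

/-! ### The matrices `Θ` and `B`, and the lower bound for torsion points -/

namespace DrinfeldModule

variable {Fq : Type*} [Field Fq] [Fintype Fq] {r : ℕ} {φ : DrinfeldModule Fq r}

/-- The first index. -/
def firstIdx (φ : DrinfeldModule Fq r) : Fin r := ⟨0, φ.rank_pos⟩

theorem Theta_mul_of_lt (M : Matrix (Fin r) (Fin r) (KK Fq)[X]) {i : Fin r} (hi : (i : ℕ) + 1 < r)
    (j : Fin r) : (φ.Theta * M) i j = M ⟨i + 1, hi⟩ j := by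
  rw [Matrix.mul_apply, Finset.sum_eq_single ⟨i + 1, hi⟩]
  · simp [Theta, hi]
  · intro k _ hk
    have : (k : ℕ) ≠ i + 1 := fun h => hk (Fin.ext h)
    simp [Theta, hi, this]
  · simp

theorem Theta_last_apply {i : Fin r} (hi : ¬ (i : ℕ) + 1 < r) (k : Fin r) :
    φ.Theta i k = (if k = φ.firstIdx then Polynomial.C (φ.A r)⁻¹ * Polynomial.X else 0) -
      Polynomial.C (φ.A r)⁻¹ * Polynomial.C (φ.A k) := by
  by_cases hk : (k : ℕ) = 0
  · have : k = φ.firstIdx := Fin.ext hk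
    simp only [Theta, Matrix.of_apply, if_neg hi, if_pos hk, if_pos this]
    rw [hk, A_zero, mul_sub]
  · have : k ≠ φ.firstIdx := fun h => hk (by rw [h]; rfl)
    simp only [Theta, Matrix.of_apply, if_neg hi, if_neg hk, if_neg this]
    rw [zero_sub, div_eq_inv_mul, Polynomial.C_mul]

theorem Theta_mul_last (M : Matrix (Fin r) (Fin r) (KK Fq)[X]) {i : Fin r} (hi : ¬ (i : ℕ) + 1 < r)
    (j : Fin r) : (φ.Theta * M) i j = Polynomial.C (φ.A r)⁻¹ *
      (Polynomial.X * M φ.firstIdx j - ∑ k : Fin r, Polynomial.C (φ.A k) * M k j) := by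
  rw [Matrix.mul_apply]
  simp only [Theta_last_apply hi, sub_mul, ite_mul, zero_mul, Finset.sum_sub_distrib,
    Finset.sum_ite_eq', Finset.mem_univ, if_true]
  rw [mul_sub, Finset.mul_sum]
  simp only [mul_assoc]

/-- The coefficients of the polynomial `h_j`. -/
def divPoint (φ : DrinfeldModule Fq r) (N : ℕ) (ξ : KK Fq) (m : ℕ) : KK Fq :=
  if m < N then φ.act (Polynomial.X ^ (N - 1 - m)) ξ else 0

theorem coeff_h (N : ℕ) (ξ : KK Fq) (m : ℕ) : (φ.h N ξ).coeff m = φ.divPoint N ξ m := by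
  rw [h, Polynomial.finsetSum_coeff, divPoint]
  simp only [Polynomial.coeff_C_mul_X_pow, Finset.sum_ite_eq, Finset.mem_range]

theorem coeff_B (N : ℕ) (ξ : Fin r → KK Fq) (i j : Fin r) (m : ℕ) :
    (φ.B N ξ i j).coeff m = φ.divPoint N (ξ j) m ^ Fintype.card Fq ^ (i : ℕ) := by
  rw [B, Matrix.of_apply, Polynomial.coeff_map, coeff_h]
  exact frob_pow_apply _ _

theorem act_zero_right (a : Fq[X]) : φ.act a 0 = 0 := by
  rw [act, evalTau, SkewPolynomial.sum_def]
  exact Finset.sum_eq_zero fun i _ => by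
    rw [zero_pow (pow_ne_zero _ Fintype.card_ne_zero), mul_zero]

variable {N : ℕ} {x ξ : Fin r → KK Fq}

theorem IsDivisionData.divPoint_zero (hξ : φ.IsDivisionData x N ξ) (j : Fin r) :
    φ.divPoint N (ξ j) 0 = x j := by
  rw [divPoint, if_pos (Nat.lt_of_succ_le hξ.one_le), Nat.sub_zero, hξ.act_eq]

theorem IsDivisionData.norm_divPoint_lt (hξ : φ.IsDivisionData x N ξ) {j : Fin r} (hx : x j ≠ 0)
    {m : ℕ} (hm : 0 < m) : ‖φ.divPoint N (ξ j) m‖ < ‖x j‖ := by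
  rw [divPoint]
  split_ifs with h
  · rw [← hξ.act_eq j]
    have key : ∀ d, 0 < d → d ≤ N - 1 → ‖φ.act (Polynomial.X ^ (N - 1 - d)) (ξ j)‖ <
        ‖φ.act (Polynomial.X ^ (N - 1)) (ξ j)‖ := by
      intro d hd hdN
      induction d, hd using Nat.le_induction with
      | base =>
        have := hξ.norm_act_lt j (N - 1 - 1) (by omega)
        rwa [show N - 1 - 1 + 1 = N - 1 by omega] at this
      | succ d hd ih =>
        have := hξ.norm_act_lt j (N - 1 - (d + 1)) (by omega)
        rw [show N - 1 - (d + 1) + 1 = N - 1 - d by omega] at this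
        exact this.trans (ih (by omega))
    exact key m hm (by omega)
  · simpa using hx

/-- The matrix `-(t^N / A_r)` times `ξ` in the last row. -/
def defect (φ : DrinfeldModule Fq r) (N : ℕ) (ξ : Fin r → KK Fq) :
    Matrix (Fin r) (Fin r) (KK Fq)[X] :=
  Matrix.of fun i j => if (i : ℕ) + 1 < r then 0 else
    Polynomial.C (φ.A r)⁻¹ * (-(Polynomial.C (ξ j) * Polynomial.X ^ N))

theorem sum_A_mul_pow (y : KK Fq) : ∑ k : Fin r, φ.A k * y ^ Fintype.card Fq ^ (k : ℕ) =
    φ.act Polynomial.X y - φ.A r * y ^ Fintype.card Fq ^ r := by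
  rw [φ.isAdditivePoly_act y, Finset.sum_range_succ, add_sub_cancel_right, Finset.sum_range]

/-- `B^{(1)} = Θ B` up to a defect in the last row. -/
theorem map_frob_B (hξ : φ.IsDivisionData x N ξ) :
    (φ.B N ξ).map (Polynomial.map (frob Fq : KK Fq →+* KK Fq)) =
      φ.Theta * φ.B N ξ + φ.defect N ξ := by
  refine Matrix.ext fun i j => Polynomial.ext fun m => ?_
  have hl : (((φ.B N ξ).map (Polynomial.map (frob Fq : KK Fq →+* KK Fq))) i j).coeff m =
      φ.divPoint N (ξ j) m ^ Fintype.card Fq ^ ((i : ℕ) + 1) := by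
    rw [Matrix.map_apply, Polynomial.coeff_map, coeff_B, pow_succ, pow_mul]
    rfl
  rw [hl, Matrix.add_apply, Polynomial.coeff_add]
  by_cases hi : (i : ℕ) + 1 < r
  · rw [Theta_mul_of_lt _ hi, coeff_B, defect, Matrix.of_apply, if_pos hi, Polynomial.coeff_zero,
      add_zero]
  · have hir : (i : ℕ) + 1 = r := by have := i.2; omega
    have hA := φ.A_rank_ne_zero
    rw [Theta_mul_last _ hi, defect, Matrix.of_apply, if_neg hi, ← Polynomial.coeff_add, ← mul_add,
      Polynomial.coeff_C_mul, Polynomial.coeff_add, Polynomial.coeff_sub,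
      Polynomial.finsetSum_coeff, Polynomial.coeff_neg, Polynomial.coeff_C_mul_X_pow]
    simp only [Polynomial.coeff_C_mul, coeff_B]
    rw [sum_A_mul_pow, hir, eq_inv_mul_iff_mul_eq₀ hA]
    -- Multiplication by `t` shifts the coefficients of `h_j`, which acts as `φ_t` on each of them.
    -- At `m = 0` this uses `ξ_j ∈ φ[t^N]`, and at `m = N` the last coefficient `ξ_j` is left over;
    -- it is the source of the defect.
    have hkey : (Polynomial.X * φ.B N ξ φ.firstIdx j).coeff m =
        φ.act Polynomial.X (φ.divPoint N (ξ j) m) + if m = N then ξ j else 0 := by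
      have hN := hξ.one_le
      cases m with
      | zero =>
        rw [Polynomial.coeff_X_mul_zero, if_neg (by omega), add_zero, divPoint,
          if_pos (Nat.lt_of_succ_le hN),
          Nat.sub_zero, ← act_pow_succ, Nat.sub_add_cancel hN]
        exact (hξ.mem_torsion j).symm
      | succ m =>
        rw [Polynomial.coeff_X_mul, coeff_B]
        simp only [firstIdx, pow_zero, pow_one]
        rcases lt_trichotomy (m + 1) N with h | h | h
        · rw [if_neg h.ne, add_zero, divPoint, divPoint, if_pos h, if_pos (show m < N by omega),
            ← act_pow_succ]
          congr 2
          omega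
        · rw [if_pos h, divPoint, divPoint, if_neg (show ¬ m + 1 < N by omega),
            if_pos (show m < N by omega), act_zero_right,
            zero_add, show N - 1 - m = 0 by omega, pow_zero, act_one]
        · rw [if_neg h.ne', divPoint, divPoint, if_neg (show ¬ m + 1 < N by omega),
            if_neg (show ¬ m < N by omega),
            act_zero_right, zero_add]
    rw [hkey]
    ring

/-- `Θ` is invertible over `𝕋`. -/
theorem isUnit_toTate_Theta (φ : DrinfeldModule Fq r) : IsUnit (toTate φ.Theta) := by
  obtain ⟨v, hv, -⟩ := exists_inverse_X_sub_theta (Fq := Fq)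
  -- `M` has first row `A_1, …, A_r` and `t - θ` below the diagonal. It is `(t - θ) Θ⁻¹` written
  -- without denominators, so it suffices to invert `t - θ`, which is possible in `𝕋` because `|θ| >
  -- 1`.
  let M : Matrix (Fin r) (Fin r) (KK Fq)[X] := Matrix.of fun i j =>
    if (i : ℕ) = 0 then Polynomial.C (φ.A (j + 1)) else
      if (j : ℕ) + 1 = i then Polynomial.X - Polynomial.C (theta Fq) else 0
  have hM : φ.Theta * M = (Polynomial.X - Polynomial.C (theta Fq)) • 1 := by
    refine Matrix.ext fun i j => ?_
    rw [Matrix.smul_apply, smul_eq_mul]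
    by_cases hi : (i : ℕ) + 1 < r
    · rw [Theta_mul_of_lt _ hi]
      simp only [M, Matrix.of_apply, if_neg (Nat.succ_ne_zero _)]
      rcases eq_or_ne i j with rfl | hij
      · simp
      · have : ¬ (j : ℕ) + 1 = i + 1 := fun h => hij (Fin.ext (by omega))
        rw [if_neg this, Matrix.one_apply_ne hij, mul_zero]
    · have hir : (i : ℕ) + 1 = r := by have := i.2; omega
      have hA : Polynomial.C (φ.A r)⁻¹ * Polynomial.C (φ.A r) = 1 := by
        rw [← Polynomial.C_mul, inv_mul_cancel₀ φ.A_rank_ne_zero, Polynomial.C_1]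
      have hsum : ∑ k : Fin r, Polynomial.C (φ.A k) * M k j =
          Polynomial.C (theta Fq) * Polynomial.C (φ.A (j + 1)) + if i = j then 0 else
            Polynomial.C (φ.A (j + 1)) * (Polynomial.X - Polynomial.C (theta Fq)) := by
        rw [← Finset.add_sum_erase _ _ (Finset.mem_univ φ.firstIdx)]
        congr 1
        · simp [M, firstIdx, A_zero]
        · split_ifs with hij
          · refine Finset.sum_eq_zero fun k hk => ?_
            have h0 : ¬ (k : ℕ) = 0 := fun h => Finset.ne_of_mem_erase hk (Fin.ext h)
            have h1 : ¬ (j : ℕ) + 1 = k := by rw [← hij, hir]; exact k.2.ne'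
            simp only [M, Matrix.of_apply, if_neg h0, if_neg h1, mul_zero]
          · have hj : (j : ℕ) + 1 < r := by
              have : (i : ℕ) ≠ j := fun h => hij (Fin.ext h)
              have := j.2
              omega
            rw [Finset.sum_eq_single ⟨j + 1, hj⟩]
            · simp [M]
            · intro k hk hkj
              have h0 : ¬ (k : ℕ) = 0 := fun h => Finset.ne_of_mem_erase hk (Fin.ext h)
              have h1 : ¬ (j : ℕ) + 1 = k := fun h => hkj (Fin.ext h.symm)
              simp only [M, Matrix.of_apply, if_neg h0, if_neg h1, mul_zero]
            · intro h
              refine absurd (Finset.mem_erase.2 ⟨fun h => ?_, Finset.mem_univ _⟩) h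
              simpa [firstIdx] using congrArg Fin.val h
      rw [Theta_mul_last _ hi, hsum]
      have hM0 : M φ.firstIdx j = Polynomial.C (φ.A (j + 1)) := by simp [M, firstIdx]
      rw [hM0]
      split_ifs with hij
      · rw [← hij, Matrix.one_apply_eq, mul_one, add_zero, ← sub_mul, mul_left_comm, hir, hA, mul_one]
      · rw [Matrix.one_apply_ne hij]
        ring
  rw [Matrix.isUnit_iff_isUnit_det]
  have h1 : toTate φ.Theta * (v • toTate M) = 1 := by
    rw [Matrix.mul_smul, ← toTate_mul, hM]
    refine Matrix.ext fun i j => ?_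
    rw [Matrix.smul_apply, toTate, Matrix.map_apply, Matrix.smul_apply, smul_eq_mul, smul_eq_mul,
      map_mul, ← mul_assoc, mul_comm v, hv, one_mul, ← Matrix.map_apply (f := polyToTate Fq)]
    exact congrFun (congrFun toTate_one i) j
  exact Matrix.isUnit_det_of_right_inverse h1

/-- The minimal norm of nonzero torsion points is at least `R_φ / |θ|`. -/
theorem R_le_of_act_eq_zero {y : KK Fq} (hy : y ≠ 0) (h : φ.act Polynomial.X y = 0) :
    φ.R ≤ ‖theta Fq‖ * ‖y‖ := by
  have hq := one_lt_card_real (Fq := Fq)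
  have hypos := norm_pos_iff.2 hy
  -- In a vanishing sum the linear term cannot strictly dominate, so some term of higher degree is
  -- at least as large. Taking logarithms, this says `-(1 + deg y) ≤ μ_i`.
  have hterm : ∃ i ∈ Finset.range r, ‖φ.A 0 * y‖ ≤ ‖φ.A (i + 1) * y ^ Fintype.card Fq ^ (i + 1)‖ := by
    by_contra! hlt
    have hpos : 0 < ‖φ.A 0 * y‖ := norm_pos_iff.2 (mul_ne_zero φ.A_zero_ne_zero hy)
    rw [φ.isAdditivePoly_act y, Finset.sum_range_succ', pow_zero, pow_one] at h
    have h2 : φ.A 0 * y = -∑ i ∈ Finset.range r, φ.A (i + 1) * y ^ Fintype.card Fq ^ (i + 1) :=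
      (neg_eq_of_add_eq_zero_right h).symm
    obtain ⟨i, hi, hmax⟩ := Finset.exists_max_image (Finset.range r)
      (fun i => ‖φ.A (i + 1) * y ^ Fintype.card Fq ^ (i + 1)‖) ⟨0, Finset.mem_range.2 φ.rank_pos⟩
    have h3 : ‖φ.A 0 * y‖ ≤ ‖φ.A (i + 1) * y ^ Fintype.card Fq ^ (i + 1)‖ := by
      rw [h2, norm_neg]
      exact IsUltrametricDist.norm_sum_le_of_forall_le_of_nonneg (norm_nonneg _) hmax
    exact absurd h3 (not_le.2 (hlt i hi))
  obtain ⟨i, hi, hle⟩ := hterm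
  rw [A_zero, norm_mul, norm_mul, norm_pow] at hle
  have hθ : 0 < ‖theta Fq‖ := by rw [norm_theta]; linarith
  have hAne : φ.A (i + 1) ≠ 0 := by
    intro h0
    rw [h0, norm_zero, zero_mul] at hle
    exact absurd hle (not_le.2 (by positivity))
  have hA := norm_pos_iff.2 hAne
  have hlog := Real.logb_le_logb_of_le hq (by positivity) hle
  rw [Real.logb_mul hθ.ne' hypos.ne', Real.logb_mul hA.ne' (by positivity), Real.logb_pow,
    norm_theta, Real.logb_self_eq_one hq] at hlog
  have hmu : φ.mu (i + 1) ≤ sSup (φ.mu '' {i | 1 ≤ i ∧ i ≤ r ∧ φ.A i ≠ 0}) := by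
    refine le_csSup (Set.Finite.bddAbove (Set.Finite.image _ ?_)) ⟨i + 1, ⟨?_, ?_, hAne⟩, rfl⟩
    · exact (Set.finite_Iic r).subset fun i hi => hi.2.1
    · omega
    · simpa [Nat.succ_le_iff] using hi
  have hpow : (1 : ℝ) < (Fintype.card Fq : ℝ) ^ (i + 1) := one_lt_pow₀ hq (Nat.succ_ne_zero i)
  have hge : -(1 + Real.logb (Fintype.card Fq) ‖y‖) ≤ φ.mu (i + 1) := by
    rw [mu, le_div_iff₀ (by linarith), deg]
    push_cast at hlog
    nlinarith
  rw [R]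
  calc ‖theta Fq‖ ^ (-sSup (φ.mu '' {i | 1 ≤ i ∧ i ≤ r ∧ φ.A i ≠ 0}))
      ≤ ‖theta Fq‖ ^ (1 + Real.logb (Fintype.card Fq) ‖y‖) := by
        refine Real.rpow_le_rpow_of_exponent_le (by rw [norm_theta]; exact hq.le) ?_
        linarith
    _ = ‖theta Fq‖ * ‖y‖ := by
        rw [Real.rpow_add hθ, Real.rpow_one, norm_theta,
          Real.rpow_logb (by linarith) hq.ne' hypos]

end DrinfeldModule

end DrinfeldRAT

namespace DrinfeldRAT

/-! ### Closeness of `B⁻¹ Θ⁻¹ B^{(1)}` to the identity -/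

namespace DrinfeldModule

variable {Fq : Type*} [Field Fq] [Fintype Fq] {r : ℕ} {φ : DrinfeldModule Fq r}
  {N : ℕ} {x ξ : Fin r → KK Fq}

/-- `-(t^N) ξ` in the first row. -/
def firstRow (φ : DrinfeldModule Fq r) (N : ℕ) (ξ : Fin r → KK Fq) :
    Matrix (Fin r) (Fin r) (KK Fq)[X] :=
  Matrix.of fun i j => if i = φ.firstIdx then -(Polynomial.C (ξ j) * Polynomial.X ^ N) else 0

/-- The first column of `Θ` has the single nonzero entry `(t - θ) / A_r`, in the last row. Thus
`Θ⁻¹` moves the defect to the first row and replaces the possibly small `A_r` by `t - θ`, of norm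
`|θ|`. -/
theorem Theta_mul_firstRow (φ : DrinfeldModule Fq r) (N : ℕ) (ξ : Fin r → KK Fq) :
    φ.Theta * φ.firstRow N ξ =
      (Polynomial.X - Polynomial.C (theta Fq)) • φ.defect N ξ := by
  refine Matrix.ext fun i j => ?_
  rw [Matrix.smul_apply, smul_eq_mul]
  by_cases hi : (i : ℕ) + 1 < r
  · have : (⟨i + 1, hi⟩ : Fin r) ≠ φ.firstIdx := fun h => by
      simpa [firstIdx] using congrArg Fin.val h
    rw [Theta_mul_of_lt _ hi, firstRow, defect, Matrix.of_apply, Matrix.of_apply, if_neg this,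
      if_pos hi, mul_zero]
  · rw [Theta_mul_last _ hi, defect, Matrix.of_apply, if_neg hi,
      Finset.sum_eq_single φ.firstIdx (fun k _ hk => by simp [firstRow, hk]) (by simp),
      show φ.A φ.firstIdx = theta Fq from φ.A_zero, firstRow, Matrix.of_apply, if_pos rfl]
    ring

theorem exists_Theta_mul_eq_defect (φ : DrinfeldModule Fq r) (N : ℕ) (ξ : Fin r → KK Fq) :
    ∃ Z : Matrix (Fin r) (Fin r) (tate Fq), toTate φ.Theta * Z = toTate (φ.defect N ξ) ∧
      (∀ i j, i ≠ φ.firstIdx → Z i j = 0) ∧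
      ∀ j, ‖theta Fq‖ * gaussNorm (Z φ.firstIdx j) ≤ ‖ξ j‖ := by
  obtain ⟨v, hv, hvn⟩ := exists_inverse_X_sub_theta (Fq := Fq)
  refine ⟨v • toTate (φ.firstRow N ξ), ?_, fun i j hi => ?_, fun j => ?_⟩
  · rw [Matrix.mul_smul, ← toTate_mul, Theta_mul_firstRow]
    refine Matrix.ext fun i j => ?_
    rw [Matrix.smul_apply, toTate, toTate, Matrix.map_apply, Matrix.map_apply, Matrix.smul_apply,
      smul_eq_mul, smul_eq_mul, map_mul, ← mul_assoc, mul_comm v, hv, one_mul]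
  · rw [Matrix.smul_apply, toTate, Matrix.map_apply, firstRow, Matrix.of_apply, if_neg hi, map_zero,
      smul_zero]
  · rw [Matrix.smul_apply, toTate, Matrix.map_apply, firstRow, Matrix.of_apply, if_pos rfl,
      smul_eq_mul, map_neg, mul_neg, gaussNorm_neg, map_mul]
    have h1 := gaussNorm_mul_le (polyToTate Fq (Polynomial.C (ξ j)))
      (polyToTate Fq (Polynomial.X ^ N))
    have h2 : gaussNorm (polyToTate Fq (Polynomial.C (ξ j)) * polyToTate Fq (Polynomial.X ^ N)) ≤
        ‖ξ j‖ := by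
      refine h1.trans ((mul_le_mul (gaussNorm_polyToTate_C_le _) (gaussNorm_polyToTate_X_pow_le N)
        (gaussNorm_nonneg _) (norm_nonneg _)).trans (by rw [mul_one]))
    calc ‖theta Fq‖ * gaussNorm (v * (polyToTate Fq (Polynomial.C (ξ j)) *
          polyToTate Fq (Polynomial.X ^ N)))
        ≤ ‖theta Fq‖ * (gaussNorm v * ‖ξ j‖) := by
          refine mul_le_mul_of_nonneg_left ((gaussNorm_mul_le _ _).trans
            (mul_le_mul_of_nonneg_left h2 (gaussNorm_nonneg _))) (norm_nonneg _)
      _ = (‖theta Fq‖ * gaussNorm v) * ‖ξ j‖ := by ring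
      _ ≤ 1 * ‖ξ j‖ := mul_le_mul_of_nonneg_right hvn (norm_nonneg _)
      _ = ‖ξ j‖ := one_mul _

/-- The matrix `B` is invertible over `𝕋`, and the first column of its inverse is bounded. -/
theorem isUnit_B_and_inv_le (hx : φ.IsStrictBasis x) (hξ : φ.IsDivisionData x N ξ) :
    IsUnit (toTate (φ.B N ξ)) ∧
      ∀ l, gaussNorm ((toTate (φ.B N ξ))⁻¹ l φ.firstIdx) * ‖x l‖ ≤ 1 := by
  have hli := hx.linearIndependent
  obtain ⟨b, δ, hδ, hdual, hlt, hle⟩ := exists_dual_coeff hli hx.isOrtho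
  let S : Matrix (Fin r) (Fin r) (KK Fq)[X] := Matrix.of fun l i => Polynomial.C (b l i)
  have hcoeff : ∀ l j m, ((S * φ.B N ξ) l j).coeff m =
      ∑ i : Fin r, b l i * φ.divPoint N (ξ j) m ^ Fintype.card Fq ^ (i : ℕ) := by
    intro l j m
    rw [Matrix.mul_apply, Polynomial.finsetSum_coeff]
    refine Finset.sum_congr rfl fun i _ => ?_
    rw [← coeff_B]
    exact Polynomial.coeff_C_mul _
  -- The constant coefficient of `S * B` is the identity by duality. Its higher coefficients are
  -- values of the dual polynomials at points shorter than `x j`.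
  have hsmall : ∀ l j, δ l * gaussNorm ((toTate (S * φ.B N ξ) - 1) l j) < δ j := by
    intro l j
    rw [← lt_div_iff₀' (hδ l), ← toTate_one, ← toTate_sub]
    refine gaussNorm_lt (div_pos (hδ j) (hδ l)) fun m => ?_
    rw [toTate, Matrix.map_apply, tcoeff_polyToTate, Matrix.sub_apply, Polynomial.coeff_sub, hcoeff,
      lt_div_iff₀' (hδ l)]
    rcases Nat.eq_zero_or_pos m with rfl | hm
    · rw [hξ.divPoint_zero, hdual, Matrix.one_apply]
      split_ifs <;> simp [hδ j]
    · have h1 : ((1 : Matrix (Fin r) (Fin r) (KK Fq)[X]) l j).coeff m = 0 := by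
        rw [Matrix.one_apply]
        split_ifs
        · rw [Polynomial.coeff_one, if_neg hm.ne']
        · rw [Polynomial.coeff_zero]
      rw [h1, sub_zero]
      exact hlt l j _ (hξ.norm_divPoint_lt (hli.ne_zero j) hm)
  have hU := isUnit_of_weighted hδ hsmall
  have hB : IsUnit (toTate (φ.B N ξ)) := by
    rw [toTate_mul, Matrix.isUnit_iff_isUnit_det, Matrix.det_mul] at hU
    rw [Matrix.isUnit_iff_isUnit_det]
    exact isUnit_of_mul_isUnit_right hU
  refine ⟨hB, fun l => ?_⟩
  have hdet := (Matrix.isUnit_iff_isUnit_det _).1 hB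
  -- The first column of `B⁻¹` solves a system with matrix `S * B` whose right-hand side is the
  -- first column of `S`, that is, the linear coefficients `b k 0`.
  have hsys : ∀ k, ∑ j, toTate (S * φ.B N ξ) k j * (toTate (φ.B N ξ))⁻¹ j φ.firstIdx =
      polyToTate Fq (Polynomial.C (b k 0)) := by
    intro k
    rw [← Matrix.mul_apply, toTate_mul, mul_assoc, Matrix.mul_nonsing_inv _ hdet, mul_one]
    rfl
  have hxl : 0 < ‖x l‖ := norm_pos_iff.2 (hli.ne_zero l)
  have h := weighted_solution_le hδ hsmall hsys (M := δ l / ‖x l‖) (div_pos (hδ l) hxl).le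
    (fun k => by
      rw [le_div_iff₀ hxl]
      refine le_trans ?_ (hle k l)
      exact mul_le_mul_of_nonneg_right (mul_le_mul_of_nonneg_left (gaussNorm_polyToTate_C_le _)
        (hδ k).le) hxl.le) l
  rw [le_div_iff₀ hxl, mul_assoc] at h
  exact (mul_le_iff_le_one_right (hδ l)).1 h

/-- The initial factor `B⁻¹ Θ⁻¹ B^{(1)}` is close to the identity. -/
theorem exists_gaussNorm_factor_le (hx : φ.IsStrictBasis x) (hξ : φ.IsDivisionData x N ξ) :
    ∃ ρ, 0 ≤ ρ ∧ ρ < 1 ∧ ∀ i j, gaussNorm (((toTate (φ.B N ξ))⁻¹ * (toTate φ.Theta)⁻¹ *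
      matTwist 1 (toTate (φ.B N ξ)) - 1) i j) ≤ ρ := by
  obtain ⟨hB, hinv⟩ := isUnit_B_and_inv_le hx hξ
  obtain ⟨Z, hZ, hZ0, hZn⟩ := φ.exists_Theta_mul_eq_defect N ξ
  have hBdet := (Matrix.isUnit_iff_isUnit_det _).1 hB
  have hTdet := (Matrix.isUnit_iff_isUnit_det _).1 φ.isUnit_toTate_Theta
  have hF : (toTate (φ.B N ξ))⁻¹ * (toTate φ.Theta)⁻¹ * matTwist 1 (toTate (φ.B N ξ)) - 1 =
      (toTate (φ.B N ξ))⁻¹ * Z := by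
    rw [matTwist_one_toTate, map_frob_B hξ, toTate_add, toTate_mul, ← hZ, ← mul_add, mul_assoc,
      ← mul_assoc (toTate φ.Theta)⁻¹, Matrix.nonsing_inv_mul _ hTdet, one_mul, mul_add,
      Matrix.nonsing_inv_mul _ hBdet, add_sub_cancel_left]
  have hθ : 0 < ‖theta Fq‖ := norm_pos_iff.2 theta_ne_zero
  -- Only the first row of `Z` is nonzero. Its entries have norm at most `|ξ_j| / |θ| < R_φ / |θ| ≤
  -- |x_i|`, and the entry of `B⁻¹` that multiplies them has norm at most `1 / |x_i|`.
  have hlt : ∀ p : Fin r × Fin r, gaussNorm (((toTate (φ.B N ξ))⁻¹ * Z) p.1 p.2) < 1 := by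
    rintro ⟨i, j⟩
    rw [Matrix.mul_apply, Finset.sum_eq_single φ.firstIdx
      (fun k _ hk => by rw [hZ0 k j hk, mul_zero]) (by simp)]
    refine (gaussNorm_mul_le _ _).trans_lt ?_
    have hxi : 0 < ‖x i‖ := norm_pos_iff.2 (hx.linearIndependent.ne_zero i)
    have h1 := hinv i
    have h2 := hZn j
    have h3 := (hξ.norm_lt j).trans_le
      (R_le_of_act_eq_zero (hx.linearIndependent.ne_zero i) (hx.act_eq_zero i))
    have h4 : gaussNorm (Z φ.firstIdx j) < ‖x i‖ :=
      lt_of_mul_lt_mul_left (h2.trans_lt h3) hθ.le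
    rcases (gaussNorm_nonneg ((toTate (φ.B N ξ))⁻¹ i φ.firstIdx)).eq_or_lt with h5 | h5
    · change gaussNorm ((toTate (φ.B N ξ))⁻¹ i φ.firstIdx) * gaussNorm (Z φ.firstIdx j) < 1
      rw [← h5, zero_mul]; exact zero_lt_one
    · exact (mul_lt_mul_of_pos_left h4 h5).trans_le h1
  have : Nonempty (Fin r × Fin r) := ⟨(φ.firstIdx, φ.firstIdx)⟩
  obtain ⟨p, hp⟩ := Finite.exists_max fun p : Fin r × Fin r =>
    gaussNorm (((toTate (φ.B N ξ))⁻¹ * Z) p.1 p.2)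
  refine ⟨_, gaussNorm_nonneg _, hlt p, fun i j => ?_⟩
  rw [hF]
  exact hp (i, j)

end DrinfeldModule

end DrinfeldRAT

namespace DrinfeldRAT

/-! ### The `t`-motive: degrees in `τ` and the basis `1, τ, …, τ^(r-1)` -/

section Motive

variable {Fq : Type*} [Field Fq] [Fintype Fq]

theorem coeff_sum {ι : Type*} (s : Finset ι) (a : ι → KTau Fq) (n : ℕ) :
    (∑ i ∈ s, a i).coeff n = ∑ i ∈ s, (a i).coeff n := by
  classical
  induction s using Finset.induction_on with
  | empty => simp
  | insert i s hi ih => rw [Finset.sum_insert hi, Finset.sum_insert hi, SkewPolynomial.coeff_add, ih]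

theorem coeff_smul_tau (c : KK Fq) (a : KTau Fq) (n : ℕ) : (c • a).coeff n = c * a.coeff n := rfl

theorem coeff_monomial_mul (n : ℕ) (s : KK Fq) (b : KTau Fq) (i : ℕ) :
    (SkewPolynomial.monomial n s * b).coeff i =
      if n ≤ i then s * b.coeff (i - n) ^ Fintype.card Fq ^ n else 0 := by
  induction b using SkewPolynomial.induction with
  | h0 => simp
  | ha m c b hm hc ih =>
    rw [mul_add, SkewPolynomial.coeff_add, ih, SkewPolynomial.monomial_mul_monomial,
      SkewPolynomial.coeff_monomial, SkewPolynomial.coeff_add, SkewPolynomial.coeff_monomial,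
      kkFrob_iterate]
    by_cases h : n ≤ i
    · rw [if_pos h, if_pos h, ← frob_pow_apply, ← frob_pow_apply, ← frob_pow_apply, map_add, mul_add]
      by_cases h' : m = i - n
      · rw [if_pos h', if_pos (by omega)]
      · rw [if_neg h', if_neg (by omega), map_zero, mul_zero]
    · rw [if_neg h, if_neg h, if_neg (by omega), add_zero]

/-- A twisted polynomial with leading term `c τ ^ n`, `c ≠ 0`. -/
def HasDegree (a : KTau Fq) (n : ℕ) : Prop := a.coeff n ≠ 0 ∧ ∀ i, n < i → a.coeff i = 0

theorem eq_sum_of_coeff_eq_zero {a : KTau Fq} {n : ℕ} (h : ∀ i, n < i → a.coeff i = 0) :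
    a = ∑ i ∈ Finset.range (n + 1), SkewPolynomial.monomial i (a.coeff i) := by
  refine SkewPolynomial.ext fun k => ?_
  simp only [coeff_sum, SkewPolynomial.coeff_monomial, Finset.sum_ite_eq', Finset.mem_range]
  split_ifs with hk
  · rfl
  · exact h k (by omega)

theorem HasDegree.mul {a b : KTau Fq} {m n : ℕ} (ha : HasDegree a m) (hb : HasDegree b n) :
    HasDegree (a * b) (m + n) := by
  have key (i : ℕ) : (a * b).coeff i = ∑ k ∈ Finset.range (m + 1),
      if k ≤ i then a.coeff k * b.coeff (i - k) ^ Fintype.card Fq ^ k else 0 := by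
    conv_lhs => rw [eq_sum_of_coeff_eq_zero ha.2]
    simp only [Finset.sum_mul, coeff_sum, coeff_monomial_mul]
  have hq (k : ℕ) : Fintype.card Fq ^ k ≠ 0 := pow_ne_zero _ Fintype.card_ne_zero
  refine ⟨?_, fun i hi => ?_⟩
  · rw [key, Finset.sum_eq_single_of_mem m (Finset.self_mem_range_succ m), if_pos (by omega),
      Nat.add_sub_cancel_left]
    · exact mul_ne_zero ha.1 (pow_ne_zero _ hb.1)
    · intro k hk hkm
      rw [Finset.mem_range] at hk
      rw [hb.2 _ (by omega), zero_pow (hq k), mul_zero, ite_self]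
  · rw [key]
    refine Finset.sum_eq_zero fun k hk => ?_
    rw [Finset.mem_range] at hk
    rw [hb.2 _ (by omega), zero_pow (hq k), mul_zero, ite_self]

theorem hasDegree_X_pow (n : ℕ) : HasDegree ((SkewPolynomial.X : KTau Fq) ^ n) n := by
  rw [← SkewPolynomial.monomial_one_right_eq_X_pow]
  refine ⟨?_, fun i hi => ?_⟩
  · rw [SkewPolynomial.coeff_monomial, if_pos rfl]; exact one_ne_zero
  · rw [SkewPolynomial.coeff_monomial, if_neg hi.ne]

namespace DrinfeldModule

variable {r : ℕ} (φ : DrinfeldModule Fq r)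

theorem hasDegree_toAlgHom_X : HasDegree (φ.toAlgHom Polynomial.X) r :=
  ⟨φ.coeff_rank, φ.coeff_gt⟩

theorem toAlgHom_X_eq_sum : φ.toAlgHom Polynomial.X =
    ∑ i ∈ Finset.range (r + 1), φ.A i • (SkewPolynomial.X : KTau Fq) ^ i := by
  conv_lhs => rw [eq_sum_of_coeff_eq_zero φ.coeff_gt]
  refine Finset.sum_congr rfl fun i _ => ?_
  rw [← SkewPolynomial.monomial_one_right_eq_X_pow, SkewPolynomial.smul_monomial, smul_eq_mul,
    mul_one, A]

theorem hasDegree_mulRight_pow {a : KTau Fq} {n : ℕ} (ha : HasDegree a n) (i : ℕ) :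
    HasDegree ((φ.mulRight ^ i) a) (n + r * i) := by
  induction i with
  | zero => simpa using ha
  | succ i ih =>
    rw [pow_succ', Module.End.mul_apply, Nat.mul_succ, ← add_assoc]
    exact ih.mul φ.hasDegree_toAlgHom_X

theorem hasDegree_aeval_mulRight {a : KTau Fq} {n : ℕ} (ha : HasDegree a n) {f : (KK Fq)[X]}
    (hf : f ≠ 0) :
    HasDegree (Polynomial.aeval φ.mulRight f a) (n + r * f.natDegree) := by
  have key (k : ℕ) : (Polynomial.aeval φ.mulRight f a).coeff k =
      ∑ i ∈ Finset.range (f.natDegree + 1), f.coeff i * ((φ.mulRight ^ i) a).coeff k := by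
    rw [Polynomial.aeval_eq_sum_range, LinearMap.sum_apply, coeff_sum]
    rfl
  have hr := φ.rank_pos
  refine ⟨?_, fun k hk => ?_⟩
  · rw [key, Finset.sum_eq_single_of_mem _ (Finset.self_mem_range_succ _)]
    · exact mul_ne_zero (Polynomial.leadingCoeff_ne_zero.2 hf) (φ.hasDegree_mulRight_pow ha _).1
    · intro i hi hne
      rw [Finset.mem_range] at hi
      rw [(φ.hasDegree_mulRight_pow ha i).2, mul_zero]
      have : r * i < r * f.natDegree := Nat.mul_lt_mul_of_pos_left (by omega) hr
      omega
  · rw [key]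
    refine Finset.sum_eq_zero fun i hi => ?_
    rw [Finset.mem_range] at hi
    rw [(φ.hasDegree_mulRight_pow ha i).2, mul_zero]
    have : r * i ≤ r * f.natDegree := Nat.mul_le_mul_left _ (by omega)
    omega

/-- The product `g i • τ^i` has degree `i + r deg (g i)` in `τ`. These degrees are distinct modulo
`r`, so the top one cannot cancel. -/
theorem linearIndependent_tauPowers : LinearIndependent (KK Fq)[X] φ.tauPowers := by
  classical
  rw [Fintype.linearIndependent_iff]
  intro g hg
  by_contra! hne
  obtain ⟨i₀, hi₀⟩ := hne
  let S : Finset (Fin r) := Finset.univ.filter fun i => g i ≠ 0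
  obtain ⟨j, hj, hmax⟩ := S.exists_max_image (fun i => (i : ℕ) + r * (g i).natDegree)
    ⟨i₀, by simp [S, hi₀]⟩
  have hgj : g j ≠ 0 := by simpa [S] using hj
  have hsum : ∑ i, Polynomial.aeval φ.mulRight (g i) ((SkewPolynomial.X : KTau Fq) ^ (i : ℕ)) = 0 := by
    apply (Module.AEval'.of φ.mulRight).injective
    rw [map_sum, map_zero, ← hg]
    rfl
  have hc := congrArg (fun a : KTau Fq => a.coeff ((j : ℕ) + r * (g j).natDegree)) hsum
  simp only [coeff_sum] at hc
  rw [Finset.sum_eq_single j] at hc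
  · exact (φ.hasDegree_aeval_mulRight (hasDegree_X_pow _) hgj).1 hc
  · intro i _ hij
    by_cases hgi : g i = 0
    · rw [hgi, map_zero]; rfl
    · refine (φ.hasDegree_aeval_mulRight (hasDegree_X_pow _) hgi).2 _ ?_
      refine lt_of_le_of_ne (hmax i (by simp [S, hgi])) fun h => hij ?_
      have h' := congrArg (· % r) h
      simp only [Nat.add_mul_mod_self_left, Nat.mod_eq_of_lt i.2, Nat.mod_eq_of_lt j.2] at h'
      exact Fin.ext h'
  · intro h; exact absurd (Finset.mem_univ j) h

theorem C_smul_of (c : KK Fq) (a : KTau Fq) :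
    (Polynomial.C c : (KK Fq)[X]) • Module.AEval'.of φ.mulRight a =
      Module.AEval'.of φ.mulRight (c • a) := by
  rw [map_smul]; exact Module.AEval.C_smul _ _ _

/-- For `n = m + r`, the element `t • τ^m = τ^m φ_t` has degree exactly `n`. Up to a scalar it
equals `τ^n` plus lower powers, which strong induction covers. -/
theorem X_pow_mem_span (n : ℕ) : Module.AEval'.of φ.mulRight ((SkewPolynomial.X : KTau Fq) ^ n) ∈
    Submodule.span (KK Fq)[X] (Set.range φ.tauPowers) := by
  induction n using Nat.strong_induction_on with
  | _ n ih =>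
    by_cases hn : n < r
    · exact Submodule.subset_span ⟨⟨n, hn⟩, rfl⟩
    obtain ⟨m, rfl⟩ : ∃ m, n = m + r := ⟨n - r, by omega⟩
    have hr := φ.rank_pos
    have hlow (a : KTau Fq) (ha : ∀ i, m + r ≤ i → a.coeff i = 0) :
        Module.AEval'.of φ.mulRight a ∈ Submodule.span (KK Fq)[X] (Set.range φ.tauPowers) := by
      rw [eq_sum_of_coeff_eq_zero (a := a) (n := m + r - 1) fun i hi => ha i (by omega), map_sum]
      refine Submodule.sum_mem _ fun i hi => ?_
      rw [Finset.mem_range] at hi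
      have : SkewPolynomial.monomial i (a.coeff i) =
          a.coeff i • (SkewPolynomial.X : KTau Fq) ^ i := by
        rw [← SkewPolynomial.monomial_one_right_eq_X_pow, SkewPolynomial.smul_monomial,
          smul_eq_mul, mul_one]
      rw [this, ← C_smul_of]
      exact Submodule.smul_mem _ _ (ih i (by omega))
    have hd := (hasDegree_X_pow m).mul φ.hasDegree_toAlgHom_X
    let a : KTau Fq := (SkewPolynomial.X : KTau Fq) ^ m * φ.toAlgHom Polynomial.X
    let c := a.coeff (m + r)
    have h1 : Module.AEval'.of φ.mulRight a ∈
        Submodule.span (KK Fq)[X] (Set.range φ.tauPowers) := by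
      have := Submodule.smul_mem _ (Polynomial.X : (KK Fq)[X]) (ih m (by omega))
      rwa [Module.AEval'.X_smul_of] at this
    have h2 : (SkewPolynomial.X : KTau Fq) ^ (m + r) =
        c⁻¹ • a + ((SkewPolynomial.X : KTau Fq) ^ (m + r) - c⁻¹ • a) := by abel
    rw [h2, map_add]
    refine Submodule.add_mem _ ?_ (hlow _ fun i hi => ?_)
    · rw [← C_smul_of]
      exact Submodule.smul_mem _ _ h1
    · rw [SkewPolynomial.coeff_sub, coeff_smul_tau]
      rcases hi.eq_or_lt with rfl | hi
      · rw [inv_mul_cancel₀ hd.1, ← SkewPolynomial.monomial_one_right_eq_X_pow,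
          SkewPolynomial.coeff_monomial, if_pos rfl, sub_self]
      · rw [hd.2 i hi, (hasDegree_X_pow (m + r)).2 i hi, mul_zero, sub_zero]

theorem span_tauPowers : Submodule.span (KK Fq)[X] (Set.range φ.tauPowers) = ⊤ := by
  rw [eq_top_iff]
  rintro m -
  obtain ⟨a, rfl⟩ := (Module.AEval'.of φ.mulRight).surjective m
  induction a using SkewPolynomial.induction with
  | h0 => rw [map_zero]; exact Submodule.zero_mem _
  | ha n c b hn hc ih =>
    rw [map_add]
    refine Submodule.add_mem _ ?_ ih
    have : SkewPolynomial.monomial n c = c • (SkewPolynomial.X : KTau Fq) ^ n := by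
      rw [← SkewPolynomial.monomial_one_right_eq_X_pow, SkewPolynomial.smul_monomial,
        smul_eq_mul, mul_one]
    rw [this, ← C_smul_of]
    exact Submodule.smul_mem _ _ (φ.X_pow_mem_span n)

theorem tau_tauPowers (i : Fin r) :
    φ.tau (φ.tauPowers i) = ∑ j, φ.Theta i j • φ.tauPowers j := by
  have h0 : φ.tau (φ.tauPowers i) =
      Module.AEval'.of φ.mulRight ((SkewPolynomial.X : KTau Fq) ^ ((i : ℕ) + 1)) := by
    rw [pow_succ']; rfl
  rw [h0]
  by_cases hi : (i : ℕ) + 1 < r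
  · rw [Finset.sum_eq_single (⟨(i : ℕ) + 1, hi⟩ : Fin r)]
    · rw [show φ.Theta i ⟨(i : ℕ) + 1, hi⟩ = 1 by simp [Theta, hi], one_smul]
      rfl
    · intro j _ hj
      have hj' : (j : ℕ) ≠ (i : ℕ) + 1 := fun h => hj (Fin.ext h)
      rw [show φ.Theta i j = 0 by simp [Theta, hi, hj'], zero_smul]
    · intro h; exact absurd (Finset.mem_univ _) h
  · have hir : (i : ℕ) + 1 = r := by have := i.2; omega
    have hA := φ.A_rank_ne_zero
    have hφ := φ.toAlgHom_X_eq_sum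
    rw [Finset.sum_range_succ, Finset.sum_range] at hφ
    -- As `t • 1 = φ_t`, the last row of `Θ` expresses `τ^r` by solving `φ_t = θ + A_1 τ + ⋯ + A_r
    -- τ^r` for its top term.
    have hX : (Polynomial.X : (KK Fq)[X]) • φ.tauPowers φ.firstIdx =
        Module.AEval'.of φ.mulRight (φ.toAlgHom Polynomial.X) := by
      rw [tauPowers, Module.AEval'.X_smul_of]
      congr 1
      change (SkewPolynomial.X : KTau Fq) ^ 0 * _ = _
      rw [pow_zero, one_mul]
    have hterm (j : Fin r) : φ.Theta i j • φ.tauPowers j =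
        (if j = φ.firstIdx then Module.AEval'.of φ.mulRight
          ((φ.A r)⁻¹ • φ.toAlgHom Polynomial.X) else 0) -
        Module.AEval'.of φ.mulRight
          ((φ.A r)⁻¹ • φ.A j • (SkewPolynomial.X : KTau Fq) ^ (j : ℕ)) := by
      rw [Theta_last_apply hi, sub_smul, mul_smul, ← C_smul_of φ _ (_ • _), ← C_smul_of]
      congr 1
      · split_ifs with h
        · rw [h, mul_smul, hX, C_smul_of]
        · rw [zero_smul]
      · rw [← C_smul_of]
        rfl
    simp only [hterm]
    rw [Finset.sum_sub_distrib, Finset.sum_ite_eq' Finset.univ φ.firstIdx,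
      if_pos (Finset.mem_univ _), ← map_sum, ← map_sub, ← Finset.smul_sum, ← smul_sub, hir, hφ,
      add_sub_cancel_left, inv_smul_smul₀ hA]

end DrinfeldModule

end Motive

end DrinfeldRAT

end

open DrinfeldRAT in
theorem corollaryC (Fq : Type*) [Field Fq] [Fintype Fq] (r : ℕ) (φ : DrinfeldModule Fq r) :
    -- the finite initial data exist: a strict basis of `φ[t]`, and, above each strict basis, the
    -- required `t^N`-division points as soon as `N` exceeds an explicit bound
    (∃ x : Fin r → KK Fq, φ.IsStrictBasis x) ∧
    (∀ x : Fin r → KK Fq, φ.IsStrictBasis x → ∀ N : ℕ, 1 ≤ N →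
      (∀ j, deg (x j) - Real.logb (Fintype.card Fq) φ.R + 1 < N) →
      ∃ ξ : Fin r → KK Fq, φ.IsDivisionData x N ξ) ∧
    -- every such choice of data produces a rigid analytic trivialization
    (∀ (x : Fin r → KK Fq) (N : ℕ) (ξ : Fin r → KK Fq),
      φ.IsStrictBasis x → φ.IsDivisionData x N ξ →
      ∀ B Θ : Matrix (Fin r) (Fin r) (tate Fq), B = toTate (φ.B N ξ) → Θ = toTate φ.Theta →
        IsUnit B ∧ IsUnit Θ ∧
        ∃ P PiMat : Matrix (Fin r) (Fin r) (tate Fq),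
          HasTwistProd (B⁻¹ * Θ⁻¹ * matTwist 1 B) P ∧ PiMat = B * P ∧
          IsUnit PiMat ∧ matTwist 1 PiMat = Θ * PiMat ∧
          IsRigidAnalyticTrivialization φ φ.tauPowers φ.Theta PiMat) := by
  refine ⟨DrinfeldModule.exists_isStrictBasis φ,
    fun x hx N hN h => DrinfeldModule.exists_isDivisionData hx hN h, ?_⟩
  rintro x N ξ hx hξ B Θ rfl rfl
  have hB := (DrinfeldModule.isUnit_B_and_inv_le hx hξ).1
  have hΘ := DrinfeldModule.isUnit_toTate_Theta φ
  obtain ⟨ρ, h0, h1, hρ⟩ := DrinfeldModule.exists_gaussNorm_factor_le hx hξ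
  obtain ⟨P, hP, hPu, hPe⟩ := exists_hasTwistProd h0 h1 hρ
  -- Substituting `P = B⁻¹ Θ⁻¹ B^{(1)} P^{(1)}` on the right cancels `Θ B` and leaves `B^{(1)}
  -- P^{(1)}`.
  have htw : matTwist 1 (toTate (φ.B N ξ) * P) =
      toTate φ.Theta * (toTate (φ.B N ξ) * P) := by
    conv_rhs => rw [hPe]
    rw [matTwist_mul]
    simp only [← mul_assoc]
    rw [mul_assoc (toTate φ.Theta),
      Matrix.mul_nonsing_inv _ ((Matrix.isUnit_iff_isUnit_det _).1 hB), mul_one,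
      Matrix.mul_nonsing_inv _ ((Matrix.isUnit_iff_isUnit_det _).1 hΘ), one_mul]
  exact ⟨hB, hΘ, P, _, hP, rfl, hB.mul hPu, htw, φ.linearIndependent_tauPowers, φ.span_tauPowers,
    φ.tau_tauPowers, hB.mul hPu, htw⟩
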